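/- Let $(M,\tau)$ be a II$_1$ factor with its faithful normal tracial state, $\|x\|_2=\sqrt{\tau(x^*x)}$, and let $$A\rtimes\Gamma = M = B\rtimes\Lambda$$ be two crossed product decompositions of $M$, where $\Gamma,\Lambda$ are countable groups acting by trace preserving automorphisms on the von Neumann subalgebras $A,B\subset M$. Thus there are unitaries $(u_g)_{g\in\Gamma}$ in $M$ with $u_gu_h=u_{gh}$, $u_gAu_g^*=A$, $\tau(au_g)=0$ for all $a\in A$, $g\neq e$, such that $A$ and $(u_g)_{g\in\Gamma}$ generate the von Neumann algebra $M$; similarly there are unitaries $(v_s)_{s\in\Lambda}$ for $B$ and $\Lambda$. Assume that $A$ and $B$ are amenable, i.e. for $P = A,B$ the trivial $P$-$P$-bimodule $L^2(P)$ is weakly contained in the coarse $P$-$P$-bimodule $L^2(P)\overline{\otimes}L^2(P)$. Assume that $\Gamma$ admits a non-amenable subgroup $\Gamma_0$ with the relative property (T), i.e. every unitary representation of $\Gamma$ that weakly contains the trivial representation has a non-zero $\Gamma_0$-invariant vector. Let $(\varphi_n)_{n\in\mathbb N}$ be a deformation of the identity of $M$, i.e. a sequence of normal, unital, trace preserving,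 completely positive maps $\varphi_n:M\to M$ with $\|\varphi_n(x)-x\|_2\to 0$ for every $x\in M$. Then for every $\varepsilon>0$ there exist $n\in\mathbb N$ and a sequence $(s_k)_{k\in\mathbb N}$ in $\Lambda$ such that 1. $\|\varphi_n(v_{s_k})-v_{s_k}\|_2<\varepsilon$ for all $k$; 2. the Fourier coefficients of $v_{s_k}$ with respect to $M=A\rtimes\Gamma$ tend to zero pointwise: for every $g\in\Gamma$, $\|(v_{s_k})_g\|_2\to 0$ as $k\to\infty$, where $(x)_g=E_A(xu_g^*)$ for $x\in M$ and $E_A:M\to A$ is the trace preserving conditional expectation. -/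

import Mathlib

open scoped ComplexOrder InnerProductSpace TensorProduct CStarAlgebra Pointwise Topology
open Filter

universe u v w

noncomputable section

/-! ## Groups: amenability and relative property (T) -/

/-- A discrete group is amenable if it carries a left-invariant finitely additive probability
measure defined on all of its subsets. -/
def IsAmenableGroup (G : Type v) [Group G] : Prop :=
  ∃ m : Set G → ℝ, (∀ S, 0 ≤ m S) ∧ m Set.univ = 1 ∧
    (∀ S T, Disjoint S T → m (S ∪ T) = m S + m T) ∧
    ∀ (g : G) (S : Set G), m (g • S) = m S

/-- A unitary representation of the discrete group `G` weakly contains the trivial representation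
if it has almost invariant unit vectors. -/
def HasAlmostInvariantVectors {G : Type v} [Group G] {K : Type w} [NormedAddCommGroup K]
    [InnerProductSpace ℂ K] [CompleteSpace K] (π : G →* unitary (K →L[ℂ] K)) : Prop :=
  ∀ (F : Finset G) (ε : ℝ), 0 < ε →
    ∃ ξ : K, ‖ξ‖ = 1 ∧ ∀ g ∈ F, ‖(π g : K →L[ℂ] K) ξ - ξ‖ < ε

/-- The subgroup `G₀` of the countable discrete group `G` has the relative property (T) in `G`:
every unitary representation of `G` that weakly contains the trivial representation has a nonzero
`G₀`-invariant vector. -/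
def HasRelativePropertyT {G : Type v} [Group G] (G₀ : Subgroup G) : Prop :=
  ∀ (K : Type v) [NormedAddCommGroup K] [InnerProductSpace ℂ K] [CompleteSpace K]
    (π : G →* unitary (K →L[ℂ] K)), HasAlmostInvariantVectors π →
      ∃ ξ : K, ξ ≠ 0 ∧ ∀ g ∈ G₀, (π g : K →L[ℂ] K) ξ = ξ

/-! ## The C*-algebra underlying a von Neumann algebra, and its weak operator topology -/

namespace VonNeumannAlgebra

variable {H : Type u} [NormedAddCommGroup H] [InnerProductSpace ℂ H] [CompleteSpace H]

instance instSMulMemClass : SMulMemClass (VonNeumannAlgebra H) ℂ (H →L[ℂ] H) where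
  smul_mem {S} c _ hx := S.toStarSubalgebra.smul_mem hx c

theorem isClosed (M : VonNeumannAlgebra H) : IsClosed (M : Set (H →L[ℂ] H)) := by
  rw [← M.centralizer_centralizer]
  exact Set.isClosed_centralizer _

instance instCStarAlgebra (M : VonNeumannAlgebra H) : CStarAlgebra M :=
  haveI := M.isClosed
  StarSubalgebra.cstarAlgebra M

theorem sqrt_mem (M : VonNeumannAlgebra H) {x : H →L[ℂ] H} (hx : x ∈ M) :
    CFC.sqrt x ∈ M := by
  rw [← SetLike.mem_coe, ← M.centralizer_centralizer, Set.mem_centralizer_iff]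
  intro c hc
  have h : Commute x c := Set.mem_centralizer_iff.mp hc x hx
  exact (h.cfcₙ_nnreal NNReal.sqrt).symm

/-- The order on `M` is the operator order inherited from `B(H)`; it is the usual order of the
C*-algebra `M`. -/
instance instStarOrderedRing (M : VonNeumannAlgebra H) : StarOrderedRing M := by
  refine StarOrderedRing.of_nonneg_iff' (fun {x y} h z => ?_) (fun x => ⟨fun h => ?_, ?_⟩)
  · exact add_le_add_right (show (x : H →L[ℂ] H) ≤ y from h) (z : H →L[ℂ] H)
  · have h' : (0 : H →L[ℂ] H) ≤ x := h
    refine ⟨⟨CFC.sqrt (x : H →L[ℂ] H), M.sqrt_mem x.2⟩, Subtype.ext ?_⟩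
    change (x : H →L[ℂ] H) = star (CFC.sqrt (x : H →L[ℂ] H)) * CFC.sqrt (x : H →L[ℂ] H)
    rw [(CFC.sqrt_nonneg (x : H →L[ℂ] H)).isSelfAdjoint.star_eq, CFC.sqrt_mul_sqrt_self _ h']
  · rintro ⟨s, rfl⟩
    exact star_mul_self_nonneg (s : H →L[ℂ] H)

/-- The weak operator topology on a von Neumann algebra. -/
@[reducible]
def weakTopology (M : VonNeumannAlgebra H) : TopologicalSpace M :=
  TopologicalSpace.induced
    (fun x : M => (ContinuousLinearMapWOT.ofCLM (x : H →L[ℂ] H) : H →WOT[ℂ] H)) inferInstance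

/-- A functional on `M` is normal if it is weakly continuous on the unit ball of `M`. -/
def IsNormalFunctional (M : VonNeumannAlgebra H) (f : M → ℂ) : Prop :=
  @ContinuousOn M ℂ M.weakTopology _ f {x | ‖x‖ ≤ 1}

/-- A map from `M` to itself is normal if it is weakly continuous on the unit ball of `M`. -/
def IsNormalMap (M : VonNeumannAlgebra H) (f : M → M) : Prop :=
  @ContinuousOn M M M.weakTopology M.weakTopology f {x | ‖x‖ ≤ 1}

/-- The inclusion of a von Neumann subalgebra, as a positive linear map. -/
def inclusion {A M : VonNeumannAlgebra H} (h : A ≤ M) : A →ₚ[ℂ] M where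
  toFun x := ⟨x, h x.2⟩
  map_add' _ _ := rfl
  map_smul' _ _ := rfl
  monotone' _ _ hxy := hxy

/-- `M` is a factor: its center consists of the scalars. -/
def IsFactor (M : VonNeumannAlgebra H) : Prop :=
  ∀ z : M, (∀ x : M, z * x = x * z) → ∃ c : ℂ, z = c • (1 : M)

end VonNeumannAlgebra

/-! ## `L²` of a tracial positive functional, and bimodules -/

section Tracial

variable {A : Type u} [CStarAlgebra A] [PartialOrder A] [StarOrderedRing A]

/-- Right multiplication by `b` on `A`, as a bounded operator for the `2`-norm of the trace `τ`. -/
def rightMulPreGNS (τ : A →ₚ[ℂ] ℂ) (hτ : ∀ x y, τ (x * y) = τ (y * x)) (b : A) :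
    τ.PreGNS →L[ℂ] τ.PreGNS :=
  (τ.toPreGNS.toLinearMap ∘ₗ LinearMap.mulRight ℂ b ∘ₗ τ.ofPreGNS.toLinearMap).mkContinuous ‖b‖
    fun x => by
      have key (y : A) : ‖τ.toPreGNS y‖ ^ 2 = ‖τ.toPreGNS (star y)‖ ^ 2 := by
        rw [← Complex.ofReal_inj]
        push_cast
        rw [τ.preGNS_norm_sq, τ.preGNS_norm_sq]
        simp [hτ (star y) y]
      have h := (τ.leftMulMapPreGNS (star b)).le_of_opNorm_le
        (LinearMap.mkContinuous_norm_le _ (norm_nonneg _) _) (τ.toPreGNS (star (τ.ofPreGNS x)))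
      have h1 : ‖τ.toPreGNS (τ.ofPreGNS x * b)‖ = ‖τ.toPreGNS (star b * star (τ.ofPreGNS x))‖ := by
        rw [← sq_eq_sq₀ (norm_nonneg _) (norm_nonneg _), key]
        simp
      have h2 : ‖τ.toPreGNS (star (τ.ofPreGNS x))‖ = ‖x‖ := by
        rw [← sq_eq_sq₀ (norm_nonneg _) (norm_nonneg _), ← key]
        simp
      simpa [h1, h2, norm_star] using h

@[simp]
theorem rightMulPreGNS_apply (τ : A →ₚ[ℂ] ℂ) (hτ : ∀ x y, τ (x * y) = τ (y * x)) (b : A)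
    (x : τ.PreGNS) : rightMulPreGNS τ hτ b x = τ.toPreGNS (τ.ofPreGNS x * b) := rfl

/-- The right action of `A` on `L²(A, τ)`: it sends (the class of) `x` to `x b`. -/
def rightAction (τ : A →ₚ[ℂ] ℂ) (hτ : ∀ x y, τ (x * y) = τ (y * x)) :
    Aᵐᵒᵖ →⋆ₐ[ℂ] (τ.GNS →L[ℂ] τ.GNS) where
  toFun b := (rightMulPreGNS τ hτ b.unop).completion
  map_one' := by
    ext c
    induction c using UniformSpace.Completion.induction_on with
    | hp => apply isClosed_eq <;> fun_prop
    | ih c => simp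
  map_mul' a b := by
    ext c
    induction c using UniformSpace.Completion.induction_on with
    | hp => apply isClosed_eq <;> fun_prop
    | ih c => simp [mul_assoc]
  map_zero' := by
    ext c
    induction c using UniformSpace.Completion.induction_on with
    | hp => apply isClosed_eq <;> fun_prop
    | ih c => simp [UniformSpace.Completion.coe_zero]
  map_add' a b := by
    ext c
    induction c using UniformSpace.Completion.induction_on with
    | hp => apply isClosed_eq <;> fun_prop
    | ih c => simp [mul_add, UniformSpace.Completion.coe_add]
  commutes' r := by
    ext c
    induction c using UniformSpace.Completion.induction_on with
    | hp => apply isClosed_eq <;> fun_prop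
    | ih c => simp [Algebra.algebraMap_eq_smul_one]
  map_star' a := by
    refine (ContinuousLinearMap.eq_adjoint_iff _ _).mpr fun x y => ?_
    induction x, y using UniformSpace.Completion.induction_on₂ with
    | hp => apply isClosed_eq <;> fun_prop
    | ih x y =>
      have h := hτ a.unop (star (τ.ofPreGNS x) * τ.ofPreGNS y)
      simpa [PositiveLinearMap.preGNS_inner_def, mul_assoc] using h

end Tracial

/-- The first-leg embedding `T ↦ T ⊗ 1` of `B(E)` into `B(E ⊗ F)`, for the completed tensor product
of Hilbert spaces. -/
def firstLeg (E : Type v) (F : Type w) [NormedAddCommGroup E] [InnerProductSpace ℂ E]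
    [CompleteSpace E] [NormedAddCommGroup F] [InnerProductSpace ℂ F] :
    (E →L[ℂ] E) →⋆ₐ[ℂ]
      (UniformSpace.Completion (E ⊗[ℂ] F) →L[ℂ] UniformSpace.Completion (E ⊗[ℂ] F)) where
  toFun T := (T.rTensor F).completion
  map_one' := by
    ext c
    induction c using UniformSpace.Completion.induction_on with
    | hp => apply isClosed_eq <;> fun_prop
    | ih c => simp
  map_mul' a b := by
    ext c
    induction c using UniformSpace.Completion.induction_on with
    | hp => apply isClosed_eq <;> fun_prop
    | ih c => simp [ContinuousLinearMap.rTensor_mul]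
  map_zero' := by
    ext c
    induction c using UniformSpace.Completion.induction_on with
    | hp => apply isClosed_eq <;> fun_prop
    | ih c => simp
  map_add' a b := by
    ext c
    induction c using UniformSpace.Completion.induction_on with
    | hp => apply isClosed_eq <;> fun_prop
    | ih c => simp [UniformSpace.Completion.coe_add]
  commutes' r := by
    ext c
    induction c using UniformSpace.Completion.induction_on with
    | hp => apply isClosed_eq <;> fun_prop
    | ih c => simp [Algebra.algebraMap_eq_smul_one]
  map_star' a := by
    refine (ContinuousLinearMap.eq_adjoint_iff _ _).mpr fun x y => ?_
    induction x, y using UniformSpace.Completion.induction_on₂ with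
    | hp => apply isClosed_eq <;> fun_prop
    | ih x y =>
      simp only [ContinuousLinearMap.completion_apply_coe, UniformSpace.Completion.inner_coe]
      induction x using TensorProduct.induction_on with
      | zero => simp
      | add x₁ x₂ h₁ h₂ => simp only [map_add, inner_add_left, h₁, h₂]
      | tmul e f =>
        induction y using TensorProduct.induction_on with
        | zero => simp
        | add y₁ y₂ h₁ h₂ => simp only [map_add, inner_add_right, h₁, h₂]
        | tmul e' f' =>
          simp [ContinuousLinearMap.star_eq_adjoint, ContinuousLinearMap.adjoint_inner_left]

/-- The second-leg embedding `T ↦ 1 ⊗ T` of `B(F)` into `B(E ⊗ F)`, for the completed tensor product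
of Hilbert spaces. -/
def secondLeg (E : Type v) (F : Type w) [NormedAddCommGroup E] [InnerProductSpace ℂ E]
    [NormedAddCommGroup F] [InnerProductSpace ℂ F] [CompleteSpace F] :
    (F →L[ℂ] F) →⋆ₐ[ℂ]
      (UniformSpace.Completion (E ⊗[ℂ] F) →L[ℂ] UniformSpace.Completion (E ⊗[ℂ] F)) where
  toFun T := (T.lTensor E).completion
  map_one' := by
    ext c
    induction c using UniformSpace.Completion.induction_on with
    | hp => apply isClosed_eq <;> fun_prop
    | ih c => simp
  map_mul' a b := by
    ext c
    induction c using UniformSpace.Completion.induction_on with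
    | hp => apply isClosed_eq <;> fun_prop
    | ih c => simp [ContinuousLinearMap.lTensor_mul]
  map_zero' := by
    ext c
    induction c using UniformSpace.Completion.induction_on with
    | hp => apply isClosed_eq <;> fun_prop
    | ih c => simp
  map_add' a b := by
    ext c
    induction c using UniformSpace.Completion.induction_on with
    | hp => apply isClosed_eq <;> fun_prop
    | ih c => simp [UniformSpace.Completion.coe_add]
  commutes' r := by
    ext c
    induction c using UniformSpace.Completion.induction_on with
    | hp => apply isClosed_eq <;> fun_prop
    | ih c => simp [Algebra.algebraMap_eq_smul_one]
  map_star' a := by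
    refine (ContinuousLinearMap.eq_adjoint_iff _ _).mpr fun x y => ?_
    induction x, y using UniformSpace.Completion.induction_on₂ with
    | hp => apply isClosed_eq <;> fun_prop
    | ih x y =>
      simp only [ContinuousLinearMap.completion_apply_coe, UniformSpace.Completion.inner_coe]
      induction x using TensorProduct.induction_on with
      | zero => simp
      | add x₁ x₂ h₁ h₂ => simp only [map_add, inner_add_left, h₁, h₂]
      | tmul e f =>
        induction y using TensorProduct.induction_on with
        | zero => simp
        | add y₁ y₂ h₁ h₂ => simp only [map_add, inner_add_right, h₁, h₂]
        | tmul e' f' =>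
          simp [ContinuousLinearMap.star_eq_adjoint, ContinuousLinearMap.adjoint_inner_left]

/-- Weak containment of bimodules (in the sense of Fell). Here `(L₁, R₁)` and `(L₂, R₂)` are the
left and right actions of `A` and `B` on the Hilbert spaces `K₁` and `K₂`, so that `x ξ y` is
`L x (R (op y) ξ)`. The bimodule `K₁` is weakly contained in `K₂` if every coefficient
`(x, y) ↦ ⟪ξ, x ξ y⟫` of `K₁` is a pointwise limit of finite sums of coefficients of `K₂`. -/
def WeaklyContained {A B K₁ K₂ : Type*} [CStarAlgebra A] [CStarAlgebra B]
    [NormedAddCommGroup K₁] [InnerProductSpace ℂ K₁] [CompleteSpace K₁]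
    [NormedAddCommGroup K₂] [InnerProductSpace ℂ K₂] [CompleteSpace K₂]
    (L₁ : A →⋆ₐ[ℂ] (K₁ →L[ℂ] K₁)) (R₁ : Bᵐᵒᵖ →⋆ₐ[ℂ] (K₁ →L[ℂ] K₁))
    (L₂ : A →⋆ₐ[ℂ] (K₂ →L[ℂ] K₂)) (R₂ : Bᵐᵒᵖ →⋆ₐ[ℂ] (K₂ →L[ℂ] K₂)) : Prop :=
  ∀ (ξ : K₁) (E : Finset A) (F : Finset B) (ε : ℝ), 0 < ε →
    ∃ (n : ℕ) (η : Fin n → K₂), ∀ x ∈ E, ∀ y ∈ F,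
      ‖⟪ξ, L₁ x (R₁ (MulOpposite.op y) ξ)⟫_ℂ -
        ∑ i, ⟪η i, L₂ x (R₂ (MulOpposite.op y) (η i))⟫_ℂ‖ < ε

/-! ## Tracial von Neumann algebras -/

namespace VonNeumannAlgebra

variable {H : Type u} [NormedAddCommGroup H] [InnerProductSpace ℂ H] [CompleteSpace H]

/-- A faithful normal tracial state `τ` on `M`; the pair `(M, τ)` is a tracial von Neumann
algebra. -/
structure TracialState (M : VonNeumannAlgebra H) where
  toFunctional : M →ₚ[ℂ] ℂ
  map_one : toFunctional 1 = 1
  trace_comm : ∀ x y : M, toFunctional (x * y) = toFunctional (y * x)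
  faithful : ∀ x : M, toFunctional (star x * x) = 0 → x = 0
  normal : M.IsNormalFunctional toFunctional

namespace TracialState

variable {M : VonNeumannAlgebra H} (τ : M.TracialState)

instance : CoeFun M.TracialState (fun _ => M → ℂ) := ⟨fun τ x => τ.toFunctional x⟩

/-- The `2`-norm `‖x‖₂ = √τ(x* x)`. -/
def norm₂ (x : M) : ℝ := √(τ (star x * x)).re

/-- The restriction of the trace to a von Neumann subalgebra. -/
def restrict {A : VonNeumannAlgebra H} (h : A ≤ M) : A.TracialState where
  toFunctional := τ.toFunctional.comp (inclusion h)
  map_one := τ.map_one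
  trace_comm x y := τ.trace_comm (inclusion h x) (inclusion h y)
  faithful x hx := by
    have h0 : inclusion h x = 0 := τ.faithful (inclusion h x) hx
    exact Subtype.ext (congrArg (fun y : M => (y : H →L[ℂ] H)) h0)
  normal :=
    @ContinuousOn.comp A M ℂ A.weakTopology M.weakTopology _ (inclusion h)
      {x | ‖x‖ ≤ 1} τ.toFunctional {x | ‖x‖ ≤ 1} τ.normal
      (@Continuous.continuousOn A M A.weakTopology M.weakTopology _ _
        (continuous_induced_rng.mpr continuous_induced_dom))
      (fun _ hx => hx)

/-- The Hilbert space `L²(M, τ)`, the completion of `M` for `⟪x, y⟫ = τ(x* y)`. -/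
abbrev L2 : Type u := τ.toFunctional.GNS

/-- The canonical map `M → L²(M, τ)`. -/
def toL2 : M →ₗ[ℂ] τ.L2 where
  toFun x := (τ.toFunctional.toPreGNS x : τ.toFunctional.PreGNS)
  map_add' x y := by rw [map_add, UniformSpace.Completion.coe_add]
  map_smul' c x := by rw [map_smul, UniformSpace.Completion.coe_smul]; rfl

/-- The left action of `M` on `L²(M, τ)`. -/
def leftMul : M →⋆ₐ[ℂ] (τ.L2 →L[ℂ] τ.L2) := τ.toFunctional.gnsStarAlgHom

/-- The right action of `M` on `L²(M, τ)`. -/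
def rightMul : Mᵐᵒᵖ →⋆ₐ[ℂ] (τ.L2 →L[ℂ] τ.L2) := rightAction τ.toFunctional τ.trace_comm

/-- The Hilbert space `L²(M) ⊗ L²(M)` of the coarse bimodule. -/
abbrev Coarse : Type u := UniformSpace.Completion (τ.L2 ⊗[ℂ] τ.L2)

/-- The tracial von Neumann algebra `(M, τ)` is amenable: the trivial bimodule `L²(M)` is weakly
contained in the coarse bimodule `L²(M) ⊗ L²(M)`, on which `x (ξ ⊗ η) y = x ξ ⊗ η y`. -/
def IsAmenable : Prop :=
  WeaklyContained τ.leftMul τ.rightMul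
    ((firstLeg τ.L2 τ.L2).comp τ.leftMul) ((secondLeg τ.L2 τ.L2).comp τ.rightMul)

/-- A deformation of the identity of `(M, τ)`: a sequence of normal, unital, trace preserving,
completely positive maps converging to the identity pointwise in `2`-norm. -/
structure IsDeformationOfIdentity (φ : ℕ → (M →CP M)) : Prop where
  normal : ∀ n, M.IsNormalMap (φ n)
  map_one : ∀ n, φ n 1 = 1
  trace_map : ∀ n x, τ (φ n x) = τ x
  tendsto : ∀ x, Tendsto (fun n => τ.norm₂ (φ n x - x)) atTop (𝓝 0)

/-- `M` is the crossed product `A ⋊ Γ`, with `Γ` acting on the von Neumann subalgebra `A` of `M` by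
`α_g(a) = u_g a u_g*`: the trace preserving copy of `A` and the unitaries `u_g` in `M` satisfy
`u_g A u_g* = A`, `u_g u_h = u_{gh}`, `τ(a u_g) = 0` for `g ≠ e`, and together they generate the von
Neumann algebra `M`. -/
structure IsCrossedProduct (A : VonNeumannAlgebra H) {Γ : Type v} [Group Γ]
    (u : Γ →* unitary M) : Prop where
  le : A ≤ M
  conj_mem : ∀ (g : Γ), ∀ a ∈ A, ((u g : M) : H →L[ℂ] H) * a * star ((u g : M) : H →L[ℂ] H) ∈ A
  trace_eq_zero : ∀ (g : Γ) (a : A), g ≠ 1 → τ (inclusion le a * (u g : M)) = 0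
  generates : Set.centralizer (Set.centralizer
    ((A : Set (H →L[ℂ] H)) ∪ Set.range fun g => ((u g : M) : H →L[ℂ] H))) = M

/-- The subspace `L²(A)` of `L²(M)`, the `2`-norm closure of `A`. -/
def L2Sub {A : VonNeumannAlgebra H} (h : A ≤ M) : Submodule ℂ τ.L2 :=
  (LinearMap.range (τ.toL2 ∘ₗ (inclusion h).toLinearMap)).topologicalClosure

/-- The Fourier coefficient `(x)_g = E_A(x u_g*)` of `x ∈ M` with respect to the decomposition
`M = A ⋊ Γ`, as an element of `L²(A)`. The trace preserving conditional expectation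
`E_A : M → A` is the orthogonal projection of `L²(M)` onto `L²(A)`, restricted to `M`. -/
def fourierCoeff {A : VonNeumannAlgebra H} (h : A ≤ M) {Γ : Type v} [Group Γ]
    (u : Γ →* unitary M) (x : M) (g : Γ) : τ.L2 :=
  haveI : CompleteSpace (τ.L2Sub h) := (Submodule.isClosed_topologicalClosure _).completeSpace_coe
  (τ.L2Sub h).starProjection (τ.toL2 (x * star (u g : M)))

end TracialState

/-- `M` is a II₁ factor with trace `τ`: a factor with a (faithful normal) tracial state that is not
isomorphic to a matrix algebra. -/
structure IsTypeIIOneFactor (M : VonNeumannAlgebra H) (_τ : M.TracialState) : Prop where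
  factor : M.IsFactor
  not_matrix : ∀ n : ℕ, IsEmpty (M ≃⋆ₐ[ℂ] Matrix (Fin n) (Fin n) ℂ)

end VonNeumannAlgebra

end

/-! Complete positivity makes f_n(s) = τ(v_s* φ_n(v_s)) a positive definite function on Λ
(`isPosDefFun_cpCoeff`). It tends to 1 pointwise, and f_n(s) close to 1 means that φ_n almost fixes
v_s. Let P_s be the projection of L²(M) onto L²(B)v_s. The function ω_n(g) = Σ_s f_n(s)‖P_s u_g‖² is
then positive definite on Γ (`isPosDefFun_transfer`) and tends to 1, so relative property (T) makes
some ω_n uniformly close to 1 on Γ₀ (`exists_uniform`). Consequently, for V = {s : ‖φ_n(v_s) − v_s‖₂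
< ε}, each u_g with g ∈ Γ₀ carries at least half of its squared 2-norm on the blocks s ∈ V.

If V contained no sequence with vanishing Fourier coefficients, some finite F ⊂ Γ and δ > 0 would
satisfy max_{g∈F} ‖(v_s)_g‖₂ ≥ δ for all s ∈ V. Then Γ₀ would be amenable by
`isAmenableGroup_of_fourierCoeff_le`, a contradiction. The mechanism uses the two amenability
hypotheses in turn. The function ψ(s) = Σ ‖E_A(u_t* v_s u_r)‖₂², over t, r ∈ F ∪ {1}, is at least δ²
on V. Amenability of A approximates it on finite sets by a coefficient ⟨ζ, v_s ζ v_s*⟩ of a multiple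
of the coarse M-bimodule (`exists_coarse_vector`). Averaging this over s with weights ‖P_s u_g‖²,
after cutting ζ down to finitely many blocks, gives a combination of the numbers ‖E_B(v_t* u_g
v_r)‖₂². Amenability of B turns it into a coarse coefficient ⟨ζ', u_g ζ' u_g*⟩, bounded below on any
prescribed finite subset of Γ₀. Conjugation by u_g permutes the blocks u_t L²(A) ⊗ L²(M) freely, and
such lower bounds force amenability (`isAmenableGroup_of_partition`).

Two foundational facts are derived from the bicommutant definition: the conditional expectation maps
into A (`exists_expect_eq`), and the span of the a u_g is dense in L²(M) (`dense_span`). -/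

namespace VonNeumannAlgebra

/-! ### The standard form L²(M) and the projection onto L²(A). -/

variable {H : Type u} [NormedAddCommGroup H] [InnerProductSpace ℂ H] [CompleteSpace H]
  {M A : VonNeumannAlgebra H}

@[simp] theorem inclusion_mul (h : A ≤ M) (a b : A) :
    inclusion h (a * b) = inclusion h a * inclusion h b := rfl

@[simp] theorem inclusion_star (h : A ≤ M) (a : A) :
    inclusion h (star a) = star (inclusion h a) := rfl

@[simp] theorem inclusion_one (h : A ≤ M) : inclusion h (1 : A) = 1 := rfl

namespace TracialState

variable (τ : M.TracialState)

theorem trace_star (x : M) : τ (star x) = star (τ x) := map_star τ.toFunctional x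

theorem toL2_def (x : M) : τ.toL2 x = (τ.toFunctional.toPreGNS x : τ.toFunctional.PreGNS) := rfl

@[simp] theorem inner_toL2 (x y : M) : ⟪τ.toL2 x, τ.toL2 y⟫_ℂ = τ (star x * y) := by
  rw [toL2_def, toL2_def, UniformSpace.Completion.inner_coe, PositiveLinearMap.preGNS_inner_def]
  rfl

@[simp] theorem leftMul_toL2 (x y : M) : τ.leftMul x (τ.toL2 y) = τ.toL2 (x * y) :=
  τ.toFunctional.gnsNonUnitalStarAlgHom_apply_coe

@[simp] theorem rightMul_toL2 (x : Mᵐᵒᵖ) (y : M) :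
    τ.rightMul x (τ.toL2 y) = τ.toL2 (y * x.unop) := by
  change (rightMulPreGNS τ.toFunctional τ.trace_comm x.unop).completion _ = _
  rw [toL2_def, ContinuousLinearMap.completion_apply_coe]
  rfl

theorem denseRange_toL2 : DenseRange τ.toL2 := by
  have h : DenseRange ((↑) : τ.toFunctional.PreGNS → τ.L2) :=
    UniformSpace.Completion.denseRange_coe
  exact h

theorem ext_inner_toL2 {ξ η : τ.L2} (h : ∀ m, ⟪τ.toL2 m, ξ⟫_ℂ = ⟪τ.toL2 m, η⟫_ℂ) : ξ = η := by
  refine ext_inner_left ℂ fun ζ => ?_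
  induction ζ using τ.denseRange_toL2.induction_on with
  | hp => exact isClosed_eq (by fun_prop) (by fun_prop)
  | ih z => exact h z

theorem norm_toL2_sq (x : M) : ‖τ.toL2 x‖ ^ 2 = (τ (star x * x)).re := by
  rw [← inner_toL2, ← inner_self_eq_norm_sq (𝕜 := ℂ)]; rfl

theorem norm₂_eq (x : M) : τ.norm₂ x = ‖τ.toL2 x‖ := by
  rw [norm₂, ← norm_toL2_sq, Real.sqrt_sq (norm_nonneg _)]

theorem norm_toL2_star (x : M) : ‖τ.toL2 (star x)‖ = ‖τ.toL2 x‖ := by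
  rw [← sq_eq_sq₀ (norm_nonneg _) (norm_nonneg _), norm_toL2_sq, norm_toL2_sq, star_star]
  exact congrArg Complex.re (τ.trace_comm _ _)

theorem norm_toL2_one : ‖τ.toL2 1‖ = 1 := by
  rw [← sq_eq_sq₀ (norm_nonneg _) zero_le_one, norm_toL2_sq]
  simp [τ.map_one]

theorem norm_leftMul_le (x : M) : ‖τ.leftMul x‖ ≤ ‖x‖ :=
  NonUnitalStarAlgHom.norm_apply_le τ.leftMul x

theorem norm_toL2_le (x : M) : ‖τ.toL2 x‖ ≤ ‖x‖ := by
  have := (τ.leftMul x).le_of_opNorm_le (τ.norm_leftMul_le x) (τ.toL2 1)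
  simpa [norm_toL2_one] using this

theorem norm_rightMul_le (x : Mᵐᵒᵖ) (ξ : τ.L2) : ‖τ.rightMul x ξ‖ ≤ ‖x.unop‖ * ‖ξ‖ := by
  induction ξ using τ.denseRange_toL2.induction_on with
  | hp => exact isClosed_le (by fun_prop) (by fun_prop)
  | ih z =>
    have := (τ.leftMul (star x.unop)).le_of_opNorm_le (τ.norm_leftMul_le _) (τ.toL2 (star z))
    rw [leftMul_toL2, ← star_mul, norm_toL2_star, norm_toL2_star, norm_star] at this
    simpa using this

theorem leftMul_rightMul_comm (x : M) (y : Mᵐᵒᵖ) (ξ : τ.L2) :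
    τ.leftMul x (τ.rightMul y ξ) = τ.rightMul y (τ.leftMul x ξ) := by
  induction ξ using τ.denseRange_toL2.induction_on with
  | hp => exact isClosed_eq (by fun_prop) (by fun_prop)
  | ih z => simp [mul_assoc]

theorem inner_leftMul_left (x : M) (ξ η : τ.L2) :
    ⟪τ.leftMul x ξ, η⟫_ℂ = ⟪ξ, τ.leftMul (star x) η⟫_ℂ := by
  rw [map_star, ContinuousLinearMap.star_eq_adjoint, ContinuousLinearMap.adjoint_inner_right]

theorem inner_rightMul_left (x : Mᵐᵒᵖ) (ξ η : τ.L2) :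
    ⟪τ.rightMul x ξ, η⟫_ℂ = ⟪ξ, τ.rightMul (star x) η⟫_ℂ := by
  rw [map_star, ContinuousLinearMap.star_eq_adjoint, ContinuousLinearMap.adjoint_inner_right]

theorem leftMul_mul_apply (x y : M) (ξ : τ.L2) :
    τ.leftMul (x * y) ξ = τ.leftMul x (τ.leftMul y ξ) := by rw [map_mul]; rfl

theorem rightMul_mul_apply (x y : Mᵐᵒᵖ) (ξ : τ.L2) :
    τ.rightMul (x * y) ξ = τ.rightMul x (τ.rightMul y ξ) := by rw [map_mul]; rfl

/-- The orthogonal projection of `L²(M)` onto `L²(A)`. -/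
noncomputable def expect (h : A ≤ M) : τ.L2 →L[ℂ] τ.L2 :=
  haveI : CompleteSpace (τ.L2Sub h) := (Submodule.isClosed_topologicalClosure _).completeSpace_coe
  (τ.L2Sub h).starProjection

variable (h : A ≤ M)

theorem toL2_inclusion_mem (a : A) : τ.toL2 (inclusion h a) ∈ τ.L2Sub h :=
  Submodule.le_topologicalClosure _ ⟨a, rfl⟩

theorem expect_mem (ξ : τ.L2) : τ.expect h ξ ∈ τ.L2Sub h :=
  haveI : CompleteSpace (τ.L2Sub h) := (Submodule.isClosed_topologicalClosure _).completeSpace_coe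
  Submodule.starProjection_apply_mem _ _

theorem expect_eq_self {ξ : τ.L2} (hξ : ξ ∈ τ.L2Sub h) : τ.expect h ξ = ξ :=
  haveI : CompleteSpace (τ.L2Sub h) := (Submodule.isClosed_topologicalClosure _).completeSpace_coe
  Submodule.starProjection_eq_self_iff.mpr hξ

theorem inner_expect_left (ξ η : τ.L2) : ⟪τ.expect h ξ, η⟫_ℂ = ⟪ξ, τ.expect h η⟫_ℂ :=
  haveI : CompleteSpace (τ.L2Sub h) := (Submodule.isClosed_topologicalClosure _).completeSpace_coe
  Submodule.inner_starProjection_left_eq_right _ _ _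

theorem expect_idem (ξ : τ.L2) : τ.expect h (τ.expect h ξ) = τ.expect h ξ :=
  τ.expect_eq_self h (τ.expect_mem h ξ)

theorem inner_toL2_expect (a : A) (ξ : τ.L2) :
    ⟪τ.toL2 (inclusion h a), τ.expect h ξ⟫_ℂ = ⟪τ.toL2 (inclusion h a), ξ⟫_ℂ := by
  rw [← inner_expect_left, τ.expect_eq_self h (τ.toL2_inclusion_mem h a)]

theorem L2Sub_induction {p : τ.L2 → Prop} (hp : IsClosed {ξ | p ξ})
    (ih : ∀ a : A, p (τ.toL2 (inclusion h a))) {ξ : τ.L2} (hξ : ξ ∈ τ.L2Sub h) : p ξ := by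
  have h1 : (τ.L2Sub h : Set τ.L2) ⊆ {ξ | p ξ} := by
    rw [L2Sub, Submodule.topologicalClosure_coe]
    refine closure_minimal ?_ hp
    rintro _ ⟨a, rfl⟩
    exact ih a
  exact h1 hξ

theorem fourierCoeff_eq {Γ : Type v} [Group Γ] (u : Γ →* unitary M) (x : M) (g : Γ) :
    τ.fourierCoeff h u x g = τ.expect h (τ.toL2 (x * star (u g : M))) := rfl

theorem inner_restrict_toL2 (a b : A) :
    ⟪(τ.restrict h).toL2 a, (τ.restrict h).toL2 b⟫_ℂ =
      ⟪τ.toL2 (inclusion h a), τ.toL2 (inclusion h b)⟫_ℂ := by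
  rw [inner_toL2, inner_toL2]; rfl

theorem norm_restrict_toL2 (a : A) :
    ‖(τ.restrict h).toL2 a‖ = ‖τ.toL2 (inclusion h a)‖ := by
  rw [@norm_eq_sqrt_re_inner ℂ, @norm_eq_sqrt_re_inner ℂ, inner_restrict_toL2]

end TracialState
end VonNeumannAlgebra

/-! ### The trace preserving conditional expectation. -/

namespace VonNeumannAlgebra

variable {H : Type u} [NormedAddCommGroup H] [InnerProductSpace ℂ H] [CompleteSpace H]
  {M A : VonNeumannAlgebra H}

/-- The unit ball of a von Neumann algebra is compact for the weak operator topology. -/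
theorem exists_weak_limit (A : VonNeumannAlgebra H) (U : Ultrafilter A)
    (hU : ∀ᶠ a in (U : Filter A), ‖a‖ ≤ 1) :
    ∃ a : A, ‖a‖ ≤ 1 ∧ ∀ x y : H, Tendsto (fun b : A => ⟪(b : H →L[ℂ] H) x, y⟫_ℂ) U
      (𝓝 ⟪(a : H →L[ℂ] H) x, y⟫_ℂ) := by
  have hbd : ∀ x y : H, ∀ᶠ b : A in (U : Filter A), ‖⟪(b : H →L[ℂ] H) x, y⟫_ℂ‖ ≤ 1 * ‖x‖ * ‖y‖ := by
    intro x y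
    filter_upwards [hU] with b hb
    calc ‖⟪(b : H →L[ℂ] H) x, y⟫_ℂ‖ ≤ ‖(b : H →L[ℂ] H) x‖ * ‖y‖ := norm_inner_le_norm _ _
      _ ≤ 1 * ‖x‖ * ‖y‖ := by
        gcongr
        exact (b : H →L[ℂ] H).le_of_opNorm_le hb x
  have hlim : ∀ x y : H, ∃ z : ℂ, ‖z‖ ≤ 1 * ‖x‖ * ‖y‖ ∧
      Tendsto (fun b : A => ⟪(b : H →L[ℂ] H) x, y⟫_ℂ) U (𝓝 z) := by
    intro x y
    have hc := isCompact_closedBall (0 : ℂ) (1 * ‖x‖ * ‖y‖)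
    obtain ⟨z, hz, hle⟩ := hc.ultrafilter_le_nhds
      (U.map fun b : A => ⟪(b : H →L[ℂ] H) x, y⟫_ℂ) (by
        rw [Ultrafilter.coe_map, le_principal_iff, mem_map]
        filter_upwards [hbd x y] with b hb
        simpa using hb)
    exact ⟨z, by simpa using hz, hle⟩
  choose B hB hBt using hlim
  let L : H →ₗ⋆[ℂ] H →ₗ[ℂ] ℂ := LinearMap.mk₂'ₛₗ (starRingEnd ℂ) (RingHom.id ℂ) B
    (fun x x' y => tendsto_nhds_unique (hBt (x + x') y) (by
      simpa [inner_add_left] using (hBt x y).add (hBt x' y)))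
    (fun c x y => tendsto_nhds_unique (hBt (c • x) y) (by
      simpa [inner_smul_left, mul_comm] using (hBt x y).const_mul (starRingEnd ℂ c)))
    (fun x y y' => tendsto_nhds_unique (hBt x (y + y')) (by
      simpa [inner_add_right] using (hBt x y).add (hBt x y')))
    (fun c x y => tendsto_nhds_unique (hBt x (c • y)) (by
      simpa [inner_smul_right] using (hBt x y).const_mul c))
  let T : H →L[ℂ] H := InnerProductSpace.continuousLinearMapOfBilin (L.mkContinuous₂ 1 hB)
  have hT : ∀ x y, ⟪T x, y⟫_ℂ = B x y := fun x y =>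
    InnerProductSpace.continuousLinearMapOfBilin_apply _ x y
  -- The limit form commutes with every operator of the commutant, so T lies in the bicommutant.
  have hTm : T ∈ A := by
    rw [← SetLike.mem_coe, ← A.centralizer_centralizer, Set.mem_centralizer_iff]
    intro c hc
    refine ContinuousLinearMap.ext fun x => ext_inner_right ℂ fun y => ?_
    have h1 : ⟪(c * T) x, y⟫_ℂ = B x (ContinuousLinearMap.adjoint c y) := by
      rw [← hT, ContinuousLinearMap.adjoint_inner_right]; rfl
    have h2 : ⟪(T * c) x, y⟫_ℂ = B (c x) y := by rw [← hT]; rfl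
    rw [h1, h2]
    refine tendsto_nhds_unique (hBt _ _) ((hBt (c x) y).congr fun b => ?_)
    rw [ContinuousLinearMap.adjoint_inner_right]
    have h3 := Set.mem_centralizer_iff.mp hc b b.2
    exact congrArg (fun S : H →L[ℂ] H => ⟪S x, y⟫_ℂ) h3
  refine ⟨⟨T, hTm⟩, ?_, fun x y => by simpa only [hT] using hBt x y⟩
  refine ContinuousLinearMap.opNorm_le_bound _ zero_le_one fun x => ?_
  have h1 : ‖T x‖ * ‖T x‖ ≤ 1 * ‖x‖ * ‖T x‖ := by
    have := hB x (T x)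
    rwa [← hT, inner_self_eq_norm_sq_to_K, ← RCLike.ofReal_pow, RCLike.norm_ofReal, abs_of_nonneg
      (by positivity), sq] at this
  by_cases h0 : ‖T x‖ = 0
  · exact h0.le.trans (by positivity)
  · exact le_of_mul_le_mul_right h1 (lt_of_le_of_ne (norm_nonneg _) (Ne.symm h0))

namespace TracialState

variable (τ : M.TracialState)

/-- The trace is continuous along bounded weakly convergent families. -/
theorem tendsto_trace {ι : Type*} {l : Filter ι} {f : ι → M} {a : M} {C : ℝ}
    (hf : ∀ᶠ i in l, ‖f i‖ ≤ C) (ha : ‖a‖ ≤ C)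
    (h : ∀ x y : H, Tendsto (fun i => ⟪(f i : H →L[ℂ] H) x, y⟫_ℂ) l
      (𝓝 ⟪(a : H →L[ℂ] H) x, y⟫_ℂ)) :
    Tendsto (fun i => τ (f i)) l (𝓝 (τ a)) := by
  -- Normality is continuity on the unit ball only, so everything is rescaled by D; the maximum with
  -- 1 keeps D positive.
  set D : ℝ := max C 1
  have hD : 0 < D := lt_of_lt_of_le one_pos (le_max_right _ _)
  have hball : ∀ z : M, ‖z‖ ≤ C → ‖((D⁻¹ : ℝ) : ℂ) • z‖ ≤ 1 := by
    intro z hz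
    rw [norm_smul, Complex.norm_real, Real.norm_of_nonneg (by positivity), inv_mul_le_one₀ hD]
    exact hz.trans (le_max_left _ _)
  have hw : @Tendsto ι M (fun i => ((D⁻¹ : ℝ) : ℂ) • f i) l
      (@nhdsWithin M M.weakTopology (((D⁻¹ : ℝ) : ℂ) • a) {x | ‖x‖ ≤ 1}) := by
    let _ := M.weakTopology
    refine tendsto_nhdsWithin_iff.mpr ⟨?_, hf.mono fun i hi => hball _ hi⟩
    rw [nhds_induced, tendsto_comap_iff,
      ContinuousLinearMapWOT.tendsto_iff_forall_inner_apply_tendsto]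
    intro x y
    have h1 := ((h x y).star).const_mul ((D⁻¹ : ℝ) : ℂ)
    simpa [ContinuousLinearMapWOT.coe_ofCLM, inner_smul_right] using h1
  have h2 := Tendsto.comp (τ.normal _ (hball a ha)) hw
  have h3 := h2.const_mul (D : ℂ)
  have h4 : (D : ℂ) ≠ 0 := by exact_mod_cast hD.ne'
  have h5 : ∀ z : M, (D : ℂ) * τ (((D⁻¹ : ℝ) : ℂ) • z) = τ z := by
    intro z
    rw [show τ (((D⁻¹ : ℝ) : ℂ) • z) = ((D⁻¹ : ℝ) : ℂ) * τ z from map_smul τ.toFunctional _ z]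
    push_cast
    rw [mul_inv_cancel_left₀ h4]
  rw [h5] at h3
  exact h3.congr fun i => h5 _

theorem tendsto_inner_toL2 {ι : Type*} {l : Filter ι} {f : ι → M} {a : M} {C : ℝ}
    (hf : ∀ᶠ i in l, ‖f i‖ ≤ C) (ha : ‖a‖ ≤ C)
    (h : ∀ x y : H, Tendsto (fun i => ⟪(f i : H →L[ℂ] H) x, y⟫_ℂ) l
      (𝓝 ⟪(a : H →L[ℂ] H) x, y⟫_ℂ)) (m : M) :
    Tendsto (fun i => ⟪τ.toL2 m, τ.toL2 (f i)⟫_ℂ) l (𝓝 ⟪τ.toL2 m, τ.toL2 a⟫_ℂ) := by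
  have hb : ∀ z : M, ‖z‖ ≤ C → ‖star m * z‖ ≤ ‖m‖ * C := fun z hz =>
    (norm_mul_le _ _).trans (by rw [norm_star]; gcongr)
  simp only [inner_toL2]
  refine τ.tendsto_trace (C := ‖m‖ * C) (hf.mono fun i hi => hb _ hi) (hb _ ha) fun x y => ?_
  have h1 := h x ((m : H →L[ℂ] H) y)
  have h2 : ∀ z : M, ⟪((star m * z : M) : H →L[ℂ] H) x, y⟫_ℂ =
      ⟪(z : H →L[ℂ] H) x, (m : H →L[ℂ] H) y⟫_ℂ := fun z => by
    change ⟪ContinuousLinearMap.adjoint (m : H →L[ℂ] H) ((z : H →L[ℂ] H) x), y⟫_ℂ = _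
    rw [ContinuousLinearMap.adjoint_inner_left]
  simpa only [h2] using h1

/-- An ultrafilter of contractions of A whose images converge to ξ also has a weak limit a in the
ball. Normality of the trace makes the pairings with M converge to those of a, so ξ is the image of
a. -/
theorem isClosed_image_ball (h : A ≤ M) :
    IsClosed ((fun a : A => τ.toL2 (inclusion h a)) '' {a | ‖a‖ ≤ 1}) := by
  rw [← closure_subset_iff_isClosed]
  intro ξ hξ
  have hne : (comap (fun a : A => τ.toL2 (inclusion h a)) (𝓝 ξ) ⊓ 𝓟 {a | ‖a‖ ≤ 1}).NeBot := by
    rw [mem_closure_iff_nhds] at hξ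
    rw [inf_principal_neBot_iff]
    rintro s ⟨t, ht, hts⟩
    obtain ⟨_, hy, a, ha, rfl⟩ := hξ t ht
    exact ⟨a, hts hy, ha⟩
  obtain ⟨U, hU⟩ := Ultrafilter.exists_le (comap (fun a : A => τ.toL2 (inclusion h a)) (𝓝 ξ) ⊓ 𝓟 {a | ‖a‖ ≤ 1})
  have hU1 : ∀ᶠ a in (U : Filter A), ‖a‖ ≤ 1 := hU (mem_inf_of_right (mem_principal_self _))
  have hU2 : Tendsto (fun a : A => τ.toL2 (inclusion h a)) U (𝓝 ξ) :=
    tendsto_iff_comap.mpr (hU.trans inf_le_left)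
  obtain ⟨a, ha, hat⟩ := A.exists_weak_limit U hU1
  refine ⟨a, ha, ?_⟩
  refine τ.ext_inner_toL2 fun m => tendsto_nhds_unique
    (τ.tendsto_inner_toL2 (f := fun a => inclusion h a) (a := inclusion h a) hU1 ha hat m) ?_
  exact tendsto_const_nhds.inner hU2

end TracialState
end VonNeumannAlgebra

/-- Regularized polar decomposition in a C*-algebra: `c = a d` with `a` a contraction, `d ≥ 0` and
`c* a` close to `d`. -/
theorem exists_polar_approx {R : Type*} [CStarAlgebra R] [PartialOrder R] [StarOrderedRing R]
    (c : R) {ε : ℝ} (hε : 0 < ε) :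
    ∃ a e r : R, ‖a‖ ≤ 1 ∧ IsSelfAdjoint e ∧ c = a * (e * e) ∧ ‖r‖ ≤ ε ∧
      star c * a = e * e - r := by
  -- With p = c*c + ε² and d = √p invertible, take a = c d⁻¹, e = √d and r = ε² d⁻¹, so that c*a = d
  -- − r. Conjugating x*x ≤ p by d⁻¹ gives ‖x d⁻¹‖ ≤ 1; this is used for x = c and for x = ε.
  set p : R := star c * c + algebraMap ℝ R (ε ^ 2)
  have hε2 : (0 : R) ≤ algebraMap ℝ R (ε ^ 2) := algebraMap_nonneg _ (by positivity)
  have hp0 : 0 ≤ p := add_nonneg (star_mul_self_nonneg c) hε2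
  have hp1 : algebraMap ℝ R (ε ^ 2) ≤ p := le_add_of_nonneg_left (star_mul_self_nonneg c)
  have hpu : IsUnit p := by
    refine CStarAlgebra.isUnit_of_le _ hp1 ?_
    exact (IsUnit.map (algebraMap ℝ R) (isUnit_iff_ne_zero.mpr (by positivity))).isStrictlyPositive
      hε2
  set d : R := CFC.sqrt p
  have hd0 : 0 ≤ d := CFC.sqrt_nonneg p
  have hdd : d * d = p := CFC.sqrt_mul_sqrt_self p hp0
  have hds : star d = d := (IsSelfAdjoint.of_nonneg hd0).star_eq
  have hdu : IsUnit d := by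
    have : IsUnit (d * d) := hdd ▸ hpu
    exact (Commute.isUnit_mul_iff (Commute.refl d)).mp this |>.1
  obtain ⟨D, hD⟩ := hdu
  set i : R := ↑D⁻¹
  have hdi : d * i = 1 := by rw [← hD]; exact D.mul_inv
  have hid : i * d = 1 := by rw [← hD]; exact D.inv_mul
  have his : star i = i := by
    have h1 : star i * d = 1 := by rw [← hds, ← star_mul, hdi, star_one]
    calc star i = star i * (d * i) := by rw [hdi, mul_one]
      _ = i := by rw [← mul_assoc, h1, one_mul]
  have hipi : i * p * i = 1 := by
    rw [← hdd, ← mul_assoc, hid, one_mul, hdi]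
  have hconj : ∀ x : R, star x * x ≤ p → ‖x * i‖ ≤ 1 := by
    intro x hx
    have h1 : star (x * i) * (x * i) ≤ 1 := by
      have := star_left_conjugate_le_conjugate hx i
      rw [his, hipi] at this
      rw [star_mul, his]
      simpa only [mul_assoc] using this
    have h2 := CStarAlgebra.norm_le_one_iff_of_nonneg (star (x * i) * (x * i)) (star_mul_self_nonneg _) |>.mpr h1
    rw [CStarRing.norm_star_mul_self] at h2
    nlinarith [norm_nonneg (x * i)]
  set e : R := CFC.sqrt d
  have he : e * e = d := CFC.sqrt_mul_sqrt_self d hd0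
  refine ⟨c * i, e, algebraMap ℝ R ε * (algebraMap ℝ R ε * i),
    hconj c (le_add_of_nonneg_right hε2), IsSelfAdjoint.of_nonneg (CFC.sqrt_nonneg d), ?_, ?_, ?_⟩
  · rw [he, mul_assoc, hid, mul_one]
  · have h1 := hconj (algebraMap ℝ R ε) (by
      rw [← algebraMap_star_comm, ← map_mul]
      simpa [sq] using hp1)
    rw [← Algebra.smul_def]
    rw [norm_smul, Real.norm_of_nonneg hε.le]
    exact mul_le_of_le_one_right hε.le h1
  · have h1 : star c * c = d * d - algebraMap ℝ R (ε ^ 2) := by rw [hdd]; simp [p]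
    rw [he, ← mul_assoc, ← mul_assoc, ← map_mul, ← sq, h1, sub_mul, mul_assoc d d, hdi, mul_one]

theorem exists_re_inner_sub_nonpos {E : Type*} [NormedAddCommGroup E] [InnerProductSpace ℂ E]
    {C : Set E} (hne : C.Nonempty) (hC : IsComplete C)
    (hconv : ∀ x ∈ C, ∀ y ∈ C, ∀ s t : ℝ, 0 ≤ s → 0 ≤ t → s + t = 1 →
      (s : ℂ) • x + (t : ℂ) • y ∈ C) (ξ : E) :
    ∃ k ∈ C, ∀ w ∈ C, (⟪ξ - k, w - k⟫_ℂ).re ≤ 0 := by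
  let _ : InnerProductSpace ℝ E := InnerProductSpace.rclikeToReal ℂ E
  have hc : Convex ℝ C := fun x hx y hy s t hs ht hst => hconv x hx y hy s t hs ht hst
  obtain ⟨k, hk, hmin⟩ := exists_norm_eq_iInf_of_complete_convex hne hC hc ξ
  rw [norm_eq_iInf_iff_real_inner_le_zero hc hk] at hmin
  exact ⟨k, hk, hmin⟩

namespace VonNeumannAlgebra.TracialState

variable {H : Type u} [NormedAddCommGroup H] [InnerProductSpace ℂ H] [CompleteSpace H]
  {M A : VonNeumannAlgebra H} (τ : M.TracialState)

theorem norm_trace_le (x : M) : ‖τ x‖ ≤ ‖x‖ := by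
  have h1 : τ x = ⟪τ.toL2 1, τ.toL2 x⟫_ℂ := by simp
  rw [h1]
  refine (norm_inner_le_norm _ _).trans ?_
  rw [norm_toL2_one, one_mul]
  exact τ.norm_toL2_le x

/-- The pairing of c with contractions is controlled by its trace norm, which the polar part of c,
an element of A, nearly attains. Writing c = a e², traciality gives ⟨c, x⟩ = ⟨ae, xe⟩, and
Cauchy–Schwarz bounds it by ‖e‖₂² = τ(e²) ≈ ⟨c, a⟩. -/
theorem exists_contraction_re_inner_le (h : A ≤ M) {x : M} (hx : ‖x‖ ≤ 1) (c : A) {ε : ℝ}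
    (hε : 0 < ε) : ∃ a : A, ‖a‖ ≤ 1 ∧
      (⟪τ.toL2 (inclusion h c), τ.toL2 x⟫_ℂ).re ≤
        (⟪τ.toL2 (inclusion h c), τ.toL2 (inclusion h a)⟫_ℂ).re + ε := by
  obtain ⟨a, e, r, ha, he, hc, hr, hca⟩ := exists_polar_approx c hε
  refine ⟨a, ha, ?_⟩
  set ι := inclusion h
  have hes : star (ι e) = ι e := by rw [← inclusion_star, he.star_eq]
  have h1 : ⟪τ.toL2 (ι c), τ.toL2 x⟫_ℂ = ⟪τ.toL2 (ι (a * e)), τ.toL2 (x * ι e)⟫_ℂ := by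
    rw [inner_toL2, inner_toL2, hc]
    refine Eq.trans ?_ (τ.trace_comm (ι e) (star (ι (a * e)) * x))
    refine congrArg τ.toFunctional ?_
    simp only [ι, inclusion_mul, star_mul, hes, mul_assoc]
  have h2 : (⟪τ.toL2 (ι (a * e)), τ.toL2 (x * ι e)⟫_ℂ).re ≤ ‖τ.toL2 (ι e)‖ ^ 2 := by
    refine (Complex.re_le_norm _).trans ((norm_inner_le_norm _ _).trans ?_)
    have h3 : ∀ y : M, ‖y‖ ≤ 1 → ‖τ.toL2 (y * ι e)‖ ≤ ‖τ.toL2 (ι e)‖ := by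
      intro y hy
      rw [← leftMul_toL2]
      refine ((τ.leftMul y).le_of_opNorm_le ((τ.norm_leftMul_le y).trans hy) _).trans ?_
      rw [one_mul]
    rw [sq]
    exact mul_le_mul (h3 (ι a) ha) (h3 x hx) (norm_nonneg _) (norm_nonneg _)
  have h4 : ⟪τ.toL2 (ι c), τ.toL2 (ι a)⟫_ℂ = τ (ι (e * e)) - τ (ι r) := by
    rw [inner_toL2, ← inclusion_star, ← inclusion_mul, hca, map_sub]
    exact map_sub τ.toFunctional _ _
  have h5 : ‖τ.toL2 (ι e)‖ ^ 2 = (τ (ι (e * e))).re := by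
    rw [norm_toL2_sq, hes]; rfl
  have h6 : (τ (ι r)).re ≤ ε := (Complex.re_le_norm _).trans ((τ.norm_trace_le _).trans hr)
  rw [h1, h4, Complex.sub_re]
  linarith

/-- The projection of `M` onto `L²(A)` takes values in `A`: existence of the trace preserving
conditional expectation. -/
theorem exists_expect_eq (h : A ≤ M) (x : M) :
    ∃ a : A, τ.expect h (τ.toL2 x) = τ.toL2 (inclusion h a) := by
  wlog hx : ‖x‖ ≤ 1 generalizing x
  · have hx0 : ((‖x‖ : ℝ) : ℂ) ≠ 0 := by
      rw [not_le] at hx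
      exact_mod_cast (zero_lt_one.trans hx).ne'
    obtain ⟨a, ha⟩ := this (((‖x‖⁻¹ : ℝ) : ℂ) • x) (by
      rw [norm_smul, Complex.norm_real, norm_inv, norm_norm]
      exact inv_mul_le_one)
    refine ⟨((‖x‖ : ℝ) : ℂ) • a, ?_⟩
    rw [map_smul, map_smul] at ha
    rw [map_smul, map_smul, ← ha, smul_smul]
    push_cast
    rw [mul_inv_cancel₀ hx0, one_smul]
  set ξ := τ.expect h (τ.toL2 x)
  set C : Set τ.L2 := (fun a : A => τ.toL2 (inclusion h a)) '' {a | ‖a‖ ≤ 1}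
  have hCne : C.Nonempty := ⟨_, 0, by simp, rfl⟩
  -- The image of the unit ball of A is closed and convex, so ξ has a nearest point k in it; the
  -- goal becomes ξ = k.
  obtain ⟨k, hk, hmin⟩ : ∃ k ∈ C, ∀ w ∈ C, (⟪ξ - k, w - k⟫_ℂ).re ≤ 0 := by
    refine exists_re_inner_sub_nonpos hCne (τ.isClosed_image_ball h).isComplete ?_ ξ
    rintro _ ⟨a, ha, rfl⟩ _ ⟨b, hb, rfl⟩ s t hs ht hst
    refine ⟨(s : ℂ) • a + (t : ℂ) • b, ?_, by simp only [map_add, map_smul]⟩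
    refine (norm_add_le _ _).trans ?_
    rw [norm_smul, norm_smul, Complex.norm_real, Complex.norm_real, Real.norm_of_nonneg hs,
      Real.norm_of_nonneg ht, ← hst]
    exact add_le_add (mul_le_of_le_one_right hs ha) (mul_le_of_le_one_right ht hb)
  set η := ξ - k
  have hη : η ∈ τ.L2Sub h := by
    obtain ⟨a, -, rfl⟩ := hk
    exact Submodule.sub_mem _ (τ.expect_mem h _) (τ.toL2_inclusion_mem h a)
  have hmin' : ∀ w ∈ C, (⟪η, w⟫_ℂ).re ≤ (⟪η, k⟫_ℂ).re := by
    intro w hw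
    have h1 : (⟪η, w - k⟫_ℂ).re ≤ 0 := hmin w hw
    rw [inner_sub_right, Complex.sub_re] at h1
    linarith
  -- Against vectors of L²(A), x does no better than contractions of A, and k is the best of these
  -- in the direction η. Replacing η by c costs ε twice, and the approximate polar decomposition
  -- costs ε once.
  have hkey : ∀ ε : ℝ, 0 < ε → (⟪η, ξ⟫_ℂ).re ≤ (⟪η, k⟫_ℂ).re + 3 * ε := by
    intro ε hε
    obtain ⟨c, hc⟩ : ∃ c : A, ‖η - τ.toL2 (inclusion h c)‖ < ε := by
      have h1 : η ∈ closure (LinearMap.range (τ.toL2 ∘ₗ (inclusion h).toLinearMap) : Set τ.L2) := hη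
      obtain ⟨_, ⟨c, rfl⟩, hc⟩ := Metric.mem_closure_iff.mp h1 ε hε
      exact ⟨c, by rwa [dist_eq_norm] at hc⟩
    obtain ⟨a, ha, hle⟩ := τ.exists_contraction_re_inner_le h hx c hε
    have h2 : ⟪η, ξ⟫_ℂ = ⟪η, τ.toL2 x⟫_ℂ := by
      rw [← inner_expect_left, τ.expect_eq_self h hη]
    have h3 : ∀ y : M, ‖y‖ ≤ 1 →
        |(⟪η, τ.toL2 y⟫_ℂ).re - (⟪τ.toL2 (inclusion h c), τ.toL2 y⟫_ℂ).re| ≤ ε := by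
      intro y hy
      rw [← Complex.sub_re, ← inner_sub_left]
      refine (Complex.abs_re_le_norm _).trans ((norm_inner_le_norm _ _).trans ?_)
      calc _ ≤ ε * 1 := mul_le_mul hc.le ((τ.norm_toL2_le y).trans hy) (norm_nonneg _) hε.le
        _ = ε := mul_one _
    have h4 := abs_le.mp (h3 x hx)
    have h5 := abs_le.mp (h3 (inclusion h a) ha)
    have h6 := hmin' _ ⟨a, ha, rfl⟩
    rw [h2]
    linarith [h4.1, h4.2, h5.1, h5.2]
  have h7 : ‖η‖ ^ 2 ≤ 0 := by
    refine le_of_forall_pos_le_add fun ε hε => ?_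
    have h8 := hkey (ε / 3) (by positivity)
    have h9 : ‖η‖ ^ 2 = (⟪η, ξ⟫_ℂ).re - (⟪η, k⟫_ℂ).re := by
      rw [← Complex.sub_re, ← inner_sub_right, ← inner_self_eq_norm_sq (𝕜 := ℂ)]; rfl
    linarith
  have h10 : η = 0 := by
    rw [← norm_eq_zero]
    exact pow_eq_zero_iff two_ne_zero |>.mp (le_antisymm h7 (sq_nonneg _))
  obtain ⟨a, -, ha⟩ := hk
  exact ⟨a, (sub_eq_zero.mp h10).trans ha.symm⟩

end VonNeumannAlgebra.TracialState

theorem tendsto_inner_of_denseRange {E X ι : Type*} [NormedAddCommGroup E] [InnerProductSpace ℂ E]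
    {e : X → E} (he : DenseRange e) {l : Filter ι} {f : ι → E} {a : E} {C : ℝ}
    (hf : ∀ᶠ i in l, ‖f i‖ ≤ C) (h : ∀ x, Tendsto (fun i => ⟪e x, f i⟫_ℂ) l (𝓝 ⟪e x, a⟫_ℂ))
    (ζ : E) : Tendsto (fun i => ⟪ζ, f i⟫_ℂ) l (𝓝 ⟪ζ, a⟫_ℂ) := by
  rw [Metric.tendsto_nhds]
  intro ε hε
  set D : ℝ := max C ‖a‖ + 1
  have hD : 0 < D := by
    have := (norm_nonneg a).trans (le_max_right C ‖a‖)
    positivity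
  obtain ⟨x, hx⟩ := he.exists_dist_lt ζ (show 0 < ε / (3 * D) by positivity)
  rw [dist_eq_norm] at hx
  have hb : ∀ v : E, ‖v‖ ≤ D → ‖⟪ζ, v⟫_ℂ - ⟪e x, v⟫_ℂ‖ ≤ ε / 3 := by
    intro v hv
    rw [← inner_sub_left]
    calc _ ≤ ‖ζ - e x‖ * ‖v‖ := norm_inner_le_norm _ _
      _ ≤ ε / (3 * D) * D := by gcongr
      _ = ε / 3 := by field_simp
  filter_upwards [hf, Metric.tendsto_nhds.mp (h x) (ε / 3) (by positivity)] with i hi hi2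
  have h1 := hb (f i) ((hi.trans (le_max_left C ‖a‖)).trans (le_add_of_nonneg_right zero_le_one))
  have h2 := hb a ((le_max_right C ‖a‖).trans (le_add_of_nonneg_right zero_le_one))
  rw [dist_eq_norm] at hi2 ⊢
  have h3 : ⟪ζ, f i⟫_ℂ - ⟪ζ, a⟫_ℂ = (⟪ζ, f i⟫_ℂ - ⟪e x, f i⟫_ℂ) +
    (⟪e x, f i⟫_ℂ - ⟪e x, a⟫_ℂ) - (⟪ζ, a⟫_ℂ - ⟪e x, a⟫_ℂ) := by ring
  rw [h3]
  linarith [norm_sub_le ((⟪ζ, f i⟫_ℂ - ⟪e x, f i⟫_ℂ) + (⟪e x, f i⟫_ℂ - ⟪e x, a⟫_ℂ))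
    (⟪ζ, a⟫_ℂ - ⟪e x, a⟫_ℂ), norm_add_le (⟪ζ, f i⟫_ℂ - ⟪e x, f i⟫_ℂ) (⟪e x, f i⟫_ℂ - ⟪e x, a⟫_ℂ)]

theorem smul_add_smul_mem_closure {E : Type*} [NormedAddCommGroup E] [NormedSpace ℂ E] {S : Set E}
    {s t : ℂ} (h : ∀ v ∈ S, ∀ w ∈ S, s • v + t • w ∈ S) {v w : E} (hv : v ∈ closure S)
    (hw : w ∈ closure S) : s • v + t • w ∈ closure S :=
  map_mem_closure₂ (f := fun v w : E => s • v + t • w) (by fun_prop) hv hw h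

/-! ### Density of a *-algebra in its bicommutant, in the strong sense and in L². -/

section DoubleCommutant

variable {H : Type u} [NormedAddCommGroup H] [InnerProductSpace ℂ H] [CompleteSpace H]

/-- The diagonal amplification of an operator. -/
noncomputable def diagOp (ι : Type*) [Fintype ι] (x : H →L[ℂ] H) :
    PiLp 2 (fun _ : ι => H) →L[ℂ] PiLp 2 (fun _ : ι => H) :=
  (PiLp.continuousLinearEquiv 2 ℂ (fun _ : ι => H)).symm.toContinuousLinearMap ∘L
    (ContinuousLinearMap.pi fun i => x ∘L ContinuousLinearMap.proj i) ∘L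
    (PiLp.continuousLinearEquiv 2 ℂ (fun _ : ι => H)).toContinuousLinearMap

variable {ι : Type*} [Fintype ι]

set_option linter.unusedSectionVars false

@[simp] theorem diagOp_apply (x : H →L[ℂ] H) (v : PiLp 2 (fun _ : ι => H)) (i : ι) :
    diagOp ι x v i = x (v i) := rfl

theorem diagOp_add (x y : H →L[ℂ] H) (v : PiLp 2 (fun _ : ι => H)) :
    diagOp ι (x + y) v = diagOp ι x v + diagOp ι y v := rfl

theorem diagOp_smul (c : ℂ) (x : H →L[ℂ] H) (v : PiLp 2 (fun _ : ι => H)) :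
    diagOp ι (c • x) v = c • diagOp ι x v := rfl

theorem inner_diagOp_left (x : H →L[ℂ] H) (v w : PiLp 2 (fun _ : ι => H)) :
    ⟪diagOp ι x v, w⟫_ℂ = ⟪v, diagOp ι (star x) w⟫_ℂ := by
  simp [PiLp.inner_apply, ContinuousLinearMap.star_eq_adjoint,
    ContinuousLinearMap.adjoint_inner_right]

/-- Von Neumann's density theorem. -/
theorem diagOp_mem_closure (N : StarSubalgebra ℂ (H →L[ℂ] H)) {x : H →L[ℂ] H}
    (hx : x ∈ Set.centralizer (Set.centralizer (N : Set (H →L[ℂ] H))))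
    (ξ : PiLp 2 (fun _ : ι => H)) :
    diagOp ι x ξ ∈ closure ((fun y => diagOp ι y ξ) '' (N : Set (H →L[ℂ] H))) := by
  classical
  let W₀ : Submodule ℂ (PiLp 2 (fun _ : ι => H)) :=
    { carrier := (fun y => diagOp ι y ξ) '' (N : Set (H →L[ℂ] H))
      add_mem' := by
        rintro _ _ ⟨y, hy, rfl⟩ ⟨z, hz, rfl⟩
        exact ⟨y + z, add_mem hy hz, by ext i; simp⟩
      zero_mem' := ⟨0, zero_mem N, by ext i; simp⟩
      smul_mem' := by
        rintro c _ ⟨y, hy, rfl⟩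
        exact ⟨c • y, N.smul_mem hy c, by ext i; simp⟩ }
  let W := W₀.topologicalClosure
  have : CompleteSpace W := (Submodule.isClosed_topologicalClosure _).completeSpace_coe
  have hinv : ∀ y ∈ N, ∀ w ∈ W, diagOp ι y w ∈ W := by
    intro y hy w hw
    have h1 : Set.MapsTo (diagOp ι y) (W₀ : Set _) W₀ := by
      rintro _ ⟨z, hz, rfl⟩
      exact ⟨y * z, mul_mem hy hz, by ext i; simp⟩
    have h2 := h1.closure (diagOp ι y).continuous
    rw [← Submodule.topologicalClosure_coe] at h2
    exact h2 hw
  have hξ : ξ ∈ W := W₀.le_topologicalClosure ⟨1, one_mem N, by ext i; simp⟩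
  let P := W.starProjection
  have hcomm : ∀ y ∈ N, ∀ v, P (diagOp ι y v) = diagOp ι y (P v) := by
    intro y hy v
    have h1 : diagOp ι y (P v) ∈ W := hinv y hy _ (W.starProjection_apply_mem v)
    have h2 : diagOp ι y (v - P v) ∈ Wᗮ := by
      rw [Submodule.mem_orthogonal']
      intro w hw
      rw [inner_diagOp_left]
      exact Submodule.inner_left_of_mem_orthogonal (hinv _ (star_mem hy) w hw)
        (W.sub_starProjection_mem_orthogonal v)
    have h3 : diagOp ι y v = diagOp ι y (P v) + diagOp ι y (v - P v) := by
      rw [← map_add]; simp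
    rw [h3, map_add, Submodule.starProjection_eq_self_iff.mpr h1,
      (W.starProjection_apply_eq_zero_iff).mpr h2, add_zero]
  let emb : ι → H →L[ℂ] PiLp 2 (fun _ : ι => H) := fun j =>
    (PiLp.continuousLinearEquiv 2 ℂ (fun _ : ι => H)).symm.toContinuousLinearMap ∘L
      (ContinuousLinearMap.single ℂ (fun _ : ι => H) j)
  -- The projection onto the closure of Nξ commutes with the amplified N, so its matrix entries lie
  -- in the commutant of N and hence commute with x.
  let Pij : ι → ι → H →L[ℂ] H := fun i j => PiLp.proj 2 (fun _ : ι => H) i ∘L P ∘L emb j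
  have hemb : ∀ (y : H →L[ℂ] H) j v, diagOp ι y (emb j v) = emb j (y v) := by
    intro y j v
    ext i
    by_cases hij : i = j
    · subst hij; simp [emb]
    · simp [emb, hij]
  have hsum : ∀ v : PiLp 2 (fun _ : ι => H), v = ∑ j, emb j (v j) := by
    intro v
    ext i
    simp [emb, Finset.sum_apply, Pi.single_apply]
  have hPc : ∀ i j, Pij i j ∈ Set.centralizer (N : Set (H →L[ℂ] H)) := by
    intro i j
    rw [Set.mem_centralizer_iff]
    intro y hy
    ext v
    have h1 := congrArg (fun w : PiLp 2 (fun _ : ι => H) => w i) (hcomm y hy (emb j v))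
    rw [hemb] at h1
    exact h1.symm
  have hxP : ∀ v, P (diagOp ι x v) = diagOp ι x (P v) := by
    intro v
    have key : ∀ j w, P (diagOp ι x (emb j w)) = diagOp ι x (P (emb j w)) := by
      intro j w
      ext i
      rw [hemb]
      exact (congrArg (fun S : H →L[ℂ] H => S w)
        (Set.mem_centralizer_iff.mp hx _ (hPc i j)))
    rw [hsum v]
    simp only [map_sum, key]
  have h4 : diagOp ι x ξ ∈ W := by
    have h5 := hxP ξ
    rw [Submodule.starProjection_eq_self_iff.mpr hξ] at h5
    rw [← h5]
    exact W.starProjection_apply_mem _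
  exact h4

/-- The sum of the two coefficients is a single coefficient of the amplification over ι ⊕ ι, at the
vectors (η, ξ) and (ξ, η), so the density theorem applies to it. -/
theorem inner_diagOp_add_eq_zero (N : StarSubalgebra ℂ (H →L[ℂ] H))
    (ξ η : PiLp 2 (fun _ : ι => H))
    (h : ∀ y ∈ N, ⟪η, diagOp ι y ξ⟫_ℂ + ⟪ξ, diagOp ι y η⟫_ℂ = 0) {x : H →L[ℂ] H}
    (hx : x ∈ Set.centralizer (Set.centralizer (N : Set (H →L[ℂ] H)))) :
    ⟪η, diagOp ι x ξ⟫_ℂ + ⟪ξ, diagOp ι x η⟫_ℂ = 0 := by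
  let p : (ι ⊕ ι → H) → PiLp 2 (fun _ : ι ⊕ ι => H) := fun v => WithLp.toLp 2 v
  have h1 := diagOp_mem_closure N hx (p (Sum.elim ξ η))
  have h2 : ∀ y, ⟪η, diagOp ι y ξ⟫_ℂ + ⟪ξ, diagOp ι y η⟫_ℂ =
      ⟪p (Sum.elim η ξ), diagOp (ι ⊕ ι) y (p (Sum.elim ξ η))⟫_ℂ := by
    intro y
    simp [PiLp.inner_apply, p]
  rw [h2]
  refine closure_minimal (s := (fun y => diagOp (ι ⊕ ι) y (p (Sum.elim ξ η))) '' (N : Set _))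
    (t := {w | ⟪p (Sum.elim η ξ), w⟫_ℂ = 0}) ?_ (isClosed_eq (by fun_prop) (by fun_prop)) h1
  rintro _ ⟨y, hy, rfl⟩
  exact (h2 y).symm.trans (h y hy)

theorem exists_selfAdjoint_add_smul (N : StarSubalgebra ℂ (H →L[ℂ] H)) {y : H →L[ℂ] H}
    (hy : y ∈ N) : ∃ a ∈ N, ∃ b ∈ N, IsSelfAdjoint a ∧ IsSelfAdjoint b ∧
      y = a + (-Complex.I) • b := by
  refine ⟨(1 / 2 : ℂ) • (y + star y), N.smul_mem (add_mem hy (star_mem hy)) _,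
    (Complex.I / 2 : ℂ) • (y - star y), N.smul_mem (sub_mem hy (star_mem hy)) _, ?_, ?_, ?_⟩
  · rw [isSelfAdjoint_iff]; simp [add_comm]
  · rw [isSelfAdjoint_iff, star_smul, star_sub, star_star]
    have : star (Complex.I / 2) = -(Complex.I / 2) := by simp [neg_div]
    rw [this, neg_smul, ← smul_neg, neg_sub]
  · rw [smul_smul]
    have : -Complex.I * (Complex.I / 2) = 1 / 2 := by
      rw [neg_mul, mul_div_assoc', Complex.I_mul_I]; norm_num
    rw [this, ← smul_add, add_add_sub_cancel, ← two_smul ℂ y, smul_smul]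
    norm_num

/-- Self-adjoint elements of the double commutant are strong limits of self-adjoint elements. -/
theorem diagOp_mem_closure_selfAdjoint (N : StarSubalgebra ℂ (H →L[ℂ] H)) {x : H →L[ℂ] H}
    (hx : x ∈ Set.centralizer (Set.centralizer (N : Set (H →L[ℂ] H)))) (hxs : IsSelfAdjoint x)
    (ξ : PiLp 2 (fun _ : ι => H)) :
    diagOp ι x ξ ∈ closure ((fun y => diagOp ι y ξ) '' {y | y ∈ N ∧ IsSelfAdjoint y}) := by
  set S := (fun y => diagOp ι y ξ) '' {y | y ∈ N ∧ IsSelfAdjoint y} with hS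
  have hreal : ∀ (s : ℝ) (y : H →L[ℂ] H), IsSelfAdjoint y → IsSelfAdjoint ((s : ℂ) • y) :=
    fun s y hy => by
      rw [isSelfAdjoint_iff, star_smul, hy.star_eq]
      exact congrArg (· • y) (Complex.conj_ofReal s)
  have hSlin : ∀ s t : ℝ, ∀ v ∈ S, ∀ w ∈ S, (s : ℂ) • v + (t : ℂ) • w ∈ S := by
    rintro s t _ ⟨y, ⟨hy, hys⟩, rfl⟩ _ ⟨z, ⟨hz, hzs⟩, rfl⟩
    exact ⟨(s : ℂ) • y + (t : ℂ) • z, ⟨add_mem (N.smul_mem hy _) (N.smul_mem hz _),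
      (hreal s y hys).add (hreal t z hzs)⟩, rfl⟩
  have hSconv : ∀ s t : ℝ, ∀ v ∈ closure S, ∀ w ∈ closure S,
      (s : ℂ) • v + (t : ℂ) • w ∈ closure S :=
    fun s t v hv w hw => smul_add_smul_mem_closure (hSlin s t) hv hw
  have h0 : (0 : PiLp 2 (fun _ : ι => H)) ∈ closure S :=
    subset_closure ⟨0, ⟨zero_mem N, IsSelfAdjoint.zero _⟩, rfl⟩
  clear_value S
  obtain ⟨k, hk, hmin⟩ := exists_re_inner_sub_nonpos ⟨0, h0⟩ isClosed_closure.isComplete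
    (fun v hv w hw s t _ _ _ => hSconv s t v hv w hw) (diagOp ι x ξ)
  set η := diagOp ι x ξ - k
  have hη : ∀ w ∈ closure S, (⟪η, w⟫_ℂ).re = 0 := by
    intro w hw
    have h1 := hmin _ (hSconv 1 1 k hk w hw)
    have h2 := hmin _ (hSconv 1 (-1) k hk w hw)
    simp at h1 h2
    linarith
  -- The residual η is real-orthogonal to the self-adjoint orbit. On self-adjoint y the
  -- complex-linear functional below is twice that real part, so it vanishes there, then on all of N
  -- by linearity, then on x by density. This gives Re⟨η, xξ⟩ = 0 and so η = 0.
  have hsa : ∀ y, IsSelfAdjoint y → (⟪η, diagOp ι y ξ⟫_ℂ + ⟪ξ, diagOp ι y η⟫_ℂ =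
      ((2 * (⟪η, diagOp ι y ξ⟫_ℂ).re : ℝ) : ℂ)) := by
    intro y hy
    have h1 : ⟪ξ, diagOp ι y η⟫_ℂ = starRingEnd ℂ ⟪η, diagOp ι y ξ⟫_ℂ := by
      rw [inner_conj_symm, inner_diagOp_left, hy.star_eq]
    rw [h1, Complex.add_conj]
  have hz : ∀ y ∈ N, ⟪η, diagOp ι y ξ⟫_ℂ + ⟪ξ, diagOp ι y η⟫_ℂ = 0 := by
    have hz' : ∀ y ∈ N, IsSelfAdjoint y → ⟪η, diagOp ι y ξ⟫_ℂ + ⟪ξ, diagOp ι y η⟫_ℂ = 0 := by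
      intro y hy hys
      rw [hsa y hys, hη _ (subset_closure (hS ▸ ⟨y, ⟨hy, hys⟩, rfl⟩))]
      simp
    intro y hy
    obtain ⟨a, ha, b, hb, has, hbs, rfl⟩ := exists_selfAdjoint_add_smul N hy
    have hr := hz' a ha has
    have hi := hz' b hb hbs
    rw [diagOp_add, diagOp_add, diagOp_smul, diagOp_smul, inner_add_right, inner_add_right,
      inner_smul_right, inner_smul_right]
    linear_combination hr + (-Complex.I) * hi
  have h5 := inner_diagOp_add_eq_zero N ξ η hz hx
  rw [hsa x hxs] at h5
  have h6 : (⟪η, diagOp ι x ξ⟫_ℂ).re = 0 := by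
    have := congrArg Complex.re h5
    simpa using this
  have h7 : ‖η‖ ^ 2 = 0 := by
    have h8 : ‖η‖ ^ 2 = (⟪η, diagOp ι x ξ⟫_ℂ).re - (⟪η, k⟫_ℂ).re := by
      rw [← Complex.sub_re, ← inner_sub_right, ← inner_self_eq_norm_sq (𝕜 := ℂ)]; rfl
    rw [h8, h6, hη k hk, sub_zero]
  have h8 : η = 0 := norm_eq_zero.mp (pow_eq_zero_iff two_ne_zero |>.mp h7)
  rw [sub_eq_zero.mp h8]
  exact hk

end DoubleCommutant

section Resolvent

variable {H : Type u} [NormedAddCommGroup H] [InnerProductSpace ℂ H] [CompleteSpace H]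

/-- The resolvent of a self-adjoint operator at `-i`. -/
theorem exists_resolvent (N : StarSubalgebra ℂ (H →L[ℂ] H)) (hN : IsClosed (N : Set (H →L[ℂ] H)))
    {y : H →L[ℂ] H} (hy : y ∈ N) (hys : IsSelfAdjoint y) :
    ∃ R ∈ N, ‖R‖ ≤ 1 ∧ (y + Complex.I • (1 : H →L[ℂ] H)) * R = 1 ∧
      R * (y + Complex.I • (1 : H →L[ℂ] H)) = 1 := by
  have hu : IsUnit (y + Complex.I • (1 : H →L[ℂ] H)) := by
    have h1 : -Complex.I ∉ spectrum ℂ y := fun h => by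
      have := hys.im_eq_zero_of_mem_spectrum h
      simp at this
    rw [spectrum.notMem_iff] at h1
    have h2 : y + Complex.I • (1 : H →L[ℂ] H) =
        -(algebraMap ℂ (H →L[ℂ] H) (-Complex.I) - y) := by
      rw [Algebra.algebraMap_eq_smul_one]; simp
    rw [h2]
    exact h1.neg
  have hm : y + Complex.I • (1 : H →L[ℂ] H) ∈ N := add_mem hy (N.smul_mem (one_mem N) _)
  obtain ⟨D, hD⟩ := hu
  refine ⟨↑D⁻¹, ?_, ?_, by rw [← hD]; exact D.mul_inv, by rw [← hD]; exact D.inv_mul⟩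
  -- Spectral permanence: the inverse already lies in the closed *-subalgebra.
  · have h3 : IsUnit (⟨y + Complex.I • (1 : H →L[ℂ] H), hm⟩ : N) := N.coe_isUnit.mp ⟨D, hD⟩
    obtain ⟨E, hE⟩ := h3
    have h4 : (D : H →L[ℂ] H) * ((↑E⁻¹ : N) : H →L[ℂ] H) = 1 := by
      have h5 := congrArg (fun z : N => (z : H →L[ℂ] H)) E.mul_inv
      rw [hE] at h5
      rw [hD]
      exact h5
    rw [Units.inv_eq_of_mul_eq_one_right h4]
    exact (↑E⁻¹ : N).2
  · refine ContinuousLinearMap.opNorm_le_bound _ zero_le_one fun v => ?_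
    set w : H := (↑D⁻¹ : H →L[ℂ] H) v
    have h1 : v = y w + Complex.I • w := by
      have : ((D : H →L[ℂ] H) * ↑D⁻¹) v = v := by rw [D.mul_inv]; rfl
      rw [hD] at this
      exact this.symm
    -- Since ⟨yw, w⟩ is real, yw and iw are real-orthogonal, so ‖v‖² = ‖yw‖² + ‖w‖².
    have h2 : (⟪y w, Complex.I • w⟫_ℂ).re = 0 := by
      have h3 : (⟪y w, w⟫_ℂ).im = 0 := by
        have h4 := hys.isSymmetric.conj_inner_sym w w
        exact Complex.conj_eq_iff_im.mp h4
      rw [inner_smul_right]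
      simp [h3]
    have h5 : ‖w‖ ^ 2 ≤ ‖v‖ ^ 2 := by
      rw [h1, @norm_add_sq ℂ, norm_smul, Complex.norm_I, one_mul]
      rw [show RCLike.re ⟪y w, Complex.I • w⟫_ℂ = 0 from h2]
      nlinarith [sq_nonneg ‖y w‖]
    rw [one_mul]
    exact (sq_le_sq₀ (norm_nonneg _) (norm_nonneg _)).mp h5

/-- A self-adjoint element of the double commutant is the strong limit of self-adjoint elements. -/
theorem exists_filter_tendsto (N : StarSubalgebra ℂ (H →L[ℂ] H)) {x : H →L[ℂ] H}
    (hx : x ∈ Set.centralizer (Set.centralizer (N : Set (H →L[ℂ] H)))) (hxs : IsSelfAdjoint x) :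
    ∃ l : Filter {y : H →L[ℂ] H // y ∈ N ∧ IsSelfAdjoint y}, l.NeBot ∧
      ∀ v, Tendsto (fun y : {y : H →L[ℂ] H // y ∈ N ∧ IsSelfAdjoint y} => (y : H →L[ℂ] H) v) l (𝓝 (x v)) := by
  let F : {y : H →L[ℂ] H // y ∈ N ∧ IsSelfAdjoint y} → H → H := fun y => y
  refine ⟨comap F (𝓝 ⇑x), ?_, fun v => ?_⟩
  · rw [comap_neBot_iff]
    intro t ht
    rw [nhds_pi, Filter.mem_pi] at ht
    obtain ⟨I, hI, s, hs, hst⟩ := ht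
    have : Fintype I := hI.fintype
    let ξ : PiLp 2 (fun _ : I => H) := WithLp.toLp 2 fun i => (i : H)
    have h1 := mem_closure_iff_nhds.mp (diagOp_mem_closure_selfAdjoint N hx hxs ξ)
      {w | ∀ i : I, w i ∈ s i} (eventually_all.mpr fun i => by
        have h2 : Continuous fun w : PiLp 2 (fun _ : I => H) => w i := by fun_prop
        exact h2.continuousAt (hs i))
    obtain ⟨_, hw, y, hy, rfl⟩ := h1
    exact ⟨⟨y, hy⟩, hst fun i hi => hw ⟨i, hi⟩⟩
  · exact (tendsto_pi_nhds.mp tendsto_comap) v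

end Resolvent

namespace VonNeumannAlgebra.TracialState

variable {H : Type u} [NormedAddCommGroup H] [InnerProductSpace ℂ H] [CompleteSpace H]
  {M : VonNeumannAlgebra H} (τ : M.TracialState)

/-- The self-adjoint y ∈ N that converge strongly to x need not be bounded, but their resolvents S_y
are contractions. The identity S_y − R = S_y (x − y) R makes them converge strongly to R. Normality
gives weak convergence in L², and a closed subspace is weakly closed. This replaces Kaplansky's
density theorem. -/
theorem toL2_resolvent_mem {K : Submodule ℂ τ.L2} (hK : IsClosed (K : Set τ.L2))
    {N : StarSubalgebra ℂ (H →L[ℂ] H)} (hN : IsClosed (N : Set (H →L[ℂ] H)))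
    (hNM : ∀ y ∈ N, y ∈ M) (hNK : ∀ y : M, (y : H →L[ℂ] H) ∈ N → τ.toL2 y ∈ K)
    {x : H →L[ℂ] H} (hx : x ∈ Set.centralizer (Set.centralizer (N : Set (H →L[ℂ] H))))
    (hxs : IsSelfAdjoint x) {R : M} (hR : ‖R‖ ≤ 1)
    (hR1 : (x + Complex.I • (1 : H →L[ℂ] H)) * R = 1) : τ.toL2 R ∈ K := by
  obtain ⟨l, hl, hlt⟩ := exists_filter_tendsto N hx hxs
  have hres := fun y : {y : H →L[ℂ] H // y ∈ N ∧ IsSelfAdjoint y} =>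
    exists_resolvent N hN y.2.1 y.2.2
  choose S hSN hS1 hSr hSl using hres
  let T : {y : H →L[ℂ] H // y ∈ N ∧ IsSelfAdjoint y} → M := fun y => ⟨S y, hNM _ (hSN y)⟩
  have hdiff : ∀ y v, S y v - (R : H →L[ℂ] H) v =
      S y (x ((R : H →L[ℂ] H) v) - (y : H →L[ℂ] H) ((R : H →L[ℂ] H) v)) := by
    intro y v
    have h1 : S y = S y * ((x + Complex.I • (1 : H →L[ℂ] H)) * R) := by rw [hR1, mul_one]
    have h2 : (R : H →L[ℂ] H) = S y * ((y : H →L[ℂ] H) + Complex.I • (1 : H →L[ℂ] H)) * R := by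
      rw [hSl, one_mul]
    have h3 : S y - R = S y * ((x - y) * R) :=
      (congrArg₂ (· - ·) h1 h2).trans (by noncomm_ring)
    exact congrArg (fun S : H →L[ℂ] H => S v) h3
  have hstrong : ∀ v, Tendsto (fun y => S y v) l (𝓝 ((R : H →L[ℂ] H) v)) := by
    intro v
    rw [tendsto_iff_norm_sub_tendsto_zero]
    have h1 : Tendsto (fun y : {y : H →L[ℂ] H // y ∈ N ∧ IsSelfAdjoint y} =>
        ‖x ((R : H →L[ℂ] H) v) - (y : H →L[ℂ] H) ((R : H →L[ℂ] H) v)‖) l (𝓝 0) := by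
      have := (tendsto_const_nhds (x := x ((R : H →L[ℂ] H) v))).sub (hlt ((R : H →L[ℂ] H) v))
      rw [sub_self] at this
      simpa using this.norm
    refine squeeze_zero (fun _ => norm_nonneg _) (fun y => ?_) h1
    rw [hdiff]
    exact ((S y).le_of_opNorm_le (hS1 y) _).trans_eq (one_mul _)
  have hweak := τ.tendsto_inner_toL2 (l := l) (f := T) (a := R) (C := 1)
    (Eventually.of_forall hS1) hR
    (fun v w => (hstrong v).inner tendsto_const_nhds)
  have hweak' := tendsto_inner_of_denseRange τ.denseRange_toL2 (l := l)
    (f := fun y => τ.toL2 (T y)) (C := 1)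
    (Eventually.of_forall fun y => (τ.norm_toL2_le _).trans (hS1 y)) hweak
  have : CompleteSpace K := hK.completeSpace_coe
  rw [← K.orthogonal_orthogonal, Submodule.mem_orthogonal]
  intro ζ hζ
  refine tendsto_nhds_unique (hweak' ζ) ?_
  refine tendsto_const_nhds.congr fun y => ?_
  exact (Submodule.inner_left_of_mem_orthogonal (hNK (T y) (hSN y)) hζ).symm

/-- A self-adjoint x is recovered from the resolvents R_n = (x/(n+1) + i)⁻¹. The relation iR_n − 1 =
−R_n x/(n+1) puts R_n x in K, and it also shows iR_n → 1, so iR_n x → x in norm. -/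
theorem toL2_mem_of_generates {K : Submodule ℂ τ.L2} (hK : IsClosed (K : Set τ.L2))
    {N : StarSubalgebra ℂ (H →L[ℂ] H)} (hN : IsClosed (N : Set (H →L[ℂ] H)))
    (hNM : ∀ y ∈ N, y ∈ M) (hNK : ∀ y : M, (y : H →L[ℂ] H) ∈ N → τ.toL2 y ∈ K)
    (hMN : ∀ y ∈ M, y ∈ Set.centralizer (Set.centralizer (N : Set (H →L[ℂ] H)))) (x : M) :
    τ.toL2 x ∈ K := by
  have hsa : ∀ x : M, IsSelfAdjoint (x : H →L[ℂ] H) → τ.toL2 x ∈ K := by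
    intro x hxs
    have hres : ∀ n : ℕ, ∃ R : M, ‖R‖ ≤ 1 ∧ τ.toL2 R ∈ K ∧
        (((1 / (n + 1 : ℝ) : ℝ) : ℂ) • x + Complex.I • (1 : M)) * R = 1 ∧
        R * (((1 / (n + 1 : ℝ) : ℝ) : ℂ) • x + Complex.I • (1 : M)) = 1 := by
      intro n
      set t : ℝ := 1 / (n + 1 : ℝ)
      have hts : IsSelfAdjoint ((t : ℂ) • (x : H →L[ℂ] H)) := by
        rw [isSelfAdjoint_iff, star_smul, hxs.star_eq]
        exact congrArg (· • (x : H →L[ℂ] H)) (Complex.conj_ofReal t)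
      have htm : (t : ℂ) • (x : H →L[ℂ] H) ∈ M := M.toStarSubalgebra.smul_mem x.2 _
      obtain ⟨R, hRm, hR1, hRr, hRl⟩ := exists_resolvent M.toStarSubalgebra M.isClosed htm hts
      exact ⟨⟨R, hRm⟩, hR1, τ.toL2_resolvent_mem hK hN hNM hNK (hMN _ htm) hts hR1 hRr,
        Subtype.ext hRr, Subtype.ext hRl⟩
    choose R hR1 hRK hRr hRl using hres
    have h1K : τ.toL2 1 ∈ K := hNK 1 (one_mem N)
    have hid : ∀ n : ℕ, Complex.I • R n - 1 = -(((1 / (n + 1 : ℝ) : ℝ) : ℂ) • (R n * x)) := by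
      intro n
      have h1 := hRl n
      rw [mul_add, mul_smul_comm, mul_smul_comm, mul_one] at h1
      rw [← h1]
      abel
    have hRxK : ∀ n, τ.toL2 (R n * x) ∈ K := by
      intro n
      have h1 : R n * x = (-((n + 1 : ℝ) : ℂ)) • (Complex.I • R n - 1) := by
        rw [hid, smul_neg, neg_smul, neg_neg, smul_smul, ← Complex.ofReal_mul,
          mul_one_div_cancel (by positivity)]
        simp
      rw [h1, map_smul, map_sub, map_smul]
      exact K.smul_mem _ (K.sub_mem (K.smul_mem _ (hRK n)) h1K)
    have hlim : Tendsto (fun n => τ.toL2 (Complex.I • (R n * x))) atTop (𝓝 (τ.toL2 x)) := by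
      rw [tendsto_iff_norm_sub_tendsto_zero]
      have hb : ∀ n : ℕ, ‖τ.toL2 (Complex.I • (R n * x)) - τ.toL2 x‖ ≤
          1 / ((n : ℝ) + 1) * (‖x‖ * ‖x‖) := by
        intro n
        rw [← map_sub]
        refine (τ.norm_toL2_le _).trans ?_
        have h1 : Complex.I • (R n * x) - x = (Complex.I • R n - 1) * x := by
          rw [sub_mul, one_mul, smul_mul_assoc]
        rw [h1, hid, neg_mul, norm_neg, smul_mul_assoc, norm_smul, Complex.norm_real,
          Real.norm_of_nonneg (by positivity)]
        gcongr
        refine (norm_mul_le _ _).trans ?_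
        gcongr
        refine (norm_mul_le _ _).trans ?_
        exact mul_le_of_le_one_left (norm_nonneg _) (hR1 n)
      refine squeeze_zero (fun _ => norm_nonneg _) hb ?_
      simpa using (tendsto_one_div_add_atTop_nhds_zero_nat (𝕜 := ℝ)).mul_const (‖x‖ * ‖x‖)
    refine hK.mem_of_tendsto hlim (Eventually.of_forall fun n => ?_)
    rw [map_smul]
    exact K.smul_mem _ (hRxK n)
  obtain ⟨a, ha, b, hb, has, hbs, hx⟩ := exists_selfAdjoint_add_smul M.toStarSubalgebra x.2
  have hx' : x = (⟨a, ha⟩ : M) + (-Complex.I) • (⟨b, hb⟩ : M) := Subtype.ext hx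
  rw [hx', map_add, map_smul]
  exact K.add_mem (hsa _ has) (K.smul_mem _ (hsa _ hbs))

end VonNeumannAlgebra.TracialState

/-! ### Orthogonal decompositions of Hilbert spaces. -/

/-- A family of pairwise orthogonal projections with sum `1`. -/
structure IsOrthPartition {T E : Type*} [NormedAddCommGroup E] [InnerProductSpace ℂ E]
    (Q : T → E →L[ℂ] E) : Prop where
  symm : ∀ t ξ η, ⟪Q t ξ, η⟫_ℂ = ⟪ξ, Q t η⟫_ℂ
  idem : ∀ t ξ, Q t (Q t ξ) = Q t ξ
  orth : ∀ s t ξ, s ≠ t → Q s (Q t ξ) = 0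
  hasSum : ∀ ξ, HasSum (fun t => Q t ξ) ξ

namespace IsOrthPartition

variable {T E : Type*} [NormedAddCommGroup E] [InnerProductSpace ℂ E] {Q : T → E →L[ℂ] E}

theorem norm_sum_le (symm : ∀ t ξ η, ⟪Q t ξ, η⟫_ℂ = ⟪ξ, Q t η⟫_ℂ)
    (idem : ∀ t ξ, Q t (Q t ξ) = Q t ξ) (orth : ∀ s t ξ, s ≠ t → Q s (Q t ξ) = 0)
    (F : Finset T) (ξ : E) : ‖∑ t ∈ F, Q t ξ‖ ≤ ‖ξ‖ := by
  classical
  set η := ∑ t ∈ F, Q t ξ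
  have h1 : ⟪η, η⟫_ℂ = ⟪ξ, η⟫_ℂ := by
    have h2 : ∀ t ∈ F, Q t η = Q t ξ := by
      intro t ht
      rw [map_sum, Finset.sum_eq_single t (fun s _ hs => orth t s ξ hs.symm)
        (fun h => absurd ht h), idem]
    rw [show ⟪η, η⟫_ℂ = ∑ t ∈ F, ⟪Q t ξ, η⟫_ℂ from sum_inner _ _ _,
      show ⟪ξ, η⟫_ℂ = ∑ t ∈ F, ⟪ξ, Q t ξ⟫_ℂ from inner_sum _ _ _]
    refine Finset.sum_congr rfl fun t ht => ?_
    rw [symm, h2 t ht]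
  have h2 : ‖η‖ * ‖η‖ ≤ ‖ξ‖ * ‖η‖ := by
    rw [← inner_self_eq_norm_mul_norm (𝕜 := ℂ), h1]
    exact re_inner_le_norm _ _
  by_cases h0 : ‖η‖ = 0
  · rw [h0]; positivity
  · exact le_of_mul_le_mul_right h2 (lt_of_le_of_ne (norm_nonneg _) (Ne.symm h0))

theorem of_dense (symm : ∀ t ξ η, ⟪Q t ξ, η⟫_ℂ = ⟪ξ, Q t η⟫_ℂ)
    (idem : ∀ t ξ, Q t (Q t ξ) = Q t ξ) (orth : ∀ s t ξ, s ≠ t → Q s (Q t ξ) = 0)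
    {S : Set E} (hS : ∀ ξ, ξ ∈ closure (Submodule.span ℂ S : Set E))
    (hsum : ∀ ξ ∈ S, HasSum (fun t => Q t ξ) ξ) : IsOrthPartition Q where
  symm := symm
  idem := idem
  orth := orth
  hasSum ξ := by
    have hspan : ∀ ξ ∈ Submodule.span ℂ S, HasSum (fun t => Q t ξ) ξ := by
      intro ξ hξ
      induction hξ using Submodule.span_induction with
      | mem x hx => exact hsum x hx
      | zero => simp
      | add x y _ _ hx hy => simpa using hx.add hy
      | smul c x _ hx => simpa using hx.const_smul c
    rw [HasSum, Metric.tendsto_nhds]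
    intro ε hε
    obtain ⟨η, hη, hd⟩ := Metric.mem_closure_iff.mp (hS ξ) (ε / 3) (by positivity)
    rw [dist_eq_norm] at hd
    filter_upwards [Metric.tendsto_nhds.mp (hspan η hη) (ε / 3) (by positivity)] with F hF
    rw [dist_eq_norm] at hF ⊢
    have h1 := norm_sum_le symm idem orth F (ξ - η)
    have h2 : ∑ t ∈ F, Q t ξ - ξ =
        ∑ t ∈ F, Q t (ξ - η) + (∑ t ∈ F, Q t η - η) - (ξ - η) := by
      simp only [map_sub, Finset.sum_sub_distrib]; abel
    rw [h2]
    linarith [norm_sub_le (∑ t ∈ F, Q t (ξ - η) + (∑ t ∈ F, Q t η - η)) (ξ - η),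
      norm_add_le (∑ t ∈ F, Q t (ξ - η)) (∑ t ∈ F, Q t η - η)]

theorem inner_self_apply (hQ : IsOrthPartition Q) (t : T) (ξ : E) :
    ⟪ξ, Q t ξ⟫_ℂ = ((‖Q t ξ‖ ^ 2 : ℝ) : ℂ) := by
  rw [← hQ.idem, ← hQ.symm, inner_self_eq_norm_sq_to_K, hQ.idem]
  push_cast; rfl

theorem hasSum_norm_sq (hQ : IsOrthPartition Q) (ξ : E) :
    HasSum (fun t => ‖Q t ξ‖ ^ 2) (‖ξ‖ ^ 2) := by
  have h1 := (hQ.hasSum ξ).mapL (innerSL ℂ ξ)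
  have h2 := Complex.hasSum_re h1
  simp only [innerSL_apply_apply, hQ.inner_self_apply] at h2
  simpa [inner_self_eq_norm_sq_to_K, ← Complex.ofReal_pow] using h2

theorem rTensor (hQ : IsOrthPartition Q) (F : Type*) [NormedAddCommGroup F]
    [InnerProductSpace ℂ F] : IsOrthPartition fun t => (Q t).rTensor F where
  symm t ξ η := by
    induction ξ using TensorProduct.induction_on with
    | zero => simp
    | add x y hx hy => simp only [map_add, inner_add_left, hx, hy]
    | tmul e f =>
      induction η using TensorProduct.induction_on with
      | zero => simp
      | add x y hx hy => simp only [map_add, inner_add_right, hx, hy]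
      | tmul e' f' => simp [hQ.symm]
  idem t ξ := by
    induction ξ using TensorProduct.induction_on with
    | zero => simp
    | add x y hx hy => simp only [map_add, hx, hy]
    | tmul e f => simp [hQ.idem]
  orth s t ξ hst := by
    induction ξ using TensorProduct.induction_on with
    | zero => simp
    | add x y hx hy => simp only [map_add, hx, hy, add_zero]
    | tmul e f => simp [hQ.orth s t _ hst]
  hasSum ξ := by
    induction ξ using TensorProduct.induction_on with
    | zero => simp
    | add x y hx hy => simpa using hx.add hy
    | tmul e f =>
      have h1 := (hQ.hasSum e).mapL ((TensorProduct.mkL ℂ E F).flip f)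
      simpa using h1

end IsOrthPartition

/-! ### Crossed products and their Fourier decomposition. -/

namespace VonNeumannAlgebra.TracialState

variable {H : Type u} [NormedAddCommGroup H] [InnerProductSpace ℂ H] [CompleteSpace H]
  {M A : VonNeumannAlgebra H} {τ : M.TracialState}

theorem expect_eq_of_inner_eq (h : A ≤ M) {ξ η : τ.L2} (hη : η ∈ τ.L2Sub h)
    (hi : ∀ a : A, ⟪τ.toL2 (inclusion h a), ξ⟫_ℂ = ⟪τ.toL2 (inclusion h a), η⟫_ℂ) :
    τ.expect h ξ = η := by
  rw [← sub_eq_zero, ← inner_self_eq_zero (𝕜 := ℂ)]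
  have h1 : τ.expect h ξ - η ∈ τ.L2Sub h := Submodule.sub_mem _ (τ.expect_mem h ξ) hη
  refine τ.L2Sub_induction h (p := fun ζ => ⟪ζ, τ.expect h ξ - η⟫_ℂ = 0)
    (isClosed_eq (by fun_prop) (by fun_prop)) (fun a => ?_) h1
  rw [inner_sub_right, inner_toL2_expect, hi, sub_self]

section Unitary

variable (τ)

/-- Left multiplication by a unitary. -/
noncomputable def leftIso (x : unitary M) : τ.L2 →ₗᵢ[ℂ] τ.L2 where
  toLinearMap := (τ.leftMul x : τ.L2 →L[ℂ] τ.L2)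
  norm_map' ξ := by
    change ‖τ.leftMul x ξ‖ = ‖ξ‖
    rw [@norm_eq_sqrt_re_inner ℂ, @norm_eq_sqrt_re_inner ℂ _ _ _ _ ξ, inner_leftMul_left,
      ← leftMul_mul_apply, Unitary.coe_star_mul_self, _root_.map_one]
    rfl

/-- Right multiplication by the adjoint of a unitary. -/
noncomputable def rightIso (x : unitary M) : τ.L2 →ₗᵢ[ℂ] τ.L2 where
  toLinearMap := (τ.rightMul (MulOpposite.op (star (x : M))) : τ.L2 →L[ℂ] τ.L2)
  norm_map' ξ := by
    change ‖τ.rightMul _ ξ‖ = ‖ξ‖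
    rw [@norm_eq_sqrt_re_inner ℂ, @norm_eq_sqrt_re_inner ℂ _ _ _ _ ξ, inner_rightMul_left,
      ← rightMul_mul_apply, ← MulOpposite.op_star, ← MulOpposite.op_mul, star_star,
      Unitary.coe_star_mul_self]
    simp

variable {τ}

theorem leftIso_apply (x : unitary M) (ξ : τ.L2) : τ.leftIso x ξ = τ.leftMul (x : M) ξ := rfl

theorem rightIso_apply (x : unitary M) (ξ : τ.L2) :
    τ.rightIso x ξ = τ.rightMul (MulOpposite.op (star (x : M))) ξ := rfl

@[simp] theorem leftIso_toL2 (x : unitary M) (y : M) :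
    τ.leftIso x (τ.toL2 y) = τ.toL2 (x * y) := by rw [leftIso_apply, leftMul_toL2]

@[simp] theorem rightIso_toL2 (x : unitary M) (y : M) :
    τ.rightIso x (τ.toL2 y) = τ.toL2 (y * star (x : M)) := by
  rw [rightIso_apply, rightMul_toL2]; rfl

theorem leftIso_mul (x y : unitary M) (ξ : τ.L2) :
    τ.leftIso (x * y) ξ = τ.leftIso x (τ.leftIso y ξ) := τ.leftMul_mul_apply _ _ _

theorem rightIso_mul (x y : unitary M) (ξ : τ.L2) :
    τ.rightIso (x * y) ξ = τ.rightIso x (τ.rightIso y ξ) := by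
  simp only [rightIso_apply]
  rw [← rightMul_mul_apply, ← MulOpposite.op_mul, ← star_mul]
  rfl

theorem leftIso_one (ξ : τ.L2) : τ.leftIso 1 ξ = ξ := by
  rw [leftIso_apply, OneMemClass.coe_one, _root_.map_one]; rfl

theorem rightIso_one (ξ : τ.L2) : τ.rightIso 1 ξ = ξ := by
  rw [rightIso_apply, OneMemClass.coe_one, star_one, MulOpposite.op_one, _root_.map_one]; rfl

theorem leftIso_rightIso_comm (x y : unitary M) (ξ : τ.L2) :
    τ.leftIso x (τ.rightIso y ξ) = τ.rightIso y (τ.leftIso x ξ) :=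
  τ.leftMul_rightMul_comm _ _ _

theorem inner_leftIso_left (x : unitary M) (ξ η : τ.L2) :
    ⟪τ.leftIso x ξ, η⟫_ℂ = ⟪ξ, τ.leftIso x⁻¹ η⟫_ℂ := τ.inner_leftMul_left _ _ _

theorem inner_rightIso_left (x : unitary M) (ξ η : τ.L2) :
    ⟪τ.rightIso x ξ, η⟫_ℂ = ⟪ξ, τ.rightIso x⁻¹ η⟫_ℂ := τ.inner_rightMul_left _ _ _

end Unitary

namespace IsCrossedProduct

variable {Γ : Type v} [Group Γ] {u : Γ →* unitary M}

theorem star_coe (u : Γ →* unitary M) (g : Γ) : star (u g : M) = (u g⁻¹ : M) := by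
  rw [map_inv]; rfl

theorem coe_mul (u : Γ →* unitary M) (g h : Γ) : (u (g * h) : M) = (u g : M) * (u h : M) := by
  rw [map_mul]; rfl

theorem coe_mul_inv (u : Γ →* unitary M) (g : Γ) : (u g : M) * (u g⁻¹ : M) = 1 := by
  rw [← coe_mul, mul_inv_cancel, _root_.map_one]; rfl

theorem coe_inv_mul (u : Γ →* unitary M) (g : Γ) : (u g⁻¹ : M) * (u g : M) = 1 := by
  rw [← coe_mul, inv_mul_cancel, _root_.map_one]; rfl

variable (hA : τ.IsCrossedProduct A u)

/-- The action `a ↦ u_g a u_g*`. -/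
noncomputable def act (hA : τ.IsCrossedProduct A u) (g : Γ) (a : A) : A :=
  ⟨((u g : M) : H →L[ℂ] H) * a * star ((u g : M) : H →L[ℂ] H), hA.conj_mem g a a.2⟩

theorem inclusion_act (g : Γ) (a : A) :
    inclusion hA.le (hA.act g a) = (u g : M) * inclusion hA.le a * (u g⁻¹ : M) := by
  rw [← star_coe]; rfl

end IsCrossedProduct
end VonNeumannAlgebra.TracialState

namespace VonNeumannAlgebra.TracialState.IsCrossedProduct

variable {H : Type u} [NormedAddCommGroup H] [InnerProductSpace ℂ H] [CompleteSpace H]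
  {M A : VonNeumannAlgebra H} {τ : M.TracialState} {Γ : Type v} [Group Γ] {u : Γ →* unitary M}
  (hA : τ.IsCrossedProduct A u)

/-- The linear span of the elements `a u_g`. -/
noncomputable def algSpan (hA : τ.IsCrossedProduct A u) : Submodule ℂ M :=
  Submodule.span ℂ (Set.range fun p : A × Γ => inclusion hA.le p.1 * (u p.2 : M))

include hA

theorem mul_coe_mem_algSpan (a : A) (g : Γ) : inclusion hA.le a * (u g : M) ∈ hA.algSpan :=
  Submodule.subset_span ⟨(a, g), rfl⟩

theorem inclusion_mul_mul (a b : A) (g h : Γ) :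
    inclusion hA.le a * (u g : M) * (inclusion hA.le b * (u h : M)) =
      inclusion hA.le (a * hA.act g b) * (u (g * h) : M) := by
  rw [inclusion_mul, inclusion_act, coe_mul]
  calc _ = inclusion hA.le a * (u g : M) * inclusion hA.le b * 1 * (u h : M) := by
        rw [mul_one, mul_assoc, mul_assoc, mul_assoc]
    _ = _ := by rw [← coe_inv_mul u g]; simp only [mul_assoc]

theorem star_inclusion_mul (a : A) (g : Γ) :
    star (inclusion hA.le a * (u g : M)) =
      inclusion hA.le (hA.act g⁻¹ (star a)) * (u g⁻¹ : M) := by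
  rw [star_mul, inclusion_act, star_coe, inclusion_star, inv_inv, mul_assoc _ (u g : M),
    coe_mul_inv, mul_one]

theorem algSpan_mul_mem {x y : M} (hx : x ∈ hA.algSpan) (hy : y ∈ hA.algSpan) :
    x * y ∈ hA.algSpan := by
  induction hx using Submodule.span_induction with
  | zero => rw [zero_mul]; exact zero_mem _
  | add x x' _ _ h h' => rw [add_mul]; exact add_mem h h'
  | smul c x _ h => rw [smul_mul_assoc]; exact Submodule.smul_mem _ _ h
  | mem x hx =>
    obtain ⟨⟨a, g⟩, rfl⟩ := hx
    induction hy using Submodule.span_induction with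
    | zero => rw [mul_zero]; exact zero_mem _
    | add x x' _ _ h h' => rw [mul_add]; exact add_mem h h'
    | smul c x _ h => rw [mul_smul_comm]; exact Submodule.smul_mem _ _ h
    | mem y hy =>
      obtain ⟨⟨b, h⟩, rfl⟩ := hy
      exact (hA.inclusion_mul_mul a b g h) ▸ hA.mul_coe_mem_algSpan _ _

theorem algSpan_star_mem {x : M} (hx : x ∈ hA.algSpan) : star x ∈ hA.algSpan := by
  induction hx using Submodule.span_induction with
  | zero => rw [star_zero]; exact zero_mem _
  | add x x' _ _ h h' => rw [star_add]; exact add_mem h h'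
  | smul c x _ h => rw [star_smul]; exact Submodule.smul_mem _ _ h
  | mem x hx =>
    obtain ⟨⟨a, g⟩, rfl⟩ := hx
    exact (hA.star_inclusion_mul a g) ▸ hA.mul_coe_mem_algSpan _ _

theorem one_mem_algSpan : (1 : M) ∈ hA.algSpan := by
  have := hA.mul_coe_mem_algSpan 1 1
  rwa [inclusion_one, one_mul, _root_.map_one] at this

omit hA in
/-- The `*`-algebra generated by `A` and the unitaries `u_g`. -/
noncomputable def algStar (hA : τ.IsCrossedProduct A u) : StarSubalgebra ℂ (H →L[ℂ] H) where
  carrier := {y | ∃ m ∈ hA.algSpan, (m : H →L[ℂ] H) = y}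
  mul_mem' := by
    rintro _ _ ⟨x, hx, rfl⟩ ⟨y, hy, rfl⟩
    exact ⟨x * y, hA.algSpan_mul_mem hx hy, rfl⟩
  add_mem' := by
    rintro _ _ ⟨x, hx, rfl⟩ ⟨y, hy, rfl⟩
    exact ⟨x + y, add_mem hx hy, rfl⟩
  algebraMap_mem' r := ⟨r • 1, Submodule.smul_mem _ _ hA.one_mem_algSpan, by
    rw [Algebra.algebraMap_eq_smul_one]; rfl⟩
  star_mem' := by
    rintro _ ⟨x, hx, rfl⟩
    exact ⟨star x, hA.algSpan_star_mem hx, rfl⟩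

/-- The elements a u_g span a *-algebra containing the generators, so `toL2_mem_of_generates`
applies to it. Its norm closure is used because the resolvents must stay inside the algebra. -/
theorem dense_span (ξ : τ.L2) : ξ ∈ closure (Submodule.span ℂ
    (Set.range fun p : A × Γ => τ.toL2 (inclusion hA.le p.1 * (u p.2 : M))) : Set τ.L2) := by
  set S := Submodule.span ℂ
    (Set.range fun p : A × Γ => τ.toL2 (inclusion hA.le p.1 * (u p.2 : M)))
  set K := S.topologicalClosure
  have hKc : IsClosed (K : Set τ.L2) := Submodule.isClosed_topologicalClosure _
  have hN₀ : ∀ m ∈ hA.algSpan, τ.toL2 m ∈ K := by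
    intro m hm
    refine Submodule.le_topologicalClosure _ ?_
    have h1 : S = hA.algSpan.map τ.toL2 := by
      rw [algSpan, Submodule.map_span, ← Set.range_comp]; rfl
    rw [h1]
    exact Submodule.mem_map_of_mem hm
  have hle : (hA.algStar.topologicalClosure : Set (H →L[ℂ] H)) ⊆ M := by
    rw [StarSubalgebra.topologicalClosure_coe]
    refine closure_minimal ?_ M.isClosed
    rintro _ ⟨m, -, rfl⟩
    exact m.2
  have hmem : ∀ x : M, τ.toL2 x ∈ K := by
    refine τ.toL2_mem_of_generates hKc (N := hA.algStar.topologicalClosure)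
      (StarSubalgebra.isClosed_topologicalClosure _) hle ?_ ?_
    · intro y hy
      have h1 : (y : H →L[ℂ] H) ∈ closure ((fun m : M => (m : H →L[ℂ] H)) '' hA.algSpan) := hy
      have h2 : y ∈ closure (hA.algSpan : Set M) := by
        rw [Topology.IsInducing.subtypeVal.closure_eq_preimage_closure_image]
        exact h1
      have hc : Continuous τ.toL2 :=
        AddMonoidHomClass.continuous_of_bound τ.toL2 1 fun x => by
          rw [one_mul]; exact τ.norm_toL2_le x
      exact closure_minimal (t := {m | τ.toL2 m ∈ K}) hN₀ (hKc.preimage hc) h2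
    · intro y hy
      rw [← SetLike.mem_coe, ← hA.generates] at hy
      refine Set.centralizer_subset (Set.centralizer_subset ?_) hy
      refine Set.Subset.trans ?_ (StarSubalgebra.le_topologicalClosure _)
      rintro z (hz | ⟨g, rfl⟩)
      · exact ⟨inclusion hA.le ⟨z, hz⟩, by
          simpa using hA.mul_coe_mem_algSpan ⟨z, hz⟩ 1, rfl⟩
      · exact ⟨u g, by simpa using hA.mul_coe_mem_algSpan 1 g, rfl⟩
  have h3 : IsClosed {ζ | ζ ∈ K} := hKc
  exact τ.denseRange_toL2.induction_on (p := fun ζ => ζ ∈ K) ξ h3 hmem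

theorem adj_mem (g : Γ) {ξ : τ.L2} (hξ : ξ ∈ τ.L2Sub hA.le) :
    τ.leftIso (u g) (τ.rightIso (u g) ξ) ∈ τ.L2Sub hA.le := by
  refine τ.L2Sub_induction hA.le
    (p := fun ξ => τ.leftIso (u g) (τ.rightIso (u g) ξ) ∈ τ.L2Sub hA.le) ?_ (fun a => ?_) hξ
  · exact (Submodule.isClosed_topologicalClosure _).preimage
      ((τ.leftIso (u g)).continuous.comp (τ.rightIso (u g)).continuous)
  · rw [rightIso_toL2, leftIso_toL2, star_coe, ← mul_assoc, ← hA.inclusion_act]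
    exact τ.toL2_inclusion_mem hA.le _

theorem expect_adj (g : Γ) (ξ : τ.L2) :
    τ.expect hA.le (τ.leftIso (u g) (τ.rightIso (u g) ξ)) =
      τ.leftIso (u g) (τ.rightIso (u g) (τ.expect hA.le ξ)) := by
  refine expect_eq_of_inner_eq hA.le (hA.adj_mem g (τ.expect_mem _ _)) fun a => ?_
  have h1 : ∀ ζ : τ.L2, ⟪τ.toL2 (inclusion hA.le a), τ.leftIso (u g) (τ.rightIso (u g) ζ)⟫_ℂ =
      ⟪τ.toL2 (inclusion hA.le (hA.act g⁻¹ a)), ζ⟫_ℂ := by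
    intro ζ
    have h2 := inner_leftIso_left (τ := τ) (u g)⁻¹ (τ.toL2 (inclusion hA.le a))
      (τ.rightIso (u g) ζ)
    have h3 := inner_rightIso_left (τ := τ) (u g)⁻¹
      (τ.leftIso (u g)⁻¹ (τ.toL2 (inclusion hA.le a))) ζ
    rw [inv_inv] at h2 h3
    rw [← h2, ← h3, ← map_inv, leftIso_toL2, rightIso_toL2, star_coe, ← inclusion_act]
  rw [h1, h1, inner_toL2_expect]

theorem expect_leftIso_of_ne {g : Γ} (hg : g ≠ 1) {ξ : τ.L2} (hξ : ξ ∈ τ.L2Sub hA.le) :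
    τ.expect hA.le (τ.leftIso (u g) ξ) = 0 := by
  refine τ.L2Sub_induction hA.le
    (p := fun ξ => τ.expect hA.le (τ.leftIso (u g) ξ) = 0)
    (isClosed_eq (by fun_prop) (by fun_prop)) (fun b => ?_) hξ
  refine expect_eq_of_inner_eq hA.le (Submodule.zero_mem _) fun a => ?_
  rw [leftIso_toL2, inner_toL2, inner_zero_right, ← inclusion_star]
  have h1 := hA.trace_eq_zero g (b * star a) hg
  rw [← h1, inclusion_mul, ← mul_assoc]
  refine (τ.trace_comm _ _).trans (congrArg τ.toFunctional ?_)
  rw [mul_assoc]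

theorem expect_mul_coe_of_ne {g : Γ} (hg : g ≠ 1) (a : A) :
    τ.expect hA.le (τ.toL2 (inclusion hA.le a * (u g : M))) = 0 := by
  refine expect_eq_of_inner_eq hA.le (Submodule.zero_mem _) fun b => ?_
  rw [inner_toL2, inner_zero_right, ← inclusion_star, ← mul_assoc, ← inclusion_mul]
  exact hA.trace_eq_zero g (star b * a) hg

omit hA in
/-- The orthogonal projection of `L²(M)` onto `u_g L²(A)`. -/
noncomputable def proj (hA : τ.IsCrossedProduct A u) (g : Γ) : τ.L2 →L[ℂ] τ.L2 :=
  (τ.leftIso (u g)).toContinuousLinearMap ∘L τ.expect hA.le ∘L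
    (τ.leftIso (u g⁻¹)).toContinuousLinearMap

theorem proj_apply (g : Γ) (ξ : τ.L2) :
    hA.proj g ξ = τ.leftIso (u g) (τ.expect hA.le (τ.leftIso (u g⁻¹) ξ)) := rfl

omit hA in
theorem leftIso_inv_cancel (u : Γ →* unitary M) (g : Γ) (ξ : τ.L2) :
    τ.leftIso (u g⁻¹) (τ.leftIso (u g) ξ) = ξ := by
  rw [← leftIso_mul, ← map_mul, inv_mul_cancel, _root_.map_one, leftIso_one]

omit hA in
theorem leftIso_cancel_inv (u : Γ →* unitary M) (g : Γ) (ξ : τ.L2) :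
    τ.leftIso (u g) (τ.leftIso (u g⁻¹) ξ) = ξ := by
  rw [← leftIso_mul, ← map_mul, mul_inv_cancel, _root_.map_one, leftIso_one]

theorem leftIso_proj (g h : Γ) (ξ : τ.L2) :
    τ.leftIso (u g) (hA.proj h ξ) = hA.proj (g * h) (τ.leftIso (u g) ξ) := by
  rw [proj_apply, proj_apply, ← leftIso_mul, ← map_mul, ← leftIso_mul, ← map_mul, mul_inv_rev,
    inv_mul_cancel_right]

/-- The unitary u_g normalizes A, so u_g L²(A) = L²(A) u_g. The right-handed form is the one in the
Fourier coefficient E_A(x u_g*). -/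
theorem proj_eq_right (g : Γ) (ξ : τ.L2) :
    hA.proj g ξ = τ.rightIso (u g⁻¹) (τ.expect hA.le (τ.rightIso (u g) ξ)) := by
  have h1 : τ.rightIso (u g) ξ =
      τ.leftIso (u g) (τ.rightIso (u g) (τ.leftIso (u g⁻¹) ξ)) := by
    rw [leftIso_rightIso_comm, leftIso_cancel_inv]
  rw [h1, hA.expect_adj, proj_apply, ← leftIso_rightIso_comm, ← rightIso_mul, ← map_mul,
    inv_mul_cancel, _root_.map_one, rightIso_one]

theorem rightIso_proj (g h : Γ) (ξ : τ.L2) :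
    τ.rightIso (u g) (hA.proj h ξ) = hA.proj (h * g⁻¹) (τ.rightIso (u g) ξ) := by
  rw [proj_eq_right, proj_eq_right, ← rightIso_mul, ← map_mul, ← rightIso_mul, ← map_mul,
    inv_mul_cancel_right, mul_inv_rev, inv_inv]

theorem norm_fourierCoeff (x : M) (g : Γ) :
    ‖τ.fourierCoeff hA.le u x g‖ = ‖hA.proj g (τ.toL2 x)‖ := by
  rw [fourierCoeff_eq, proj_eq_right, LinearIsometry.norm_map, rightIso_toL2]

/-- Left and right translations by the u_g permute the blocks isometrically. This is the bridge
between the kernels ‖E_A(u_s* x u_t)‖² supplied by amenability and Fourier coefficients. -/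
theorem norm_expect_star_mul_mul (x : M) (s t : Γ) :
    ‖τ.expect hA.le (τ.toL2 ((u s⁻¹ : M) * x * (u t : M)))‖ = ‖hA.proj (s * t⁻¹) (τ.toL2 x)‖ := by
  have h1 : τ.toL2 ((u s⁻¹ : M) * x * (u t : M)) =
      τ.leftIso (u s⁻¹) (τ.rightIso (u t⁻¹) (τ.toL2 x)) := by
    rw [rightIso_toL2, leftIso_toL2, star_coe, inv_inv, mul_assoc]
  have h2 : ∀ ξ : τ.L2, ‖τ.expect hA.le (τ.leftIso (u s⁻¹) ξ)‖ = ‖hA.proj s ξ‖ := by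
    intro ξ; rw [proj_apply, LinearIsometry.norm_map]
  have h3 := hA.rightIso_proj t⁻¹ (s * t⁻¹) (τ.toL2 x)
  rw [inv_inv, inv_mul_cancel_right] at h3
  rw [h1, h2, ← h3, LinearIsometry.norm_map]

theorem proj_toL2 (a : A) (g h : Γ) [Decidable (h = g)] :
    hA.proj g (τ.toL2 (inclusion hA.le a * (u h : M))) =
      if h = g then τ.toL2 (inclusion hA.le a * (u h : M)) else 0 := by
  have h1 : τ.rightIso (u g) (τ.toL2 (inclusion hA.le a * (u h : M))) =
      τ.toL2 (inclusion hA.le a * (u (h * g⁻¹) : M)) := by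
    rw [rightIso_toL2, star_coe, mul_assoc, ← coe_mul]
  rw [proj_eq_right, h1]
  split_ifs with hgh
  · subst hgh
    rw [mul_inv_cancel, _root_.map_one, OneMemClass.coe_one, mul_one,
      τ.expect_eq_self hA.le (τ.toL2_inclusion_mem hA.le a), rightIso_toL2, star_coe, inv_inv]
  · rw [hA.expect_mul_coe_of_ne (fun hh => hgh (mul_inv_eq_one.mp hh)), map_zero]

theorem isOrthPartition_proj : IsOrthPartition hA.proj := by
  classical
  refine IsOrthPartition.of_dense ?_ ?_ ?_ hA.dense_span ?_
  · intro g ξ η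
    rw [proj_apply, proj_apply, inner_leftIso_left, inner_expect_left, ← map_inv]
    have := inner_leftIso_left (τ := τ) (u g⁻¹) ξ
      (τ.expect hA.le (τ.leftIso (u g⁻¹) η))
    rw [this, ← map_inv, inv_inv]
  · intro g ξ
    rw [proj_apply, proj_apply, leftIso_inv_cancel, expect_idem]
  · intro g h ξ hgh
    rw [proj_apply, proj_apply, ← leftIso_mul, ← map_mul,
      hA.expect_leftIso_of_ne (fun hh => hgh (inv_mul_eq_one.mp hh)) (τ.expect_mem _ _), map_zero]
  · rintro _ ⟨⟨a, g⟩, rfl⟩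
    have h1 : ∀ t, hA.proj t (τ.toL2 (inclusion hA.le a * (u g : M))) =
      if t = g then τ.toL2 (inclusion hA.le a * (u g : M)) else 0 := by
      intro t; rw [hA.proj_toL2]; simp only [eq_comm]
    simp only [h1]
    exact hasSum_ite_eq g _

end VonNeumannAlgebra.TracialState.IsCrossedProduct

/-! ### Complete positivity, positive definite functions and their representations. -/

section CompletelyPositive

variable {A₁ A₂ : Type*} [CStarAlgebra A₁] [CStarAlgebra A₂] [PartialOrder A₁] [PartialOrder A₂]
  [StarOrderedRing A₁] [StarOrderedRing A₂]

theorem CompletelyPositiveMap.sum_nonneg {n : Type*} [Fintype n] (φ : A₁ →CP A₂) (x : n → A₁)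
    (y : n → A₂) : 0 ≤ ∑ i, ∑ j, star (y i) * φ (star (x i) * x j) * y j := by
  classical
  rcases isEmpty_or_nonempty n with hn | ⟨⟨k₀⟩⟩
  · simp
  -- A square matrix whose only nonzero row is (x_j), so that X*X has entries x_i* x_j.
  let X : CStarMatrix n n A₁ := CStarMatrix.ofMatrix fun k j => if k = k₀ then x j else 0
  have hX : ∀ i j, (star X * X) i j = star (x i) * x j := by
    intro i j
    have hX' : ∀ k j, X k j = if k = k₀ then x j else 0 := fun _ _ => rfl
    rw [CStarMatrix.mul_apply, Finset.sum_eq_single k₀]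
    · rw [CStarMatrix.star_apply, hX', hX', if_pos rfl, if_pos rfl]
    · intro k _ hk
      rw [hX', if_neg hk, mul_zero]
    · simp
  have h1 := φ.map_cstarMatrix_nonneg (star X * X) (star_mul_self_nonneg X)
  have h2 : ∀ P : CStarMatrix n n A₂, 0 ≤ P → 0 ≤ ∑ i, ∑ j, star (y i) * P i j * y j := by
    intro P hP
    rw [StarOrderedRing.nonneg_iff] at hP
    induction hP using AddSubmonoid.closure_induction with
    | zero => simp
    | add P P' _ _ h h' =>
      simpa only [CStarMatrix.add_apply, mul_add, add_mul, Finset.sum_add_distrib] using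
        add_nonneg h h'
    | mem P hP =>
      obtain ⟨Q, rfl⟩ := hP
      have h3 : ∑ i, ∑ j, star (y i) * (star Q * Q) i j * y j =
          ∑ k, star (∑ i, Q k i * y i) * ∑ j, Q k j * y j := by
        simp only [CStarMatrix.mul_apply, CStarMatrix.star_apply, star_sum, star_mul,
          Finset.sum_mul, Finset.mul_sum]
        rw [Finset.sum_congr rfl fun i _ => Finset.sum_comm, Finset.sum_comm]
        rw [Finset.sum_congr rfl fun k _ => Finset.sum_comm]
        refine Finset.sum_congr rfl fun k _ => Finset.sum_congr rfl fun i _ =>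
          Finset.sum_congr rfl fun j _ => ?_
        simp only [mul_assoc]
      rw [h3]
      exact Finset.sum_nonneg fun k _ => star_mul_self_nonneg _
  simpa only [CStarMatrix.map_apply, hX] using h2 _ h1

end CompletelyPositive

/-- A function on a group is positive definite. -/
def IsPosDefFun {G : Type*} [Group G] (f : G → ℂ) : Prop :=
  (Matrix.of fun g h : G => f (g⁻¹ * h)).PosSemidef

theorem posSemidef_of_inner {X E : Type*} [SeminormedAddCommGroup E] [InnerProductSpace ℂ E]
    (e : X → E) {k : Matrix X X ℂ} (h : ∀ x y, k x y = ⟪e x, e y⟫_ℂ) : k.PosSemidef := by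
  refine ⟨?_, fun c => ?_⟩
  · ext x y
    rw [Matrix.conjTranspose_apply, h, h]
    exact inner_conj_symm _ _
  · have h1 : (c.sum fun i ci => c.sum fun j cj => star ci * k i j * cj) =
        ⟪c.sum fun i ci => ci • e i, c.sum fun i ci => ci • e i⟫_ℂ := by
      simp only [Finsupp.sum, sum_inner, inner_sum, inner_smul_left, inner_smul_right, h,
        Finset.mul_sum]
      rw [Finset.sum_comm]
      refine Finset.sum_congr rfl fun i _ => Finset.sum_congr rfl fun j _ => ?_
      simp only [RCLike.star_def]; ring
    rw [h1, inner_self_eq_norm_sq_to_K]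
    simp

section KernelSpace

/-- The space of finitely supported functions, with the inner product defined by a positive
semidefinite kernel. -/
def KernelSpace {X : Type v} {k : Matrix X X ℂ} (_hk : k.PosSemidef) : Type v := X →₀ ℂ

variable {X : Type v} {k : Matrix X X ℂ} (hk : k.PosSemidef)

noncomputable instance : AddCommGroup (KernelSpace hk) := inferInstanceAs (AddCommGroup (X →₀ ℂ))
noncomputable instance : Module ℂ (KernelSpace hk) := inferInstanceAs (Module ℂ (X →₀ ℂ))

noncomputable abbrev kernelCore : PreInnerProductSpace.Core ℂ (KernelSpace hk) where
  inner a b := Finsupp.sum (show X →₀ ℂ from a) fun i ai =>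
    Finsupp.sum (show X →₀ ℂ from b) fun j bj => star ai * k i j * bj
  conj_inner_symm a b := by
    simp only [Finsupp.sum, map_sum, map_mul]
    rw [Finset.sum_comm]
    refine Finset.sum_congr rfl fun i _ => Finset.sum_congr rfl fun j _ => ?_
    have h1 : starRingEnd ℂ (k j i) = k i j := hk.1.apply i j
    rw [h1]
    simp only [RCLike.star_def, RCLike.conj_conj]; ring
  re_inner_nonneg a := (RCLike.nonneg_iff.mp (hk.2 a)).1
  add_left a b c := by
    refine Finsupp.sum_add_index' (h := fun i ai =>
      Finsupp.sum (show X →₀ ℂ from c) fun j bj => star ai * k i j * bj) (fun i => by simp [Finsupp.sum])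
      (fun i x y => ?_)
    rw [← Finsupp.sum_add]
    exact Finsupp.sum_congr fun j _ => by rw [star_add]; ring
  smul_left a b r := by
    refine (Finsupp.sum_smul_index (h := fun i ai =>
      Finsupp.sum (show X →₀ ℂ from b) fun j bj => star ai * k i j * bj) (fun i => by simp [Finsupp.sum])).trans ?_
    simp only [Finsupp.sum, Finset.mul_sum]
    refine Finset.sum_congr rfl fun i _ => Finset.sum_congr rfl fun j _ => ?_
    simp only [RCLike.star_def, map_mul]; ring

noncomputable instance : SeminormedAddCommGroup (KernelSpace hk) :=
  InnerProductSpace.Core.toSeminormedAddCommGroup (c := kernelCore hk)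
noncomputable instance : InnerProductSpace ℂ (KernelSpace hk) :=
  InnerProductSpace.ofCore (kernelCore hk)

/-- The vector of the kernel space attached to a point. -/
noncomputable def kernelVec (x : X) : KernelSpace hk := Finsupp.single x 1

theorem inner_kernelVec (x y : X) : ⟪kernelVec hk x, kernelVec hk y⟫_ℂ = k x y := by
  change (Finsupp.sum (Finsupp.single x (1 : ℂ)) fun i ai =>
    Finsupp.sum (Finsupp.single y (1 : ℂ)) fun j bj => star ai * k i j * bj) = k x y
  rw [Finsupp.sum_single_index (by simp), Finsupp.sum_single_index (by simp)]
  simp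

theorem kernelSpace_induction {p : KernelSpace hk → Prop} (h0 : p 0)
    (hadd : ∀ a b, p a → p b → p (a + b)) (hs : ∀ (c : ℂ) x, p (c • kernelVec hk x))
    (a : KernelSpace hk) : p a := by
  refine Finsupp.induction_linear (motive := fun a : X →₀ ℂ => p a) a h0 hadd fun x c => ?_
  have : (Finsupp.single x c : X →₀ ℂ) = c • (Finsupp.single x 1 : X →₀ ℂ) := by simp
  rw [this]
  exact hs c x

/-- The linear map of kernel spaces induced by a map of the points. -/
noncomputable def kernelMap (σ : X → X) : KernelSpace hk →ₗ[ℂ] KernelSpace hk :=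
  Finsupp.lmapDomain ℂ ℂ σ

theorem kernelMap_vec (σ : X → X) (x : X) :
    kernelMap hk σ (kernelVec hk x) = kernelVec hk (σ x) := Finsupp.mapDomain_single

theorem inner_kernelMap {σ : X → X} (hσ : ∀ x y, k (σ x) (σ y) = k x y) (a b : KernelSpace hk) :
    ⟪kernelMap hk σ a, kernelMap hk σ b⟫_ℂ = ⟪a, b⟫_ℂ := by
  refine kernelSpace_induction hk
    (p := fun a => ⟪kernelMap hk σ a, kernelMap hk σ b⟫_ℂ = ⟪a, b⟫_ℂ) ?_ ?_ ?_ a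
  · simp
  · intro a a' h h'; simp only [map_add, inner_add_left, h, h']
  · intro c x
    refine kernelSpace_induction hk (p := fun b =>
      ⟪kernelMap hk σ (c • kernelVec hk x), kernelMap hk σ b⟫_ℂ = ⟪c • kernelVec hk x, b⟫_ℂ)
      ?_ ?_ ?_ b
    · simp
    · intro a a' h h'; simp only [map_add, inner_add_right, h, h']
    · intro d y
      simp only [map_smul, inner_smul_left, inner_smul_right, kernelMap_vec, inner_kernelVec, hσ]

include hk in
/-- The unitary representation attached to an invariant positive semidefinite kernel. -/
theorem exists_unitary_rep {Γ : Type*} [Group Γ] [MulAction Γ X]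
    (hinv : ∀ (g : Γ) x y, k (g • x) (g • y) = k x y) :
    ∃ (K : Type v) (_ : NormedAddCommGroup K) (_ : InnerProductSpace ℂ K) (_ : CompleteSpace K)
      (π : Γ →* unitary (K →L[ℂ] K)) (e : X → K), (∀ x y, ⟪e x, e y⟫_ℂ = k x y) ∧
      (∀ g x, (π g : K →L[ℂ] K) (e x) = e (g • x)) ∧
      ∀ ξ : K, ξ ∈ closure (Submodule.span ℂ (Set.range e) : Set K) := by
  let K := UniformSpace.Completion (KernelSpace hk)
  let U₀ : Γ → KernelSpace hk →L[ℂ] KernelSpace hk := fun g =>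
    (kernelMap hk (g • ·)).mkContinuous 1 fun a => by
      rw [one_mul, @norm_eq_sqrt_re_inner ℂ, inner_kernelMap hk (hinv g),
        ← @norm_eq_sqrt_re_inner ℂ]
  let U : Γ → K →L[ℂ] K := fun g => (U₀ g).completion
  let e : X → K := fun x => (kernelVec hk x : K)
  have hUe : ∀ g x, U g (e x) = e (g • x) := by
    intro g x
    rw [ContinuousLinearMap.completion_apply_coe]
    exact congrArg _ (kernelMap_vec hk _ _)
  have hie : ∀ x y, ⟪e x, e y⟫_ℂ = k x y := by
    intro x y
    rw [UniformSpace.Completion.inner_coe, inner_kernelVec]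
  have hd : ∀ ξ : K, ξ ∈ closure (Submodule.span ℂ (Set.range e) : Set K) := by
    intro ξ
    have h1 : Set.range ((↑) : KernelSpace hk → K) ⊆ Submodule.span ℂ (Set.range e) := by
      rintro _ ⟨a, rfl⟩
      refine kernelSpace_induction hk
        (p := fun a => (a : K) ∈ (Submodule.span ℂ (Set.range e) : Set K)) ?_ ?_ ?_ a
      · rw [UniformSpace.Completion.coe_zero]; exact zero_mem _
      · intro a b ha hb
        rw [UniformSpace.Completion.coe_add]; exact add_mem ha hb
      · intro c x
        rw [UniformSpace.Completion.coe_smul]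
        exact Submodule.smul_mem _ _ (Submodule.subset_span ⟨x, rfl⟩)
    exact closure_mono h1 (UniformSpace.Completion.denseRange_coe ξ)
  have hmul : ∀ g h, U (g * h) = U g * U h := by
    intro g h
    refine ContinuousLinearMap.ext_on (s := Set.range e) (fun ξ => hd ξ) ?_
    rintro _ ⟨x, rfl⟩
    rw [mul_apply_eq_comp, hUe, hUe, hUe, mul_smul]
  have hone : U 1 = 1 := by
    refine ContinuousLinearMap.ext_on (s := Set.range e) (fun ξ => hd ξ) ?_
    rintro _ ⟨x, rfl⟩
    rw [hUe, one_smul]; rfl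
  have hiso : ∀ g, star (U g) * U g = 1 := by
    intro g
    refine ContinuousLinearMap.ext fun ξ => ext_inner_left ℂ fun η => ?_
    rw [mul_apply_eq_comp, ContinuousLinearMap.star_eq_adjoint,
      ContinuousLinearMap.adjoint_inner_right, one_apply_eq_self]
    induction ξ, η using UniformSpace.Completion.induction_on₂ with
    | hp => apply isClosed_eq <;> fun_prop
    | ih a b =>
      rw [ContinuousLinearMap.completion_apply_coe, ContinuousLinearMap.completion_apply_coe,
        UniformSpace.Completion.inner_coe, UniformSpace.Completion.inner_coe]
      exact inner_kernelMap hk (hinv g) b a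
  have hinvU : ∀ g, U g * U g⁻¹ = 1 := fun g => by rw [← hmul, mul_inv_cancel, hone]
  have hstar : ∀ g, star (U g) = U g⁻¹ := fun g =>
    left_inv_eq_right_inv (hiso g) (hinvU g)
  refine ⟨K, inferInstance, inferInstance, inferInstance,
    { toFun := fun g => ⟨U g, Unitary.mem_iff.mpr ⟨hiso g, by rw [hstar, hinvU]⟩⟩
      map_one' := Subtype.ext hone
      map_mul' := fun g h => Subtype.ext (hmul g h) }, e, hie, hUe, hd⟩

end KernelSpace

theorem posSemidef_of_tendsto {X ι : Type*} {l : Filter ι} [l.NeBot] {k : ι → Matrix X X ℂ}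
    {k' : Matrix X X ℂ} (hk : ∀ i, (k i).PosSemidef)
    (h : ∀ x y, Tendsto (fun i => k i x y) l (𝓝 (k' x y))) : k'.PosSemidef := by
  refine ⟨?_, fun c => ?_⟩
  · ext x y
    rw [Matrix.conjTranspose_apply]
    refine tendsto_nhds_unique ((h y x).star) ((h x y).congr fun i => ?_)
    exact ((hk i).1.apply x y).symm
  · refine ge_of_tendsto' (f := fun i => c.sum fun x cx => c.sum fun y cy => star cx * k i x y * cy)
      (x := l) ?_ fun i => (hk i).2 c
    exact tendsto_finsetSum _ fun x _ => tendsto_finsetSum _ fun y _ =>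
      ((h x y).const_mul _).mul_const _

namespace IsPosDefFun

variable {G : Type v} [Group G] {f f' : G → ℂ}

theorem mul (hf : IsPosDefFun f) (hf' : IsPosDefFun f') : IsPosDefFun fun g => f g * f' g :=
  Matrix.PosSemidef.hadamard hf hf'

theorem add (hf : IsPosDefFun f) (hf' : IsPosDefFun f') : IsPosDefFun fun g => f g + f' g :=
  Matrix.PosSemidef.add hf hf'

theorem const {c : ℝ} (hc : 0 ≤ c) : IsPosDefFun fun _ : G => (c : ℂ) :=
  posSemidef_of_inner (fun _ : G => ((√c : ℝ) : ℂ)) fun x y => by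
    simp [← Complex.ofReal_pow, sq_abs, Real.sq_sqrt hc]

theorem conj (hf : IsPosDefFun f) : IsPosDefFun fun g => star (f g) := by
  have h : (Matrix.of fun g h : G => star (f (g⁻¹ * h))) = (Matrix.of fun g h : G =>
      f (g⁻¹ * h)).transpose := by
    ext g h
    exact hf.1.apply h g
  rw [IsPosDefFun, h]
  exact Matrix.PosSemidef.transpose hf

theorem sum {ι : Type*} (s : Finset ι) {F : ι → G → ℂ} (hF : ∀ i, IsPosDefFun (F i)) :
    IsPosDefFun fun g => ∑ i ∈ s, F i g := by
  classical
  induction s using Finset.induction_on with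
  | empty => simpa using const (G := G) le_rfl
  | insert i s hi ih => simpa only [Finset.sum_insert hi] using (hF i).add ih

theorem prod {ι : Type*} (s : Finset ι) {F : ι → G → ℂ} (hF : ∀ i, IsPosDefFun (F i)) :
    IsPosDefFun fun g => ∏ i ∈ s, F i g := by
  classical
  induction s using Finset.induction_on with
  | empty => simpa using const (G := G) zero_le_one
  | insert i s hi ih => simpa only [Finset.prod_insert hi] using (hF i).mul ih

theorem of_tendsto {ι : Type*} {l : Filter ι} [l.NeBot] {F : ι → G → ℂ}
    (hF : ∀ i, IsPosDefFun (F i)) (h : ∀ g, Tendsto (fun i => F i g) l (𝓝 (f g))) :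
    IsPosDefFun f :=
  posSemidef_of_tendsto hF fun _ _ => h _

theorem exp (hf : IsPosDefFun f) : IsPosDefFun fun g => Complex.exp (f g) := by
  refine of_tendsto (l := atTop) (F := fun (n : ℕ) g => ∑ j ∈ Finset.range n,
    (((j.factorial : ℝ)⁻¹ : ℝ) : ℂ) * ∏ _i ∈ Finset.range j, f g) (fun n => ?_) fun g => ?_
  · exact sum _ fun j => (const (by positivity)).mul (prod _ fun _ => hf)
  · have h1 := (NormedSpace.expSeries_div_hasSum_exp (f g)).tendsto_sum_nat
    rw [← Complex.exp_eq_exp_ℂ] at h1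
    refine h1.congr fun n => Finset.sum_congr rfl fun j _ => ?_
    rw [Finset.prod_const, Finset.card_range]
    push_cast
    rw [div_eq_inv_mul]

/-- Here exp(−c(1 − Re f)) = e^{−c} exp((c/2)(f + f̄)), and the exponential series preserves
positive definiteness by the Schur product theorem. -/
theorem exp_re (hf : IsPosDefFun f) {c : ℝ} (hc : 0 ≤ c) :
    IsPosDefFun fun g => (Real.exp (-(c * (1 - (f g).re))) : ℂ) := by
  have h1 := (const (G := G) (Real.exp_nonneg (-c))).mul
    (((const (G := G) (show 0 ≤ c / 2 by positivity)).mul (hf.add hf.conj)).exp)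
  convert h1 using 2 with g
  rw [show f g + star (f g) = ((2 * (f g).re : ℝ) : ℂ) from Complex.add_conj _,
    ← Complex.ofReal_mul, ← Complex.ofReal_exp, ← Complex.ofReal_mul, ← Real.exp_add]
  congr 2
  ring

theorem exists_vec (hf : IsPosDefFun f) :
    ∃ (K : Type v) (_ : NormedAddCommGroup K) (_ : InnerProductSpace ℂ K) (_ : CompleteSpace K)
      (π : G →* unitary (K →L[ℂ] K)) (e : G → K), (∀ x y, ⟪e x, e y⟫_ℂ = f (x⁻¹ * y)) ∧
      (∀ g x, (π g : K →L[ℂ] K) (e x) = e (g * x)) ∧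
      ∀ ξ : K, ξ ∈ closure (Submodule.span ℂ (Set.range e) : Set K) :=
  exists_unitary_rep (Γ := G) hf fun g x y => by
    simp [smul_eq_mul, mul_assoc]

theorem norm_le_one (hf : IsPosDefFun f) (h1 : f 1 = 1) (g : G) : ‖f g‖ ≤ 1 := by
  obtain ⟨K, _, _, _, π, e, he, -, -⟩ := hf.exists_vec
  have hn : ∀ x, ‖e x‖ = 1 := by
    intro x
    rw [@norm_eq_sqrt_re_inner ℂ, he, inv_mul_cancel, h1]
    simp
  have := norm_inner_le_norm (𝕜 := ℂ) (e 1) (e g)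
  rw [he, hn, hn] at this
  simpa using this

/-- In the representation of f, 2(1 − Re f(x⁻¹y)) = ‖e_x − e_y‖², and the bound is the triangle
inequality squared, with (a + b)² ≤ 2a² + 2b². -/
theorem one_sub_re_mul_le (hf : IsPosDefFun f) (h1 : f 1 = 1) (g h : G) :
    1 - (f (g * h)).re ≤ 2 * (1 - (f g).re) + 2 * (1 - (f h).re) := by
  obtain ⟨K, _, _, _, π, e, he, -, -⟩ := hf.exists_vec
  have hn : ∀ x y, ‖e x - e y‖ ^ 2 = 2 * (1 - (f (x⁻¹ * y)).re) := by
    intro x y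
    have hx : ∀ x, ‖e x‖ ^ 2 = 1 := by
      intro x
      rw [← inner_self_eq_norm_sq (𝕜 := ℂ), he, inv_mul_cancel, h1]
      simp
    rw [@norm_sub_sq ℂ, hx, hx, he]
    simp only [RCLike.re_to_complex]
    ring
  have h2 := hn 1 (g * h)
  have h3 := hn 1 g
  have h4 := hn g (g * h)
  have h5 : ‖e 1 - e (g * h)‖ ≤ ‖e 1 - e g‖ + ‖e g - e (g * h)‖ := norm_sub_le_norm_sub_add_norm_sub _ _ _
  rw [inv_one, one_mul] at h2 h3
  rw [inv_mul_cancel_left] at h4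
  nlinarith [sq_nonneg (‖e 1 - e g‖ - ‖e g - e (g * h)‖), norm_nonneg (e 1 - e (g * h)),
    norm_nonneg (e 1 - e g), norm_nonneg (e g - e (g * h))]

theorem re_inv (hf : IsPosDefFun f) (g : G) : (f g⁻¹).re = (f g).re := by
  have h1 := hf.1.apply g 1
  simp only [Matrix.of_apply, inv_one, one_mul, mul_one] at h1
  rw [← h1]; simp

/-- This is the Gram matrix of the ℓ²-direct sum of the spaces of the F m. It allows a whole
sequence of positive definite functions to be realized in one representation. -/
theorem block (F : ℕ → G → ℂ) (hF : ∀ m, IsPosDefFun (F m)) :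
    (Matrix.of fun x y : ℕ × G => if x.1 = y.1 then F x.1 (x.2⁻¹ * y.2) else 0).PosSemidef := by
  choose K i1 i2 i3 π e he _ _ using fun m => (hF m).exists_vec
  refine posSemidef_of_inner (E := lp K 2) (fun x => lp.single 2 x.1 (e x.1 x.2)) ?_
  rintro ⟨m, g⟩ ⟨n, h⟩
  rw [lp.inner_single_left]
  by_cases hmn : m = n
  · subst hmn
    simp [he]
  · simp [hmn]

end IsPosDefFun

/-! ### Relative property (T) gives uniform convergence on the subgroup. -/

/-- The function q plays the role of a conditionally negative definite function. The direct sum of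
the representations of exp(−q/(m+1)) has almost invariant vectors, since these functions tend to 1.
As q blows up along all two-sided translates of the h_k⁻¹, the operators π(h_k⁻¹) tend weakly to 0,
which excludes a nonzero Γ₀-invariant vector. -/
theorem HasRelativePropertyT.false_of_tendsto_atTop {Γ : Type v} [Group Γ] {q : Γ → ℝ} (hq0 : q 1 = 0)
    (hpd : ∀ s : ℝ, 0 ≤ s → IsPosDefFun fun g => (Real.exp (-(s * q g)) : ℂ))
    {Γ₀ : Subgroup Γ} (hT : HasRelativePropertyT Γ₀) (h : ℕ → Γ) (hh : ∀ k, h k ∈ Γ₀)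
    (hinf : ∀ g g', Tendsto (fun k => q (g * (h k)⁻¹ * g')) atTop atTop) : False := by
  let k : Matrix (ℕ × Γ) (ℕ × Γ) ℂ := Matrix.of fun x y =>
    if x.1 = y.1 then (Real.exp (-(1 / ((x.1 : ℝ) + 1) * q (x.2⁻¹ * y.2))) : ℂ) else 0
  have hk : k.PosSemidef := IsPosDefFun.block
    (fun m g => (Real.exp (-(1 / ((m : ℝ) + 1) * q g)) : ℂ)) fun m => hpd _ (by positivity)
  let _ : MulAction Γ (ℕ × Γ) :=
    { smul := fun g x => (x.1, g * x.2)
      one_smul := fun x => Prod.ext rfl (one_mul _)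
      mul_smul := fun g h x => Prod.ext rfl (mul_assoc _ _ _) }
  have hsm : ∀ (g : Γ) (x : ℕ × Γ), g • x = (x.1, g * x.2) := fun _ _ => rfl
  obtain ⟨K, _, _, _, π, e, he, hπ, hd⟩ := exists_unitary_rep hk (Γ := Γ) fun g x y => by
    simp [k, hsm, mul_assoc]
  have hiso : ∀ g ξ η, ⟪(π g : K →L[ℂ] K) ξ, η⟫_ℂ = ⟪ξ, (π g⁻¹ : K →L[ℂ] K) η⟫_ℂ := by
    intro g ξ η
    rw [map_inv, ← Unitary.star_eq_inv, Unitary.coe_star, ContinuousLinearMap.star_eq_adjoint,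
      ContinuousLinearMap.adjoint_inner_right]
  have hnorm : ∀ x, ‖e x‖ = 1 := by
    intro x
    rw [@norm_eq_sqrt_re_inner ℂ, he]
    simp [k, hq0]
  have hai : HasAlmostInvariantVectors π := by
    intro F ε hε
    have h1 : ∀ g ∈ F, ∀ᶠ m : ℕ in atTop, ‖(π g : K →L[ℂ] K) (e (m, 1)) - e (m, 1)‖ < ε := by
      intro g _
      have h2 : Tendsto (fun m : ℕ => 2 - 2 * Real.exp (-(1 / ((m : ℝ) + 1) * q g⁻¹))) atTop
          (𝓝 0) := by
        have h3 := (tendsto_one_div_add_atTop_nhds_zero_nat (𝕜 := ℝ)).mul_const (q g⁻¹)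
        rw [zero_mul] at h3
        have h4 := ((Real.continuous_exp.tendsto _).comp h3.neg).const_mul 2 |>.const_sub 2
        simpa using h4
      filter_upwards [h2.eventually_lt_const (show 0 < ε ^ 2 by positivity)] with m hm
      have h5 : ‖(π g : K →L[ℂ] K) (e (m, 1)) - e (m, 1)‖ ^ 2 =
          2 - 2 * Real.exp (-(1 / ((m : ℝ) + 1) * q g⁻¹)) := by
        rw [hπ, hsm, @norm_sub_sq ℂ, hnorm, hnorm, he]
        simp only [k, Matrix.of_apply, if_true, mul_one, RCLike.re_to_complex,
          Complex.ofReal_re]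
        ring
      rw [← h5] at hm
      exact lt_of_pow_lt_pow_left₀ 2 hε.le hm
    obtain ⟨m, hm⟩ := ((Filter.eventually_all_finset F).mpr h1).exists
    exact ⟨e (m, 1), hnorm _, hm⟩
  obtain ⟨ξ, hξ0, hξ⟩ := hT K π hai
  have hmix : ∀ x y, Tendsto (fun n => ⟪e y, (π (h n)⁻¹ : K →L[ℂ] K) (e x)⟫_ℂ) atTop (𝓝 0) := by
    intro x y
    have h0 : ∀ n, (π (h n)⁻¹ : K →L[ℂ] K) (e x) = e (x.1, (h n)⁻¹ * x.2) := fun n => hπ _ _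
    simp only [h0, he]
    by_cases hxy : y.1 = x.1
    · simp only [k, Matrix.of_apply, hxy, if_true]
      rw [← Complex.ofReal_zero]
      refine (Complex.continuous_ofReal.tendsto 0).comp (Real.tendsto_exp_neg_atTop_nhds_zero.comp
        (Tendsto.const_mul_atTop (by positivity) ?_))
      simpa only [mul_assoc] using hinf y.2⁻¹ x.2
    · simp [k, hxy]
  have hzero : ∀ x, ⟪ξ, e x⟫_ℂ = 0 := by
    intro x
    have h1 := tendsto_inner_of_denseRange
      (e := ((↑) : Submodule.span ℂ (Set.range e) → K)) (l := atTop)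
      (f := fun n => (π (h n)⁻¹ : K →L[ℂ] K) (e x)) (a := 0) (C := 1)
      (by rw [DenseRange, Subtype.range_coe]; exact hd)
      (Eventually.of_forall fun n => by rw [hπ, hnorm]) (fun ζ => by
        obtain ⟨ζ, hζ⟩ := ζ
        rw [inner_zero_right]
        induction hζ using Submodule.span_induction with
        | mem ζ hζ => obtain ⟨y, rfl⟩ := hζ; exact hmix x y
        | zero => simp
        | add a b _ _ ha hb => simpa [inner_add_left] using ha.add hb
        | smul c a _ ha => simpa [inner_smul_left, mul_comm] using ha.const_mul (starRingEnd ℂ c)) ξ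
    rw [inner_zero_right] at h1
    refine tendsto_nhds_unique (tendsto_const_nhds.congr fun n => ?_) h1
    rw [← hiso, hξ _ (hh n)]
  refine hξ0 ((inner_self_eq_zero (𝕜 := ℂ)).mp ?_)
  refine closure_minimal (s := (Submodule.span ℂ (Set.range e) : Set K))
    (t := {ζ | ⟪ξ, ζ⟫_ℂ = 0}) ?_ (isClosed_eq (by fun_prop) (by fun_prop)) (hd ξ)
  intro ζ hζ
  induction hζ using Submodule.span_induction with
  | mem ζ hζ => obtain ⟨y, rfl⟩ := hζ; exact hzero y
  | zero => simp
  | add a b _ _ ha hb =>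
    change ⟪ξ, a + b⟫_ℂ = 0
    rw [inner_add_right, show ⟪ξ, a⟫_ℂ = 0 from ha, show ⟪ξ, b⟫_ℂ = 0 from hb, add_zero]
  | smul c a _ ha =>
    change ⟪ξ, c • a⟫_ℂ = 0
    rw [inner_smul_right, show ⟪ξ, a⟫_ℂ = 0 from ha, mul_zero]

/-- If uniformity fails for every n, a sparse subsequence m_k and elements h_k ∈ Γ₀ with 1 − Re
ω_{m_k}(h_k) > ε give q = Σ 4^k (1 − Re ω_{m_k}), finite everywhere but unbounded along h_k. -/
theorem HasRelativePropertyT.exists_uniform {Γ : Type v} [Group Γ] [Countable Γ] {Γ₀ : Subgroup Γ}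
    (hT : HasRelativePropertyT Γ₀) {ω : ℕ → Γ → ℂ} (hω : ∀ n, IsPosDefFun (ω n))
    (hω1 : ∀ n, ω n 1 = 1) (hlim : ∀ g, Tendsto (fun n => ω n g) atTop (𝓝 1)) {ε : ℝ}
    (hε : 0 < ε) : ∃ n, ∀ g ∈ Γ₀, 1 - (ω n g).re ≤ ε := by
  by_contra! hcon
  obtain ⟨c, hc⟩ := exists_surjective_nat Γ
  have hre : ∀ g, Tendsto (fun n => 1 - (ω n g).re) atTop (𝓝 0) := fun g => by
    simpa using ((Complex.continuous_re.tendsto _).comp (hlim g)).const_sub 1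
  -- The bound 8^{−k} beats the weight 4^k and leaves the summable 2^{−k}; the element c j is
  -- controlled from k = j on.
  have hex : ∀ k : ℕ, ∃ n, ∀ j ∈ Finset.range (k + 1), 1 - (ω n (c j)).re < (1 / 8) ^ k := fun k =>
    ((Filter.eventually_all_finset _).mpr fun j _ =>
      (hre (c j)).eventually_lt_const (by positivity)).exists
  choose m hm using hex
  choose h hh0 hh using fun k => hcon (m k)
  have hnn : ∀ n g, 0 ≤ 1 - (ω n g).re := fun n g => by
    have := (Complex.re_le_norm _).trans ((hω n).norm_le_one (hω1 n) g)
    linarith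
  have hsum : ∀ g, Summable fun k => (4 : ℝ) ^ k * (1 - (ω (m k) g).re) := by
    intro g
    obtain ⟨j, rfl⟩ := hc g
    refine (summable_nat_add_iff j).mp (Summable.of_nonneg_of_le
      (fun k => mul_nonneg (by positivity) (hnn _ _)) (fun k => ?_)
      (summable_geometric_of_lt_one (r := (1 / 2 : ℝ)) (by norm_num) (by norm_num) |>.comp_injective
        (add_left_injective j)))
    have h1 := hm (k + j) j (Finset.mem_range.mpr (by omega))
    calc (4 : ℝ) ^ (k + j) * (1 - (ω (m (k + j)) (c j)).re)
        ≤ 4 ^ (k + j) * (1 / 8) ^ (k + j) := by gcongr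
      _ = (1 / 2) ^ (k + j) := by rw [← mul_pow]; norm_num
  let q : Γ → ℝ := fun g => ∑' k, (4 : ℝ) ^ k * (1 - (ω (m k) g).re)
  have hq1 : q 1 = 0 := by simp [q, hω1]
  have hqmul : ∀ g g', q (g * g') ≤ 2 * q g + 2 * q g' := by
    intro g g'
    simp only [q]
    rw [← tsum_mul_left, ← tsum_mul_left, ← ((hsum g).mul_left 2).tsum_add ((hsum g').mul_left 2)]
    refine (hsum _).tsum_le_tsum (fun k => ?_) (((hsum g).mul_left 2).add ((hsum g').mul_left 2))
    have h1 := mul_le_mul_of_nonneg_left ((hω (m k)).one_sub_re_mul_le (hω1 _) g g')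
      (show (0 : ℝ) ≤ 4 ^ k by positivity)
    linarith
  have hqinv : ∀ g, q g⁻¹ = q g := fun g => by simp only [q, (hω _).re_inv]
  have hqh : Tendsto (fun k => q (h k)) atTop atTop := by
    refine tendsto_atTop_mono (fun k => ?_) ((tendsto_pow_atTop_atTop_of_one_lt
      (show (1 : ℝ) < 4 by norm_num)).atTop_mul_const hε)
    calc (4 : ℝ) ^ k * ε ≤ 4 ^ k * (1 - (ω (m k) (h k)).re) := by
          gcongr; exact (hh k).le
      _ ≤ q (h k) := (hsum (h k)).le_tsum k fun j _ => mul_nonneg (by positivity) (hnn _ _)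
  refine hT.false_of_tendsto_atTop hq1 (fun s hs => ?_) h hh0 fun g g' => ?_
  -- The function exp(−sq) is the limit of finite products of positive definite factors.
  · refine IsPosDefFun.of_tendsto (l := atTop) (F := fun (n : ℕ) g => ∏ k ∈ Finset.range n,
      (Real.exp (-((s * 4 ^ k) * (1 - (ω (m k) g).re))) : ℂ))
      (fun n => IsPosDefFun.prod _ fun k => (hω (m k)).exp_re (by positivity)) fun g => ?_
    have h1 := (Complex.continuous_ofReal.tendsto _).comp ((Real.continuous_exp.tendsto _).comp
      ((hsum g).hasSum.tendsto_sum_nat.const_mul s).neg)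
    refine h1.congr fun n => ?_
    simp only [Function.comp_apply]
    rw [← Complex.ofReal_prod, ← Real.exp_sum, Finset.mul_sum, ← Finset.sum_neg_distrib]
    simp only [mul_assoc]
  -- Two uses of the quasi-subadditivity `hqmul`, one for each translation, and the symmetry of q.
  · have h1 : ∀ k, q (h k) / 4 - (q g⁻¹ / 2 + q g'⁻¹) ≤ q (g * (h k)⁻¹ * g') := by
      intro k
      have h2 := hqmul (g⁻¹) (g * (h k)⁻¹)
      have h3 := hqmul (g * (h k)⁻¹ * g') g'⁻¹
      rw [inv_mul_cancel_left, hqinv (h k)] at h2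
      rw [mul_inv_cancel_right] at h3
      linarith
    refine tendsto_atTop_mono h1 (tendsto_atTop_add_const_right _ _ ?_)
    exact hqh.atTop_div_const (by norm_num)

/-! ### Transfer of positive definite functions from Λ to Γ. -/

/-- The summands are pairwise orthogonal because the Q t ξ are and R is isometric, so this is
Pythagoras with weights ‖k t‖² ≤ 1. Such sums truncate the comultiplication-like map b v_s ↦ b v_s ⊗
k_s. -/
theorem IsOrthPartition.norm_sum_tmul_le {T E E' K : Type*} [NormedAddCommGroup E]
    [InnerProductSpace ℂ E] [NormedAddCommGroup E'] [InnerProductSpace ℂ E']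
    [NormedAddCommGroup K] [InnerProductSpace ℂ K]
    {Q : T → E →L[ℂ] E} (hQ : IsOrthPartition Q) (R : E →ₗᵢ[ℂ] E') {k : T → K}
    (hk : ∀ t, ‖k t‖ ≤ 1) (S : Finset T) (ξ : E) :
    ‖∑ t ∈ S, R (Q t ξ) ⊗ₜ[ℂ] k t‖ ≤ ‖ξ‖ := by
  classical
  refine le_of_sq_le_sq ?_ (norm_nonneg _)
  have h2 : ⟪∑ t ∈ S, R (Q t ξ) ⊗ₜ[ℂ] k t, ∑ t ∈ S, R (Q t ξ) ⊗ₜ[ℂ] k t⟫_ℂ =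
      ((∑ t ∈ S, ‖Q t ξ‖ ^ 2 * ‖k t‖ ^ 2 : ℝ) : ℂ) := by
    simp only [sum_inner, inner_sum, TensorProduct.inner_tmul, LinearIsometry.inner_map_map]
    rw [Complex.ofReal_sum]
    refine Finset.sum_congr rfl fun s hs => ?_
    rw [Finset.sum_eq_single s, inner_self_eq_norm_sq_to_K, inner_self_eq_norm_sq_to_K]
    · push_cast; rfl
    · intro t _ hts
      rw [hQ.symm, hQ.orth _ _ _ hts, inner_zero_right, zero_mul]
    · exact fun h => absurd hs h
  have h1 : ‖∑ t ∈ S, R (Q t ξ) ⊗ₜ[ℂ] k t‖ ^ 2 = ∑ t ∈ S, ‖Q t ξ‖ ^ 2 * ‖k t‖ ^ 2 := by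
    rw [← inner_self_eq_norm_sq (𝕜 := ℂ), h2]; exact Complex.ofReal_re _
  rw [h1]
  calc ∑ t ∈ S, ‖Q t ξ‖ ^ 2 * ‖k t‖ ^ 2 ≤ ∑ t ∈ S, ‖Q t ξ‖ ^ 2 :=
        Finset.sum_le_sum fun t _ => mul_le_of_le_one_right (by positivity)
          (pow_le_one₀ (norm_nonneg _) (hk t))
    _ ≤ ‖ξ‖ ^ 2 := sum_le_hasSum S (fun _ _ => by positivity) (hQ.hasSum_norm_sq ξ)

theorem IsOrthPartition.norm_sum_mul_inner_le {T E : Type*} [NormedAddCommGroup E]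
    [InnerProductSpace ℂ E] {Q : T → E →L[ℂ] E} (hQ : IsOrthPartition Q) {f : T → ℂ}
    (hf : ∀ t, ‖f t‖ ≤ 1) (S : Finset T) (ζ ξ : E) :
    ‖∑ t ∈ S, f t * ⟪ζ, Q t ξ⟫_ℂ‖ ≤ ‖ζ‖ * ‖ξ‖ := by
  classical
  have h1 : ∑ t ∈ S, f t * ⟪ζ, Q t ξ⟫_ℂ =
      ⟪∑ t ∈ S, LinearIsometry.id (R := ℂ) (Q t ζ) ⊗ₜ[ℂ] (1 : ℂ),
        ∑ t ∈ S, LinearIsometry.id (R := ℂ) (Q t ξ) ⊗ₜ[ℂ] f t⟫_ℂ := by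
    simp only [sum_inner, inner_sum, TensorProduct.inner_tmul, LinearIsometry.id_apply]
    refine Finset.sum_congr rfl fun s hs => ?_
    rw [Finset.sum_eq_single s]
    · rw [hQ.symm, hQ.idem]; simp [mul_comm]
    · intro t _ hts
      rw [hQ.symm, hQ.orth _ _ _ hts, inner_zero_right, zero_mul]
    · exact fun h => absurd hs h
  rw [h1]
  exact (norm_inner_le_norm _ _).trans (mul_le_mul (hQ.norm_sum_tmul_le _ (by simp) S ζ)
    (hQ.norm_sum_tmul_le _ hf S ξ) (norm_nonneg _) (norm_nonneg _))

namespace VonNeumannAlgebra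

variable {H : Type u} [NormedAddCommGroup H] [InnerProductSpace ℂ H] [CompleteSpace H]
  {A B M : VonNeumannAlgebra H} {τ : M.TracialState}

namespace TracialState

variable {Γ : Type v} [Group Γ] {Λ : Type w} [Group Λ]

theorem norm_toL2_mul_le (x y : M) : ‖τ.toL2 (x * y)‖ ≤ ‖x‖ * ‖τ.toL2 y‖ := by
  rw [← leftMul_toL2]
  exact (τ.leftMul x).le_of_opNorm_le (τ.norm_leftMul_le x) _

theorem norm_toL2_mul_le' (x y : M) : ‖τ.toL2 (x * y)‖ ≤ ‖y‖ * ‖τ.toL2 x‖ := by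
  simpa using τ.norm_rightMul_le (MulOpposite.op y) (τ.toL2 x)

theorem norm_toL2_unitary (x : unitary M) : ‖τ.toL2 (x : M)‖ = 1 := by
  have h := (τ.leftIso x).norm_map (τ.toL2 1)
  rwa [leftIso_toL2, mul_one, norm_toL2_one] at h

namespace IsCrossedProduct

variable {v : Λ →* unitary M} (hB : τ.IsCrossedProduct B v)
include hB

/-- Uniform boundedness in 2-norm reduces the claim to the span of the b v_r, where scalars are
absorbed into b. Only additivity is required of D, so that it may also be conjugate linear. -/
theorem tendsto_zero_of_generators {ι : Type*} {l : Filter ι} {D : ι → M → ℂ} {C : ℝ}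
    (hadd : ∀ i x y, D i (x + y) = D i x + D i y) (hC : ∀ i x, ‖D i x‖ ≤ C * ‖τ.toL2 x‖)
    (h : ∀ (b : B) (r : Λ), Tendsto (fun i => D i (inclusion hB.le b * (v r : M))) l (𝓝 0)) (x : M) :
    Tendsto (fun i => D i x) l (𝓝 0) := by
  have h1 : ∀ y ∈ Submodule.span ℂ
      (Set.range fun p : B × Λ => inclusion hB.le p.1 * (v p.2 : M)), ∀ c : ℂ,
      Tendsto (fun i => D i (c • y)) l (𝓝 0) := by
    intro y hy
    induction hy using Submodule.span_induction with
    | mem y hy =>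
      obtain ⟨⟨b, r⟩, rfl⟩ := hy
      intro c
      have := h (c • b) r
      rwa [map_smul, smul_mul_assoc] at this
    | zero =>
      intro c
      have := h 0 1
      rwa [map_zero, zero_mul, ← smul_zero c] at this
    | add y z _ _ hy hz =>
      intro c
      simpa [smul_add, hadd] using (hy c).add (hz c)
    | smul d y _ hy =>
      intro c
      rw [smul_smul]
      exact hy _
  have hC0 : 0 < |C| + 1 := by positivity
  rw [Metric.tendsto_nhds]
  intro ε hε
  obtain ⟨ξ, hξ, hd⟩ := Metric.mem_closure_iff.mp (hB.dense_span (τ.toL2 x)) (ε / 2 / (|C| + 1))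
    (by positivity)
  have h2 : ξ ∈ Submodule.map τ.toL2 (Submodule.span ℂ
      (Set.range fun p : B × Λ => inclusion hB.le p.1 * (v p.2 : M))) := by
    rwa [Submodule.map_span, ← Set.range_comp]
  obtain ⟨y, hy, rfl⟩ := h2
  have h3 := h1 y hy 1
  rw [one_smul] at h3
  filter_upwards [Metric.tendsto_nhds.mp h3 (ε / 2) (by positivity)] with i hi
  rw [dist_zero_right] at hi ⊢
  have h4 : D i x = D i (x - y) + D i y := by rw [← hadd, sub_add_cancel]
  have h5 : ‖D i (x - y)‖ ≤ (|C| + 1) * ‖τ.toL2 (x - y)‖ :=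
    (hC i _).trans (mul_le_mul_of_nonneg_right ((le_abs_self C).trans (by linarith)) (norm_nonneg _))
  rw [map_sub, ← dist_eq_norm] at h5
  have h6 := mul_lt_mul_of_pos_left hd hC0
  rw [mul_div_cancel₀ _ hC0.ne'] at h6
  rw [h4]
  linarith [norm_add_le (D i (x - y)) (D i y)]

/-- With Δ(b v_s) = b v_s ⊗ k_s and m_f(b v_s) = f(s) b v_s, this is the limiting form of ⟨Δ(x),
Δ(y)w*⟩ = τ(w* m_f(x*y)). Each side is 2-norm bounded in one variable when the other is fixed. For x
= b v_r and y = c v_q the two sides agree once S contains r, q and r⁻¹q. -/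
theorem tendsto_sum_inner_proj {f : Λ → ℂ} {K : Type*} [NormedAddCommGroup K]
    [InnerProductSpace ℂ K] {k : Λ → K} (hk : ∀ s t, ⟪k s, k t⟫_ℂ = f (s⁻¹ * t)) (hf1 : f 1 = 1)
    (hf : ∀ s, ‖f s‖ ≤ 1) (w : unitary M) (x y : M) :
    Tendsto (fun S : Finset Λ => ⟪∑ s ∈ S, hB.proj s (τ.toL2 x) ⊗ₜ[ℂ] k s,
        ∑ t ∈ S, τ.rightIso w (hB.proj t (τ.toL2 y)) ⊗ₜ[ℂ] k t⟫_ℂ -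
      ∑ s ∈ S, f s * ⟪τ.toL2 (w : M), hB.proj s (τ.toL2 (star x * y))⟫_ℂ) atTop (𝓝 0) := by
  classical
  have hQ := hB.isOrthPartition_proj
  have hkn : ∀ s, ‖k s‖ ≤ 1 := fun s => by
    rw [@norm_eq_sqrt_re_inner ℂ, hk, inv_mul_cancel, hf1]; simp
  have hbound : ∀ (S : Finset Λ) (x y : M),
      ‖⟪∑ s ∈ S, hB.proj s (τ.toL2 x) ⊗ₜ[ℂ] k s,
        ∑ t ∈ S, τ.rightIso w (hB.proj t (τ.toL2 y)) ⊗ₜ[ℂ] k t⟫_ℂ -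
      ∑ s ∈ S, f s * ⟪τ.toL2 (w : M), hB.proj s (τ.toL2 (star x * y))⟫_ℂ‖ ≤
        ‖τ.toL2 x‖ * ‖τ.toL2 y‖ + ‖τ.toL2 (star x * y)‖ := by
    intro S x y
    refine (norm_sub_le _ _).trans (add_le_add ((norm_inner_le_norm (𝕜 := ℂ) (E := τ.L2 ⊗[ℂ] K)
      _ _).trans (mul_le_mul ?_ ?_ (norm_nonneg _) (norm_nonneg _))) ?_)
    · exact hQ.norm_sum_tmul_le LinearIsometry.id hkn S _
    · exact hQ.norm_sum_tmul_le (τ.rightIso w) hkn S _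
    · have := hQ.norm_sum_mul_inner_le hf S (τ.toL2 (w : M)) (τ.toL2 (star x * y))
      rwa [norm_toL2_unitary, one_mul] at this
  refine hB.tendsto_zero_of_generators (C := ‖y‖ + ‖y‖)
    (D := fun S x => ⟪∑ s ∈ S, hB.proj s (τ.toL2 x) ⊗ₜ[ℂ] k s,
        ∑ t ∈ S, τ.rightIso w (hB.proj t (τ.toL2 y)) ⊗ₜ[ℂ] k t⟫_ℂ -
      ∑ s ∈ S, f s * ⟪τ.toL2 (w : M), hB.proj s (τ.toL2 (star x * y))⟫_ℂ)
    (fun S x x' => ?_) (fun S x => ?_) (fun b r => ?_) x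
  · simp only [map_add, TensorProduct.add_tmul, Finset.sum_add_distrib, inner_add_left, star_add,
      add_mul, inner_add_right, mul_add]
    ring
  · refine (hbound S x y).trans ?_
    have h1 := norm_toL2_mul_le' (τ := τ) (star x) y
    rw [norm_toL2_star] at h1
    have h2 := mul_le_mul_of_nonneg_left (τ.norm_toL2_le y) (norm_nonneg (τ.toL2 x))
    linarith
  clear x
  set x := inclusion hB.le b * (v r : M) with hx
  refine hB.tendsto_zero_of_generators (C := ‖x‖ + ‖x‖)
    (D := fun S y => ⟪∑ s ∈ S, hB.proj s (τ.toL2 x) ⊗ₜ[ℂ] k s,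
        ∑ t ∈ S, τ.rightIso w (hB.proj t (τ.toL2 y)) ⊗ₜ[ℂ] k t⟫_ℂ -
      ∑ s ∈ S, f s * ⟪τ.toL2 (w : M), hB.proj s (τ.toL2 (star x * y))⟫_ℂ)
    (fun S y y' => ?_) (fun S y => ?_) (fun c q => ?_) y
  · simp only [map_add, TensorProduct.add_tmul, Finset.sum_add_distrib,
      inner_add_right, mul_add]
    ring
  · refine (hbound S x y).trans ?_
    have h1 := norm_toL2_mul_le (τ := τ) (star x) y
    rw [norm_star] at h1
    have h2 := mul_le_mul_of_nonneg_right (τ.norm_toL2_le x) (norm_nonneg (τ.toL2 y))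
    linarith
  clear y
  set y := inclusion hB.le c * (v q : M) with hy
  refine tendsto_const_nhds.congr' ?_
  filter_upwards [eventually_ge_atTop {r, q, r⁻¹ * q}] with S hS
  have hr : r ∈ S := hS (by simp)
  have hq : q ∈ S := hS (by simp)
  have hrq : r⁻¹ * q ∈ S := hS (by simp)
  have hxy : star x * y =
      inclusion hB.le (hB.act r⁻¹ (star b) * hB.act r⁻¹ c) * (v (r⁻¹ * q) : M) := by
    rw [hx, hy, hB.star_inclusion_mul, hB.inclusion_mul_mul]
  have h1 : ∀ (b : B) (r s : Λ), r ≠ s → hB.proj s (τ.toL2 (inclusion hB.le b * (v r : M))) = 0 :=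
    fun b r s hrs => by rw [hB.proj_toL2, if_neg hrs]
  have h2 : ∀ (b : B) (r : Λ), hB.proj r (τ.toL2 (inclusion hB.le b * (v r : M))) =
      τ.toL2 (inclusion hB.le b * (v r : M)) := fun b r => by rw [hB.proj_toL2, if_pos rfl]
  rw [Finset.sum_eq_single r (fun s _ hs => by rw [hx, h1 _ _ _ hs.symm, TensorProduct.zero_tmul])
      (fun h => absurd hr h),
    Finset.sum_eq_single q (fun s _ hs => by
      rw [hy, h1 _ _ _ hs.symm, map_zero, TensorProduct.zero_tmul]) (fun h => absurd hq h),
    Finset.sum_eq_single (r⁻¹ * q) (fun s _ hs => by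
      rw [hxy, h1 _ _ _ hs.symm, inner_zero_right, mul_zero]) (fun h => absurd hrq h),
    TensorProduct.inner_tmul, hk, h2, h2, hxy, h2, ← hxy, ← hx, ← hy, rightIso_toL2,
    inner_toL2, inner_toL2, ← mul_assoc]
  have h3 := τ.trace_comm (star x * y) (star (w : M))
  change 0 = τ.toFunctional _ * _ - _ * τ.toFunctional _
  rw [h3]
  ring

end IsCrossedProduct

/-- A function on `Λ` bounded by `1` multiplies the Fourier coefficients over `Λ`; this is the
coefficient of the resulting map at the unitary `u g`. -/
noncomputable def IsCrossedProduct.transfer {v : Λ →* unitary M} (hB : τ.IsCrossedProduct B v)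
    (u : Γ →* unitary M) (f : Λ → ℂ) (g : Γ) : ℂ :=
  ∑' s, f s * ((‖hB.proj s (τ.toL2 (u g : M))‖ ^ 2 : ℝ) : ℂ)

namespace IsCrossedProduct

variable {v : Λ →* unitary M} (hB : τ.IsCrossedProduct B v) (u : Γ →* unitary M)

theorem hasSum_norm_proj_sq (x : unitary M) :
    HasSum (fun s => ‖hB.proj s (τ.toL2 (x : M))‖ ^ 2) 1 := by
  have h := hB.isOrthPartition_proj.hasSum_norm_sq (τ.toL2 (x : M))
  rwa [norm_toL2_unitary, one_pow] at h

theorem summable_transfer {f : Λ → ℂ} (hf : ∀ s, ‖f s‖ ≤ 1) (g : Γ) :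
    Summable fun s => f s * ((‖hB.proj s (τ.toL2 (u g : M))‖ ^ 2 : ℝ) : ℂ) := by
  refine Summable.of_norm_bounded (hB.hasSum_norm_proj_sq (u g)).summable fun s => ?_
  rw [norm_mul, Complex.norm_real, Real.norm_of_nonneg (by positivity)]
  exact mul_le_of_le_one_left (by positivity) (hf s)

/-- The kernel is the limit of the Gram matrices of the truncations of Δ(u_g)u_g*, by the preceding
identity with w = u_{g⁻¹h}. -/
theorem isPosDefFun_transfer {f : Λ → ℂ} (hf : IsPosDefFun f) (hf1 : f 1 = 1) :
    IsPosDefFun (hB.transfer u f) := by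
  obtain ⟨K, _, _, _, _, k, hk, -, -⟩ := hf.exists_vec
  have hfn := hf.norm_le_one hf1
  refine posSemidef_of_tendsto (l := atTop) (k := fun S : Finset Λ => Matrix.of fun g h =>
    ⟪∑ s ∈ S, τ.rightIso (u g) (hB.proj s (τ.toL2 (u g : M))) ⊗ₜ[ℂ] k s,
      ∑ s ∈ S, τ.rightIso (u h) (hB.proj s (τ.toL2 (u h : M))) ⊗ₜ[ℂ] k s⟫_ℂ)
    (fun S => posSemidef_of_inner (fun g : Γ =>
      ∑ s ∈ S, τ.rightIso (u g) (hB.proj s (τ.toL2 (u g : M))) ⊗ₜ[ℂ] k s) fun _ _ => rfl)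
    fun g h => ?_
  have h1 := hB.tendsto_sum_inner_proj hk hf1 hfn (u (g⁻¹ * h)) (u g : M) (u h : M)
  have h2 := (hB.summable_transfer u hfn (g⁻¹ * h)).hasSum
  rw [HasSum, SummationFilter.unconditional_filter] at h2
  refine (add_zero (hB.transfer u f (g⁻¹ * h)) ▸ h2.add h1).congr fun S => ?_
  have h3 : star (u g : M) * (u h : M) = (u (g⁻¹ * h) : M) := by rw [star_coe, coe_mul]
  simp only [h3, hB.isOrthPartition_proj.inner_self_apply, add_sub_cancel, Matrix.of_apply,
    sum_inner, inner_sum, TensorProduct.inner_tmul]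
  refine Finset.sum_congr rfl fun s _ => Finset.sum_congr rfl fun t _ => ?_
  rw [inner_rightIso_left, ← rightIso_mul, map_mul, map_inv]

theorem transfer_one {f : Λ → ℂ} (hf1 : f 1 = 1) : hB.transfer u f 1 = 1 := by
  classical
  have h1 : ∀ s, hB.proj s (τ.toL2 (u 1 : M)) = if 1 = s then τ.toL2 1 else 0 := by
    intro s
    have := hB.proj_toL2 1 s 1
    rw [_root_.map_one u, OneMemClass.coe_one]
    rwa [inclusion_one, one_mul, _root_.map_one, OneMemClass.coe_one] at this
  rw [transfer, tsum_eq_single 1]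
  · rw [hf1, h1, if_pos rfl, norm_toL2_one]; simp
  · intro s hs
    rw [h1, if_neg hs.symm]; simp

theorem tendsto_transfer {f : ℕ → Λ → ℂ} (hf : ∀ n s, ‖f n s‖ ≤ 1)
    (hlim : ∀ s, Tendsto (fun n => f n s) atTop (𝓝 1)) (g : Γ) :
    Tendsto (fun n => hB.transfer u (f n) g) atTop (𝓝 1) := by
  have h0 := hB.hasSum_norm_proj_sq (u g)
  have h1 : (1 : ℂ) = ∑' s, 1 * ((‖hB.proj s (τ.toL2 (u g : M))‖ ^ 2 : ℝ) : ℂ) := by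
    simp only [one_mul]
    rw [← Complex.ofReal_tsum, h0.tsum_eq, Complex.ofReal_one]
  rw [h1]
  refine tendsto_tsum_of_dominated_convergence h0.summable
    (fun s => (hlim s).mul_const _) (Eventually.of_forall fun n s => ?_)
  rw [norm_mul, Complex.norm_real, Real.norm_of_nonneg (by positivity)]
  exact mul_le_of_le_one_left (by positivity) (hf n s)

theorem re_transfer {f : Λ → ℂ} (hf : ∀ s, ‖f s‖ ≤ 1) (g : Γ) :
    HasSum (fun s => (1 - (f s).re) * ‖hB.proj s (τ.toL2 (u g : M))‖ ^ 2)
      (1 - (hB.transfer u f g).re) := by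
  have h1 := Complex.hasSum_re (hB.summable_transfer u hf g).hasSum
  refine ((hB.hasSum_norm_proj_sq (u g)).sub h1).congr_fun fun s => ?_
  rw [Complex.re_mul_ofReal]; ring

end IsCrossedProduct

/-! ### Coefficients of a completely positive map along the unitaries v_s. -/

section CompletelyPositive

variable (τ) (φ : M →CP M) (v : Λ →* unitary M)

/-- The coefficient `s ↦ τ(v_s^* φ(v_s))`. -/
noncomputable def cpCoeff (s : Λ) : ℂ := τ.toFunctional (star (v s : M) * φ (v s))

theorem cpCoeff_eq_inner (s : Λ) : τ.cpCoeff φ v s = ⟪τ.toL2 (v s : M), τ.toL2 (φ (v s))⟫_ℂ := by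
  rw [inner_toL2, cpCoeff]

theorem isPosDefFun_cpCoeff : IsPosDefFun (τ.cpCoeff φ v) := by
  -- Traciality gives the shape y_s* φ(x_s* x_t) y_t with x_s = v_s and y_s = v_s*, to which
  -- `CompletelyPositiveMap.sum_nonneg` applies.
  have hk : ∀ s t, τ.cpCoeff φ v (s⁻¹ * t) =
      τ.toFunctional (star (v s⁻¹ : M) * φ (star (v s : M) * (v t : M)) * (v t⁻¹ : M)) := by
    intro s t
    have h1 : star (v (s⁻¹ * t) : M) = (v t⁻¹ : M) * (v s : M) := by
      rw [IsCrossedProduct.star_coe, mul_inv_rev, inv_inv, IsCrossedProduct.coe_mul]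
    rw [cpCoeff, h1, IsCrossedProduct.coe_mul, IsCrossedProduct.star_coe,
      IsCrossedProduct.star_coe, inv_inv, mul_assoc, τ.trace_comm]
  refine ⟨?_, fun c => ?_⟩
  · ext s t
    rw [Matrix.conjTranspose_apply, Matrix.of_apply, Matrix.of_apply, hk, hk, ← trace_star,
      star_mul, star_mul, star_star, ← map_star, star_mul, star_star, mul_assoc]
  · have h1 := φ.sum_nonneg (fun s : c.support => (v s : M))
      (fun s : c.support => c s • (v (s : Λ)⁻¹ : M))
    have h2 : (0 : ℂ) ≤ τ.toFunctional _ := map_nonneg τ.toFunctional h1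
    refine h2.trans_eq ?_
    rw [map_sum]
    simp only [map_sum, Finsupp.sum]
    refine (Finset.sum_congr rfl fun s _ => ?_).trans (Finset.sum_coe_sort c.support _)
    refine (Finset.sum_congr rfl fun t _ => ?_).trans (Finset.sum_coe_sort c.support _)
    change _ = star (c s) * τ.cpCoeff φ v _ * c t
    rw [hk, star_smul, smul_mul_assoc, smul_mul_assoc, mul_smul_comm, map_smul,
      map_smul]
    simp only [smul_eq_mul]
    ring

variable {φ} (hφ1 : φ 1 = 1)
include hφ1

theorem cpCoeff_one : τ.cpCoeff φ v 1 = 1 := by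
  rw [cpCoeff, _root_.map_one, OneMemClass.coe_one, hφ1, star_one, one_mul, τ.map_one]

theorem norm_toL2_map_le_one (x : unitary M) : ‖τ.toL2 (φ x)‖ ≤ 1 := by
  -- Kadison–Schwarz: these vectors and coefficients give 1 − φ(x)*φ(x) ≥ 0.
  have h1 := φ.sum_nonneg ![(x : M), 1] ![1, -φ x]
  have h2 : (0 : M) ≤ 1 - star (φ x) * φ x := by
    refine h1.trans_eq ?_
    have h3 : star (x : M) * x = 1 := Unitary.coe_star_mul_self x
    simp [Fin.sum_univ_two, hφ1, h3, map_star, sub_eq_add_neg]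
  have h3 : (0 : ℂ) ≤ τ.toFunctional _ := map_nonneg τ.toFunctional h2
  rw [map_sub, τ.map_one, show τ.toFunctional (star (φ x) * φ x) = _ from
    (τ.inner_toL2 (φ x) (φ x)).symm, inner_self_eq_norm_sq_to_K] at h3
  have h4 : (0 : ℂ) ≤ ((1 - ‖τ.toL2 (φ x)‖ ^ 2 : ℝ) : ℂ) := by
    push_cast; exact h3
  rw [Complex.zero_le_real] at h4
  nlinarith [norm_nonneg (τ.toL2 (φ x))]

theorem norm_map_sub_sq_le (s : Λ) :
    τ.norm₂ (φ (v s) - (v s : M)) ^ 2 ≤ 2 * (1 - (τ.cpCoeff φ v s).re) := by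
  rw [norm₂_eq, map_sub, @norm_sub_sq ℂ, norm_toL2_unitary, inner_re_symm, ← cpCoeff_eq_inner]
  have := pow_le_one₀ (norm_nonneg _) (τ.norm_toL2_map_le_one hφ1 (v s)) (n := 2)
  simp only [RCLike.re_to_complex]
  linarith

omit hφ1 in
theorem norm_one_sub_cpCoeff_le (s : Λ) :
    ‖τ.cpCoeff φ v s - 1‖ ≤ τ.norm₂ (φ (v s) - (v s : M)) := by
  have h1 : (1 : ℂ) = ⟪τ.toL2 (v s : M), τ.toL2 (v s : M)⟫_ℂ := by
    rw [inner_self_eq_norm_sq_to_K, norm_toL2_unitary]; simp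
  rw [norm₂_eq, cpCoeff_eq_inner, h1, ← inner_sub_right, ← map_sub]
  refine (norm_inner_le_norm _ _).trans ?_
  rw [norm_toL2_unitary, one_mul]

end CompletelyPositive

end TracialState
end VonNeumannAlgebra

/-! ### Coarse bimodules and the use of amenability. -/

theorem denseRange_tensorMap {E F E' F' : Type*} [NormedAddCommGroup E] [InnerProductSpace ℂ E]
    [NormedAddCommGroup F] [InnerProductSpace ℂ F] [AddCommGroup E'] [Module ℂ E']
    [AddCommGroup F'] [Module ℂ F'] {f : E' →ₗ[ℂ] E} {g : F' →ₗ[ℂ] F} (hf : DenseRange f)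
    (hg : DenseRange g) : DenseRange (TensorProduct.map f g) := by
  have h1 : ∀ ξ η, ξ ⊗ₜ[ℂ] η ∈ (LinearMap.range (TensorProduct.map f g)).topologicalClosure := by
    intro ξ η
    have hc : IsClosed ((LinearMap.range (TensorProduct.map f g)).topologicalClosure :
      Set (E ⊗[ℂ] F)) := Submodule.isClosed_topologicalClosure _
    induction ξ using hf.induction_on with
    | hp => exact hc.preimage (by fun_prop)
    | ih a =>
      induction η using hg.induction_on with
      | hp => exact hc.preimage (by fun_prop)
      | ih b => exact Submodule.le_topologicalClosure _ ⟨a ⊗ₜ b, rfl⟩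
  intro z
  change z ∈ (LinearMap.range (TensorProduct.map f g)).topologicalClosure
  induction z using TensorProduct.induction_on with
  | zero => exact zero_mem _
  | add x y hx hy => exact add_mem hx hy
  | tmul ξ η => exact h1 ξ η

theorem LinearIsometry.inner_sum_map_sum_eq {E ι : Type*} [NormedAddCommGroup E]
    [InnerProductSpace ℂ E] [Fintype ι] [DecidableEq ι] (L : E →ₗᵢ[ℂ] E) {w w' : ι → E} {c : ι → ℂ}
    (h : ∀ i j, ⟪w i, L (w' j)⟫_ℂ = if j = i then c i else 0) :
    ⟪∑ i, w i, L (∑ i, w' i)⟫_ℂ = ∑ i, c i := by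
  simp only [map_sum, sum_inner, inner_sum, h, Finset.sum_ite_eq, Finset.mem_univ,
    if_true]

namespace VonNeumannAlgebra.TracialState

variable {H : Type u} [NormedAddCommGroup H] [InnerProductSpace ℂ H] [CompleteSpace H]
  {A B M : VonNeumannAlgebra H} (τ : M.TracialState)

section Coarse

variable (N : Type*) [NormedAddCommGroup N] [InnerProductSpace ℂ N]

/-- A multiple `L²(M) ⊗ L²(M) ⊗ N` of the coarse bimodule (not completed). -/
def CoarseMultiple : Type _ := (τ.L2 ⊗[ℂ] τ.L2) ⊗[ℂ] N

noncomputable instance : NormedAddCommGroup (τ.CoarseMultiple N) :=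
  inferInstanceAs (NormedAddCommGroup ((τ.L2 ⊗[ℂ] τ.L2) ⊗[ℂ] N))

noncomputable instance : InnerProductSpace ℂ (τ.CoarseMultiple N) :=
  inferInstanceAs (InnerProductSpace ℂ ((τ.L2 ⊗[ℂ] τ.L2) ⊗[ℂ] N))

variable {N}

/-- The elementary tensors of a multiple of the coarse bimodule. -/
noncomputable def coarseMk (ξ η : τ.L2) (n : N) : τ.CoarseMultiple N :=
  (ξ ⊗ₜ[ℂ] η) ⊗ₜ[ℂ] n

theorem inner_coarseMk (ξ η ξ' η' : τ.L2) (n n' : N) :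
    ⟪τ.coarseMk ξ η n, τ.coarseMk ξ' η' n'⟫_ℂ = ⟪ξ, ξ'⟫_ℂ * ⟪η, η'⟫_ℂ * ⟪n, n'⟫_ℂ := by
  refine (TensorProduct.inner_tmul (𝕜 := ℂ) (ξ ⊗ₜ[ℂ] η) (ξ' ⊗ₜ[ℂ] η') n n').trans ?_
  rw [TensorProduct.inner_tmul]

theorem coarse_induction {p : τ.CoarseMultiple N → Prop} (h0 : p 0)
    (hadd : ∀ a b, p a → p b → p (a + b)) (ht : ∀ ξ η n, p (τ.coarseMk ξ η n)) (a) : p a := by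
  refine TensorProduct.induction_on (motive := p) a h0 (fun y n => ?_) hadd
  refine TensorProduct.induction_on (motive := fun y => p (y ⊗ₜ[ℂ] n)) y ?_ (fun ξ η => ht ξ η n)
    fun x y hx hy => ?_
  · rw [TensorProduct.zero_tmul]; exact h0
  · rw [TensorProduct.add_tmul]; exact hadd _ _ hx hy

/-- The conjugation `ξ ⊗ η ⊗ n ↦ x ξ ⊗ η x^* ⊗ n` by a unitary `x`, on a multiple of the coarse
bimodule. -/
noncomputable def coarseIso (x : unitary M) : τ.CoarseMultiple N →ₗᵢ[ℂ] τ.CoarseMultiple N :=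
  ((TensorProduct.mapIsometry (τ.leftIso x) (τ.rightIso x)).rTensor N :
    ((τ.L2 ⊗[ℂ] τ.L2) ⊗[ℂ] N) →ₗᵢ[ℂ] ((τ.L2 ⊗[ℂ] τ.L2) ⊗[ℂ] N))

theorem coarseIso_mk (x : unitary M) (ξ η : τ.L2) (n : N) :
    τ.coarseIso x (τ.coarseMk ξ η n) = τ.coarseMk (τ.leftIso x ξ) (τ.rightIso x η) n := rfl

theorem coarseIso_mul (x y : unitary M) (a : τ.CoarseMultiple N) :
    τ.coarseIso (x * y) a = τ.coarseIso x (τ.coarseIso y a) := by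
  refine τ.coarse_induction (p := fun a => τ.coarseIso (x * y) a = τ.coarseIso x (τ.coarseIso y a))
    ?_ (fun a b ha hb => ?_) (fun ξ η n => ?_) a
  · simp only [map_zero]
  · simp only [map_add, ha, hb]
  · simp only [coarseIso_mk, leftIso_mul, rightIso_mul]

theorem coarseIso_one (a : τ.CoarseMultiple N) : τ.coarseIso 1 a = a := by
  refine τ.coarse_induction (p := fun a => τ.coarseIso 1 a = a)
    ?_ (fun a b ha hb => ?_) (fun ξ η n => ?_) a
  · simp only [map_zero]
  · simp only [map_add, ha, hb]
  · simp only [coarseIso_mk, leftIso_one, rightIso_one]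

end Coarse

section Proj

variable {τ} {Γ : Type v} [Group Γ] {u : Γ →* unitary M} (hA : τ.IsCrossedProduct A u)
  (N : Type*) [NormedAddCommGroup N] [InnerProductSpace ℂ N]

/-- The projection onto `u_g L²(A) ⊗ L²(M) ⊗ N`. -/
noncomputable def IsCrossedProduct.coarseProj (g : Γ) :
    τ.CoarseMultiple N →L[ℂ] τ.CoarseMultiple N :=
  (((hA.proj g).rTensor τ.L2).rTensor N :
    ((τ.L2 ⊗[ℂ] τ.L2) ⊗[ℂ] N) →L[ℂ] ((τ.L2 ⊗[ℂ] τ.L2) ⊗[ℂ] N))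

variable {N}

theorem IsCrossedProduct.coarseProj_mk (g : Γ) (ξ η : τ.L2) (n : N) :
    hA.coarseProj N g (τ.coarseMk ξ η n) = τ.coarseMk (hA.proj g ξ) η n := rfl

theorem IsCrossedProduct.isOrthPartition_coarseProj : IsOrthPartition (hA.coarseProj N) :=
  (hA.isOrthPartition_proj.rTensor τ.L2).rTensor N

theorem IsCrossedProduct.coarseIso_coarseProj (g h : Γ) (a : τ.CoarseMultiple N) :
    τ.coarseIso (u g) (hA.coarseProj N h a) = hA.coarseProj N (g * h) (τ.coarseIso (u g) a) := by
  refine τ.coarse_induction (p := fun a =>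
    τ.coarseIso (u g) (hA.coarseProj N h a) = hA.coarseProj N (g * h) (τ.coarseIso (u g) a))
    ?_ (fun a b ha hb => ?_) (fun ξ η n => ?_) a
  · simp only [map_zero]
  · simp only [map_add, ha, hb]
  · simp only [coarseProj_mk, coarseIso_mk, hA.leftIso_proj]

end Proj

section Approximation

/-- The vector of the coarse bimodule attached to two elements of the algebra. -/
noncomputable def coarseVec (a b : M) : τ.Coarse :=
  ((τ.toL2 a ⊗ₜ[ℂ] τ.toL2 b : τ.L2 ⊗[ℂ] τ.L2) : τ.Coarse)

/-- The operator `ξ ⊗ η ↦ a ξ ⊗ η a^*` on the coarse bimodule. -/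
noncomputable def coarseConj (a : M) : τ.Coarse →L[ℂ] τ.Coarse :=
  firstLeg τ.L2 τ.L2 (τ.leftMul a) ∘L secondLeg τ.L2 τ.L2 (τ.rightMul (MulOpposite.op (star a)))

theorem inner_coarseVec (a b a' b' : M) : ⟪τ.coarseVec a b, τ.coarseVec a' b'⟫_ℂ =
    ⟪τ.toL2 a, τ.toL2 a'⟫_ℂ * ⟪τ.toL2 b, τ.toL2 b'⟫_ℂ := by
  rw [coarseVec, coarseVec, UniformSpace.Completion.inner_coe, TensorProduct.inner_tmul]

theorem coarseConj_coarseVec (a b c : M) :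
    τ.coarseConj a (τ.coarseVec b c) = τ.coarseVec (a * b) (c * star a) := by
  have h1 : secondLeg τ.L2 τ.L2 (τ.rightMul (MulOpposite.op (star a))) (τ.coarseVec b c) =
      τ.coarseVec b (c * star a) := by
    refine (ContinuousLinearMap.completion_apply_coe _ _).trans ?_
    rw [ContinuousLinearMap.lTensor_tmul, rightMul_toL2]; rfl
  have h2 : firstLeg τ.L2 τ.L2 (τ.leftMul a) (τ.coarseVec b (c * star a)) =
      τ.coarseVec (a * b) (c * star a) := by
    refine (ContinuousLinearMap.completion_apply_coe _ _).trans ?_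
    rw [ContinuousLinearMap.rTensor_tmul, leftMul_toL2]; rfl
  rw [coarseConj, ContinuousLinearMap.comp_apply, h1, h2]

theorem dense_coarseVec_sums : Dense {ξ : τ.Coarse | ∃ (m : ℕ) (a b : Fin m → M),
    ξ = ∑ j, τ.coarseVec (a j) (b j)} := by
  have h1 : DenseRange fun z : M ⊗[ℂ] M =>
      ((TensorProduct.map τ.toL2 τ.toL2 z : τ.L2 ⊗[ℂ] τ.L2) : τ.Coarse) :=
    UniformSpace.Completion.denseRange_coe.comp
      (denseRange_tensorMap τ.denseRange_toL2 τ.denseRange_toL2)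
      (UniformSpace.Completion.continuous_coe _)
  refine h1.mono ?_
  rintro _ ⟨z, rfl⟩
  induction z using TensorProduct.induction_on with
  | zero => exact ⟨0, 0, 0, by simp⟩
  | add x y hx hy =>
    obtain ⟨m, a, b, hx⟩ := hx
    obtain ⟨m', a', b', hy⟩ := hy
    refine ⟨m + m', Fin.append a a', Fin.append b b', ?_⟩
    simp only [map_add, UniformSpace.Completion.coe_add, Fin.sum_univ_add, Fin.append_left,
      Fin.append_right] at hx hy ⊢
    rw [hx, hy]
  | tmul a b => exact ⟨1, fun _ => a, fun _ => b, by simp [coarseVec]⟩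

theorem inner_toL2_one_conj (b : M) :
    ⟪τ.toL2 1, τ.leftMul b (τ.rightMul (MulOpposite.op (star b)) (τ.toL2 1))⟫_ℂ =
      ((‖τ.toL2 b‖ ^ 2 : ℝ) : ℂ) := by
  rw [← norm_toL2_star, Complex.ofReal_pow]
  refine Eq.trans ?_ (inner_self_eq_norm_sq_to_K (𝕜 := ℂ) (τ.toL2 (star b)))
  rw [rightMul_toL2, leftMul_toL2, inner_toL2, inner_toL2, star_star, star_one, one_mul, one_mul]
  rfl

variable {τ}

/-- Weak containment is applied at the trace vector, whose coefficient at (b, b*) is τ(bb*) = ‖b‖₂².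
The approximation is an open condition on the coarse vectors, so these may be taken to be sums of
elementary tensors of algebra elements, which also make sense in L²(M). -/
theorem IsAmenable.exists_coarseVec (ham : τ.IsAmenable) (E : Finset M) {δ : ℝ} (hδ : 0 < δ) :
    ∃ (n : ℕ) (m : Fin n → ℕ) (c d : ∀ i, Fin (m i) → M), ∀ b ∈ E,
      ‖((‖τ.toL2 b‖ ^ 2 : ℝ) : ℂ) - ∑ i, ⟪∑ j, τ.coarseVec (c i j) (d i j),
        τ.coarseConj b (∑ j, τ.coarseVec (c i j) (d i j))⟫_ℂ‖ < δ := by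
  classical
  obtain ⟨n, η, hη⟩ := ham (τ.toL2 1) E (E.image star) δ hδ
  let O : Set (Fin n → τ.Coarse) := ⋂ b ∈ E,
    {η | ‖((‖τ.toL2 b‖ ^ 2 : ℝ) : ℂ) - ∑ i, ⟪η i, τ.coarseConj b (η i)⟫_ℂ‖ < δ}
  have hO : IsOpen O :=
    isOpen_biInter_finset fun b _ => isOpen_lt (by fun_prop) continuous_const
  have hOne : O.Nonempty := by
    refine ⟨η, Set.mem_iInter₂.mpr fun b hb => ?_⟩
    have h1 := hη b hb (star b) (Finset.mem_image_of_mem _ hb)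
    rw [Set.mem_ofPred_eq, ← inner_toL2_one_conj]
    exact h1
  have hdense : Dense (Set.univ.pi fun _ : Fin n => {ξ : τ.Coarse | ∃ (m : ℕ) (a b : Fin m → M),
      ξ = ∑ j, τ.coarseVec (a j) (b j)}) := dense_pi _ fun i _ => τ.dense_coarseVec_sums
  obtain ⟨η', hη'O, hη'⟩ := hdense.inter_open_nonempty O hO hOne
  choose m c d hcd using fun i => hη' i (Set.mem_univ i)
  refine ⟨n, m, c, d, fun b hb => ?_⟩
  simp only [← hcd]
  exact Set.mem_iInter₂.mp hη'O b hb

variable {Γ : Type v} [Group Γ] {u : Γ →* unitary M} (hA : τ.IsCrossedProduct A u)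

/-- When paired with elements of A under the trace, u_t* x u_r can be replaced by its expectation a.
This moves coarse coefficients of A at a to coarse coefficients of M at x. -/
theorem IsCrossedProduct.inner_conj {t r : Γ} {x : unitary M} {a : A}
    (ha : τ.expect hA.le (τ.toL2 ((u t⁻¹ : M) * x * (u r : M))) = τ.toL2 (inclusion hA.le a))
    (c d c' d' : A) :
    ⟪(τ.restrict hA.le).toL2 c, (τ.restrict hA.le).toL2 (a * c')⟫_ℂ *
      ⟪(τ.restrict hA.le).toL2 d, (τ.restrict hA.le).toL2 (d' * star a)⟫_ℂ =
      ⟪τ.leftIso (u t) (τ.toL2 (inclusion hA.le c)),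
        τ.leftIso x (τ.leftIso (u r) (τ.toL2 (inclusion hA.le c')))⟫_ℂ *
      ⟪τ.rightIso (u t) (τ.toL2 (inclusion hA.le d)),
        τ.rightIso x (τ.rightIso (u r) (τ.toL2 (inclusion hA.le d')))⟫_ℂ := by
  have e1 := τ.inner_toL2_expect hA.le (c * star c') (τ.toL2 ((u t⁻¹ : M) * x * (u r : M)))
  have e2 := τ.inner_expect_left hA.le (τ.toL2 ((u t⁻¹ : M) * x * (u r : M)))
    (τ.toL2 (inclusion hA.le (star d * d')))
  rw [τ.expect_eq_self hA.le (τ.toL2_inclusion_mem hA.le _)] at e2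
  rw [ha] at e1 e2
  rw [inner_restrict_toL2, inner_restrict_toL2, leftIso_toL2, leftIso_toL2, leftIso_toL2,
    rightIso_toL2, rightIso_toL2, rightIso_toL2]
  simp only [inner_toL2, star_mul, inclusion_mul, inclusion_star, star_star, star_coe, inv_inv]
    at e1 e2 ⊢
  have cyc : ∀ p q : M, τ.toFunctional (p * q) = τ.toFunctional (q * p) := τ.trace_comm
  simp only [mul_assoc] at e1 e2 ⊢
  congr 1
  · simpa only [mul_assoc] using (cyc _ _).symm.trans (e1.trans (cyc _ _))
  · have e3 := cyc ((u r⁻¹ : M) * star (x : M))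
      ((u t : M) * (star (inclusion hA.le d) * inclusion hA.le d'))
    simp only [mul_assoc] at e3
    simpa only [mul_assoc] using (cyc _ _).symm.trans (e2.trans e3)

/-- If Σ_j c_ij ⊗ d_ij are the coarse vectors given by amenability of A, take ζ = Σ_t Σ_i Σ_j u_t
c_ij ⊗ d_ij u_t* ⊗ f_t ⊗ e_i. The factor f_t produces the weights ⟨f_t, f_r⟩, and the orthonormal
e_i merge the n coefficients into one. -/
theorem IsCrossedProduct.exists_coarse_vector (ham : (τ.restrict hA.le).IsAmenable)
    {N₀ : Type*} [NormedAddCommGroup N₀] [InnerProductSpace ℂ N₀] (f : Γ → N₀) (T : Finset Γ)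
    (E : Finset (unitary M)) {ε : ℝ} (hε : 0 < ε) :
    ∃ (n : ℕ) (ζ : τ.CoarseMultiple (N₀ ⊗[ℂ] EuclideanSpace ℂ (Fin n))), ∀ x ∈ E,
      ‖∑ t ∈ T, ∑ r ∈ T, ⟪f t, f r⟫_ℂ *
          ((‖τ.expect hA.le (τ.toL2 ((u t⁻¹ : M) * x * (u r : M)))‖ ^ 2 : ℝ) : ℂ) -
        ⟪ζ, τ.coarseIso x ζ⟫_ℂ‖ < ε := by
  classical
  choose a ha using fun (t r : Γ) (x : unitary M) =>
    τ.exists_expect_eq hA.le ((u t⁻¹ : M) * x * (u r : M))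
  let C : ℝ := ∑ t ∈ T, ∑ r ∈ T, ‖f t‖ * ‖f r‖
  have hC : 0 ≤ C := Finset.sum_nonneg fun _ _ => Finset.sum_nonneg fun _ _ => by positivity
  let δ := ε / (C + 1)
  have hδ : 0 < δ := by positivity
  let E' : Finset A := (T ×ˢ T ×ˢ E).image fun p => a p.1 p.2.1 p.2.2
  obtain ⟨n, m, c, d, hcd⟩ := ham.exists_coarseVec E' hδ
  let e : Fin n → EuclideanSpace ℂ (Fin n) := fun i => EuclideanSpace.single i 1
  have he : ∀ i i', ⟪e i, e i'⟫_ℂ = if i' = i then 1 else 0 := fun i i' => by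
    rw [EuclideanSpace.inner_single_left, PiLp.single_apply]; simp [eq_comm]
  let w : Γ → Fin n → τ.CoarseMultiple (N₀ ⊗[ℂ] EuclideanSpace ℂ (Fin n)) := fun t i =>
    ∑ j, τ.coarseMk (τ.leftIso (u t) (τ.toL2 (inclusion hA.le (c i j))))
      (τ.rightIso (u t) (τ.toL2 (inclusion hA.le (d i j)))) (f t ⊗ₜ e i)
  have hw : ∀ t r x i i', ⟪w t i, τ.coarseIso x (w r i')⟫_ℂ = if i' = i then ⟪f t, f r⟫_ℂ *
      ⟪∑ j, (τ.restrict hA.le).coarseVec (c i j) (d i j), (τ.restrict hA.le).coarseConj (a t r x)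
        (∑ j, (τ.restrict hA.le).coarseVec (c i j) (d i j))⟫_ℂ else 0 := by
    intro t r x i i'
    simp only [w, map_sum, sum_inner, inner_sum, coarseIso_mk, inner_coarseMk,
      TensorProduct.inner_tmul]
    split_ifs with hi
    · subst hi
      simp only [coarseConj_coarseVec, inner_coarseVec, Finset.mul_sum]
      refine Finset.sum_congr rfl fun j _ => Finset.sum_congr rfl fun j' _ => ?_
      rw [hA.inner_conj (ha t r x)]
      rw [he, if_pos rfl, mul_one, mul_comm]
    · refine Finset.sum_eq_zero fun j _ => Finset.sum_eq_zero fun j' _ => ?_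
      rw [he, if_neg hi, mul_zero, mul_zero]
  have hkey : ∀ t ∈ T, ∀ r ∈ T, ∀ x ∈ E, ‖⟪f t, f r⟫_ℂ *
      ((‖τ.expect hA.le (τ.toL2 ((u t⁻¹ : M) * x * (u r : M)))‖ ^ 2 : ℝ) : ℂ) -
        ⟪∑ i, w t i, τ.coarseIso x (∑ i, w r i)⟫_ℂ‖ ≤ ‖f t‖ * ‖f r‖ * δ := by
    intro t ht r hr x hx
    have h1 := hcd (a t r x) (Finset.mem_image.mpr ⟨(t, r, x), by simp [ht, hr, hx], rfl⟩)
    have h2 : ‖τ.expect hA.le (τ.toL2 ((u t⁻¹ : M) * x * (u r : M)))‖ =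
        ‖(τ.restrict hA.le).toL2 (a t r x)‖ := by rw [ha, norm_restrict_toL2]
    rw [(τ.coarseIso x).inner_sum_map_sum_eq (hw t r x), ← Finset.mul_sum, h2, ← mul_sub, norm_mul]
    exact mul_le_mul (norm_inner_le_norm _ _) h1.le (norm_nonneg _) (by positivity)
  refine ⟨n, ∑ t ∈ T, ∑ i, w t i, fun x hx => ?_⟩
  rw [sum_inner, ← Finset.sum_sub_distrib]
  calc _ ≤ ∑ t ∈ T, ∑ r ∈ T, ‖f t‖ * ‖f r‖ * δ := by
        refine (norm_sum_le _ _).trans (Finset.sum_le_sum fun t ht => ?_)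
        rw [map_sum, inner_sum, ← Finset.sum_sub_distrib]
        exact (norm_sum_le _ _).trans (Finset.sum_le_sum fun r hr => hkey t ht r hr x hx)
    _ = C * δ := by simp only [C, Finset.sum_mul]
    _ < (C + 1) * δ := by gcongr; linarith
    _ = ε := by simp only [δ]; field_simp

end Approximation

end VonNeumannAlgebra.TracialState

/-! ### Amenability from representations with freely permuted blocks. -/

section AlmostInvariant

variable {G K : Type*} [Group G] [NormedAddCommGroup K] [InnerProductSpace ℂ K]

/-- A vector with uniformly non-small coefficients on a large ball of a group has an almost
invariant vector in the convex hull of its translates. -/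
theorem exists_almost_invariant [DecidableEq G] (π : G → K →ₗᵢ[ℂ] K)
    (hmul : ∀ g h ξ, π (g * h) ξ = π g (π h ξ)) (S : Finset G) (hS : 1 ∈ S) (f : K) {c : ℝ}
    (hc0 : 0 < c) {N : ℕ} (hN : 0 < N) (hc : ∀ g ∈ S ^ N, c ≤ (⟪f, π g f⟫_ℂ).re) :
    ∃ h : K, c ≤ (⟪f, h⟫_ℂ).re ∧ ∀ g ∈ S, ‖π g h - h‖ ^ 2 ≤ 8 * ‖f‖ ^ 2 / N := by
  -- The least squared norm on the hull of the S^n-translates falls from at most ‖f‖² to at least 0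
  -- in N steps, so some step drops by at most ‖f‖²/N.
  let C : ℕ → Set K := fun n => convexHull ℝ ((fun g => π g f) '' (S ^ n : Finset G))
  have hCmono : ∀ m n, m ≤ n → C m ⊆ C n := fun m n hmn =>
    convexHull_mono (Set.image_mono (Finset.coe_subset.mpr (Finset.pow_subset_pow_right hS hmn)))
  have hCπ : ∀ n, ∀ g ∈ S, ∀ x ∈ C n, π g x ∈ C (n + 1) := by
    intro n g hg x hx
    let L : K →ₗ[ℝ] K := (π g).toLinearMap.restrictScalars ℝ
    have h1 : L x ∈ L '' C n := ⟨x, hx, rfl⟩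
    rw [LinearMap.image_convexHull] at h1
    refine convexHull_mono ?_ h1
    rintro _ ⟨_, ⟨w, hw, rfl⟩, rfl⟩
    refine ⟨g * w, ?_, hmul g w f⟩
    rw [pow_succ']
    exact Finset.mul_mem_mul hg hw
  have hCc : ∀ x ∈ C N, c ≤ (⟪f, x⟫_ℂ).re := by
    have : C N ⊆ {x | c ≤ (⟪f, x⟫_ℂ).re} := by
      refine convexHull_min ?_ ?_
      · rintro _ ⟨w, hw, rfl⟩
        exact hc w hw
      · exact convex_halfSpace_ge (f := fun x => (⟪f, x⟫_ℂ).re)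
          ⟨fun x y => by simp, fun r x => by
            rw [← Complex.coe_smul, inner_smul_right]; simp⟩ c
    exact this
  have hne : ∀ n, (C n).Nonempty := fun n =>
    (Set.Nonempty.image _ ⟨1, Finset.mem_coe.mpr (Finset.one_mem_pow hS)⟩).convexHull
  let d : ℕ → ℝ := fun n => sInf ((fun x => ‖x‖ ^ 2) '' C n)
  have hbdd : ∀ n, BddBelow ((fun x => ‖x‖ ^ 2) '' C n) := fun n =>
    ⟨0, by rintro _ ⟨x, _, rfl⟩; positivity⟩
  have hd0 : d 0 ≤ ‖f‖ ^ 2 := by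
    refine csInf_le (hbdd 0) ⟨π 1 f, subset_convexHull _ _ ⟨1, by simp, rfl⟩, ?_⟩
    simp only [LinearIsometry.norm_map]
  have hdN : 0 ≤ d N := Real.sInf_nonneg (by rintro _ ⟨x, _, rfl⟩; positivity)
  have hNpos : (0 : ℝ) < N := Nat.cast_pos.mpr hN
  have hf0 : 0 < ‖f‖ ^ 2 := by
    have h1 := hCc _ (subset_convexHull _ _ ⟨1, Finset.mem_coe.mpr (Finset.one_mem_pow hS), rfl⟩)
    have h2 : f ≠ 0 := by
      rintro rfl
      rw [inner_zero_left] at h1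
      exact absurd h1 (not_le.mpr hc0)
    positivity
  obtain ⟨n, hnN, hn⟩ : ∃ n < N, d n - d (n + 1) ≤ ‖f‖ ^ 2 / N := by
    by_contra! hcon
    have h1 := Finset.sum_lt_sum_of_nonempty (s := Finset.range N) ⟨0, Finset.mem_range.mpr hN⟩
      fun n hn => hcon n (Finset.mem_range.mp hn)
    rw [Finset.sum_range_sub', Finset.sum_const, Finset.card_range, nsmul_eq_mul,
      mul_div_cancel₀ _ hNpos.ne'] at h1
    linarith
  obtain ⟨_, ⟨h, hh, rfl⟩, hlt⟩ := exists_lt_of_csInf_lt ((hne n).image fun x => ‖x‖ ^ 2)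
    (show d n < d n + ‖f‖ ^ 2 / N by linarith [div_pos hf0 hNpos])
  refine ⟨h, hCc h (hCmono n N hnN.le hh), fun g hg => ?_⟩
  -- A near-minimizer h at stage n and its translate have midpoint at stage n + 1. The parallelogram
  -- law gives ‖gh − h‖² = 4‖h‖² − 4‖midpoint‖²; the drop and the near-minimality contribute 4‖f‖²/N
  -- each, hence the 8.
  have hmid : (1 / 2 : ℝ) • h + (1 / 2 : ℝ) • π g h ∈ C (n + 1) :=
    convex_convexHull ℝ _ (hCmono n (n + 1) n.le_succ hh) (hCπ n g hg h hh) (by norm_num)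
      (by norm_num) (by norm_num)
  have h1 : d (n + 1) ≤ ‖(1 / 2 : ℝ) • h + (1 / 2 : ℝ) • π g h‖ ^ 2 :=
    csInf_le (hbdd _) ⟨_, hmid, rfl⟩
  rw [← smul_add, norm_smul, mul_pow] at h1
  have h2 := parallelogram_law_with_norm ℂ (π g h) h
  rw [LinearIsometry.norm_map] at h2
  rw [add_comm h] at h1
  norm_num at h1
  simp only at hlt
  have h3 : 8 * ‖f‖ ^ 2 / N = 8 * (‖f‖ ^ 2 / N) := by ring
  rw [h3]
  nlinarith

/-- Here ‖Q_t a‖² − ‖Q_t b‖² = Re⟨Q_t(a − b), a + b⟩, and any partial sum of the Q_t is a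
contraction. -/
theorem IsOrthPartition.abs_tsum_indicator_sub_le {T : Type*} {Q : T → K →L[ℂ] K}
    (hQ : IsOrthPartition Q) (X : Set T) (a b : K) :
    |∑' t, X.indicator (fun t => ‖Q t a‖ ^ 2) t - ∑' t, X.indicator (fun t => ‖Q t b‖ ^ 2) t| ≤
      ‖a - b‖ * ‖a + b‖ := by
  classical
  have hs := fun a => ((hQ.hasSum_norm_sq a).summable.indicator X)
  rw [← (hs a).tsum_sub (hs b)]
  refine le_of_tendsto' ((hs a).sub (hs b)).hasSum.abs fun F => ?_
  have h1 : ∀ t, ‖Q t a‖ ^ 2 - ‖Q t b‖ ^ 2 = (⟪Q t (a - b), a + b⟫_ℂ).re := by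
    intro t
    rw [← hQ.idem t (a - b), hQ.symm, map_sub, map_add, inner_sub_left, inner_add_right,
      inner_add_right, ← inner_conj_symm (Q t b) (Q t a), inner_self_eq_norm_sq_to_K,
      inner_self_eq_norm_sq_to_K]
    simp only [Complex.sub_re, Complex.add_re, Complex.conj_re, Complex.coe_algebraMap]
    norm_cast
    ring
  have h2 : ∑ t ∈ F, (X.indicator (fun t => ‖Q t a‖ ^ 2) t -
      X.indicator (fun t => ‖Q t b‖ ^ 2) t) =
        (⟪∑ t ∈ F with t ∈ X, Q t (a - b), a + b⟫_ℂ).re := by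
    rw [sum_inner, Complex.re_sum, Finset.sum_filter]
    refine Finset.sum_congr rfl fun t _ => ?_
    by_cases ht : t ∈ X
    · simp only [Set.indicator_of_mem ht, if_pos ht, h1]
    · simp only [Set.indicator_of_notMem ht, if_neg ht, sub_zero]
  rw [h2]
  exact (Complex.abs_re_le_norm _).trans ((norm_inner_le_norm _ _).trans
    (mul_le_mul_of_nonneg_right (IsOrthPartition.norm_sum_le hQ.symm hQ.idem hQ.orth _ _)
      (norm_nonneg _)))

end AlmostInvariant

/-- An ultralimit over pairs (finite set, tolerance 1/(n+1)) is exactly invariant; finite additivity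
survives pointwise limits. -/
theorem isAmenableGroup_of_almost_invariant_means {G : Type v} [Group G]
    (h : ∀ (S : Finset G) (η : ℝ), 0 < η → ∃ m : Set G → ℝ, (∀ X, 0 ≤ m X) ∧ m Set.univ = 1 ∧
      (∀ X Y, Disjoint X Y → m (X ∪ Y) = m X + m Y) ∧ ∀ g ∈ S, ∀ X, |m (g • X) - m X| ≤ η) :
    IsAmenableGroup G := by
  classical
  choose m h0 h1 hadd hinv using fun i : Finset G × ℕ =>
    h i.1 (1 / ((i.2 : ℝ) + 1)) (by positivity)
  have hle : ∀ i X, m i X ≤ 1 := by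
    intro i X
    have := hadd i X Xᶜ disjoint_compl_right
    rw [Set.union_compl_self, h1] at this
    linarith [h0 i Xᶜ]
  let 𝒰 : Ultrafilter (Finset G × ℕ) := Ultrafilter.of atTop
  have h𝒰 : (𝒰 : Filter (Finset G × ℕ)) ≤ atTop := Ultrafilter.of_le _
  have hlim : ∀ X, ∃ l ∈ Set.Icc (0 : ℝ) 1, Tendsto (fun i => m i X) 𝒰 (𝓝 l) := fun X =>
    isCompact_Icc.ultrafilter_le_nhds (𝒰.map fun i => m i X)
      (Filter.le_principal_iff.mpr (Filter.mem_map.mpr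
        (Filter.univ_mem' fun i => ⟨h0 i X, hle i X⟩)))
  choose μ hμ hμt using hlim
  refine ⟨μ, fun X => (hμ X).1, ?_, fun X Y hXY => ?_, fun g X => ?_⟩
  · exact tendsto_nhds_unique (hμt _) (by simpa only [h1] using tendsto_const_nhds)
  · exact tendsto_nhds_unique (hμt _)
      (((hμt X).add (hμt Y)).congr fun i => (hadd i X Y hXY).symm)
  · rw [← sub_eq_zero]
    refine tendsto_nhds_unique ((hμt (g • X)).sub (hμt X)) ?_
    have h2 : Tendsto (fun i : Finset G × ℕ => 1 / ((i.2 : ℝ) + 1)) 𝒰 (𝓝 0) :=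
      (tendsto_one_div_add_atTop_nhds_zero_nat.comp
        (tendsto_snd.mono_left prod_atTop_atTop_eq.ge)).mono_left h𝒰
    refine squeeze_zero_norm' ?_ h2
    have h3 : ∀ᶠ i : Finset G × ℕ in 𝒰, ({g}, 0) ≤ i := h𝒰 (eventually_ge_atTop _)
    filter_upwards [h3] with i hi
    exact hinv i g (hi.1 (Finset.mem_singleton_self g)) X

/-- Left translation makes Γ a free Γ₀-set, trivialized by a choice of representatives of the cosets
Γ₀t. The map pushes measures on Γ to Γ₀. -/
theorem Subgroup.exists_equivariant_map {Γ : Type*} [Group Γ] (Γ₀ : Subgroup Γ) :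
    ∃ ρ : Γ → Γ₀, ∀ (g : Γ₀) t, ρ (g * t) = g * ρ t := by
  let r : Γ → Γ := fun t => (Quotient.mk (QuotientGroup.rightRel Γ₀) t).out
  have hr : ∀ t, t * (r t)⁻¹ ∈ Γ₀ := fun t =>
    QuotientGroup.rightRel_apply.mp (Quotient.mk_out (s := QuotientGroup.rightRel Γ₀) t)
  refine ⟨fun t => ⟨t * (r t)⁻¹, hr t⟩, fun g t => Subtype.ext ?_⟩
  have h1 : r (g * t) = r t := by
    have : (Quotient.mk (QuotientGroup.rightRel Γ₀) (g * t)) =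
        Quotient.mk (QuotientGroup.rightRel Γ₀) t := by
      refine Quotient.sound (QuotientGroup.rightRel_apply.mpr ?_)
      simp
    simp only [r, this]
  simp only [h1, Subgroup.coe_mul, mul_assoc]

/-- A group with isometric representations that are induced from the trivial group and have
uniformly non-small coefficients on arbitrary finite sets is amenable. -/
theorem Subgroup.isAmenableGroup_of_partition {Γ : Type v} [Group Γ] (Γ₀ : Subgroup Γ) {c C : ℝ}
    (hc : 0 < c) (h : ∀ S : Finset Γ₀, ∃ (K : Type w) (_ : NormedAddCommGroup K)
      (_ : InnerProductSpace ℂ K) (π : Γ₀ → K →ₗᵢ[ℂ] K) (Q : Γ → K →L[ℂ] K) (f : K),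
      (∀ g h ξ, π (g * h) ξ = π g (π h ξ)) ∧ (∀ ξ, π 1 ξ = ξ) ∧ IsOrthPartition Q ∧
      (∀ (g : Γ₀) t ξ, π g (Q t ξ) = Q (g * t) (π g ξ)) ∧ ‖f‖ ^ 2 ≤ C ∧
      ∀ g ∈ S, c ≤ (⟪f, π g f⟫_ℂ).re) : IsAmenableGroup Γ₀ := by
  classical
  obtain ⟨ρ, hρ⟩ := Γ₀.exists_equivariant_map
  refine isAmenableGroup_of_almost_invariant_means fun S η hη => ?_
  -- The invariance error is at most 8C/(N+1), while ⟨f, ξ⟩ ≥ c forces ‖ξ‖² ≥ c²/C. The choice of N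
  -- makes 2‖π_g ξ − ξ‖ ≤ η‖ξ‖.
  obtain ⟨N, hN⟩ := exists_nat_gt (8 * C * C * 4 / (c ^ 2 * η ^ 2))
  have hN1 : (8 * C * C * 4 / (c ^ 2 * η ^ 2)) < (N + 1 : ℕ) := hN.trans (by simp)
  obtain ⟨K, _, _, π, Q, f, hmul, hone, hQ, hcov, hfC, hf⟩ := h ((insert 1 S) ^ (N + 1))
  obtain ⟨ξ, hξ, hinv⟩ := exists_almost_invariant π hmul (insert 1 S)
    (Finset.mem_insert_self _ _) f hc N.succ_pos hf
  have hξ1 : c ≤ ‖f‖ * ‖ξ‖ :=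
    hξ.trans ((Complex.re_le_norm _).trans (norm_inner_le_norm _ _))
  have hξ0 : 0 < ‖ξ‖ := by
    rcases (norm_nonneg ξ).eq_or_lt with h0 | h0
    · rw [← h0, mul_zero] at hξ1; linarith
    · exact h0
  have hclose : ∀ g ∈ S, 2 * ‖π g ξ - ξ‖ ≤ η * ‖ξ‖ := by
    intro g hg
    refine le_of_sq_le_sq ?_ (by positivity)
    have h1 := hinv g (Finset.mem_insert_of_mem hg)
    have h2 : c ^ 2 ≤ C * ‖ξ‖ ^ 2 := by
      calc c ^ 2 ≤ (‖f‖ * ‖ξ‖) ^ 2 := by gcongr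
        _ = ‖f‖ ^ 2 * ‖ξ‖ ^ 2 := mul_pow _ _ _
        _ ≤ C * ‖ξ‖ ^ 2 := by gcongr
    have hC0 : 0 ≤ C := (sq_nonneg _).trans hfC
    have hNp : (0 : ℝ) < (N + 1 : ℕ) := Nat.cast_pos.mpr N.succ_pos
    rw [div_lt_iff₀ (by positivity)] at hN1
    rw [le_div_iff₀ hNp] at h1
    have h3 : ‖π g ξ - ξ‖ ^ 2 * (N + 1 : ℕ) ≤ 8 * C := h1.trans (by linarith)
    have h4 : ‖π g ξ - ξ‖ ^ 2 * ((N + 1 : ℕ) * c ^ 2) ≤ 8 * C * (C * ‖ξ‖ ^ 2) := by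
      rw [← mul_assoc]
      exact mul_le_mul h3 h2 (by positivity) (by positivity)
    have h5 : 8 * C * (C * ‖ξ‖ ^ 2) * 4 ≤ (N + 1 : ℕ) * (c ^ 2 * η ^ 2) * ‖ξ‖ ^ 2 := by
      have := mul_le_mul_of_nonneg_right hN1.le (sq_nonneg ‖ξ‖)
      linarith
    have h6 : (0 : ℝ) < (N + 1 : ℕ) * c ^ 2 := by positivity
    refine le_of_mul_le_mul_right (a := (N + 1 : ℕ) * c ^ 2) ?_ h6
    nlinarith
  -- The probability measure t ↦ ‖Q_t ξ‖²/‖ξ‖² on Γ, pushed forward to Γ₀.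
  let m : Set Γ₀ → ℝ := fun X => (∑' t, (ρ ⁻¹' X).indicator (fun t => ‖Q t ξ‖ ^ 2) t) / ‖ξ‖ ^ 2
  have hsum := hQ.hasSum_norm_sq ξ
  refine ⟨m, fun X => ?_, ?_, fun X Y hXY => ?_, fun g hg X => ?_⟩
  · exact div_nonneg (tsum_nonneg fun t => Set.indicator_nonneg (fun _ _ => by positivity) _)
      (by positivity)
  · simp only [m, Set.preimage_univ, Set.indicator_univ]
    rw [hsum.tsum_eq, div_self (by positivity)]
  · simp only [m]
    rw [← add_div, ← (hsum.summable.indicator _).tsum_add (hsum.summable.indicator _),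
      Set.preimage_union]
    congr 2
    funext t
    rw [Set.indicator_union_of_disjoint (hXY.preimage ρ)]
  · have hinvπ : ∀ ζ, π g (π g⁻¹ ζ) = ζ := fun ζ => by rw [← hmul, mul_inv_cancel, hone]
    have h1 : ∑' t, (ρ ⁻¹' (g • X)).indicator (fun t => ‖Q t ξ‖ ^ 2) t =
        ∑' t, (ρ ⁻¹' X).indicator (fun t => ‖Q t (π g⁻¹ ξ)‖ ^ 2) t := by
      rw [← (Equiv.mulLeft (g : Γ)).tsum_eq]
      refine tsum_congr fun t => ?_
      have h2 : ‖Q (g * t) ξ‖ = ‖Q t (π g⁻¹ ξ)‖ := by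
        conv_lhs => rw [← hinvπ ξ, ← hcov, LinearIsometry.norm_map]
      have h3 : (g : Γ) * t ∈ ρ ⁻¹' (g • X) ↔ t ∈ ρ ⁻¹' X := by
        rw [Set.mem_preimage, hρ, ← smul_eq_mul, Set.smul_mem_smul_set_iff, Set.mem_preimage]
      by_cases ht : t ∈ ρ ⁻¹' X
      · rw [Equiv.coe_mulLeft, Set.indicator_of_mem (h3.mpr ht), Set.indicator_of_mem ht, h2]
      · rw [Equiv.coe_mulLeft, Set.indicator_of_notMem (fun h => ht (h3.mp h)),
          Set.indicator_of_notMem ht]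
    have h4 := hQ.abs_tsum_indicator_sub_le (ρ ⁻¹' X) (π g⁻¹ ξ) ξ
    have h5 : ‖π g⁻¹ ξ - ξ‖ = ‖π g ξ - ξ‖ := by
      rw [← (π g).norm_map (π g⁻¹ ξ - ξ), map_sub, hinvπ, norm_sub_rev]
    have h6 : ‖π g⁻¹ ξ + ξ‖ ≤ 2 * ‖ξ‖ := by
      refine (norm_add_le _ _).trans ?_
      rw [LinearIsometry.norm_map]; linarith
    simp only [m]
    rw [h1, ← sub_div, abs_div, abs_of_pos (show 0 < ‖ξ‖ ^ 2 by positivity),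
      div_le_iff₀ (by positivity)]
    refine h4.trans ?_
    rw [h5]
    have := hclose g hg
    calc ‖π g ξ - ξ‖ * ‖π g⁻¹ ξ + ξ‖ ≤ ‖π g ξ - ξ‖ * (2 * ‖ξ‖) := by gcongr
      _ = (2 * ‖π g ξ - ξ‖) * ‖ξ‖ := by ring
      _ ≤ η * ‖ξ‖ * ‖ξ‖ := by gcongr
      _ = η * ‖ξ‖ ^ 2 := by ring

/-! ### Combination of the two amenability arguments, and the conclusion. -/

/-- The vectors Q_t ζ and π_s Q_r ζ lie in the blocks t and sr, so only s = tr⁻¹ contributes. When p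
s is the squared norm of block s of u_g, the right side is the kernel treated by
`exists_coarse_vector` for B. -/
theorem IsOrthPartition.hasSum_mul_inner {Λ K : Type*} [Group Λ] [NormedAddCommGroup K]
    [InnerProductSpace ℂ K] {Q : Λ → K →L[ℂ] K} (hQ : IsOrthPartition Q) (π : Λ → K →ₗᵢ[ℂ] K)
    (hmul : ∀ g h ξ, π (g * h) ξ = π g (π h ξ)) (hone : ∀ ξ, π 1 ξ = ξ)
    (hcov : ∀ g t ξ, π g (Q t ξ) = Q (g * t) (π g ξ)) (ζ : K) (T : Finset Λ) (p : Λ → ℂ) :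
    HasSum (fun s => p s * ⟪∑ t ∈ T, Q t ζ, π s (∑ t ∈ T, Q t ζ)⟫_ℂ)
      (∑ t ∈ T, ∑ r ∈ T, ⟪π t⁻¹ (Q t ζ), π r⁻¹ (Q r ζ)⟫_ℂ * p (t * r⁻¹)) := by
  classical
  have h1 : ∀ t r s, ⟪Q t ζ, π s (Q r ζ)⟫_ℂ =
      if s = t * r⁻¹ then ⟪π t⁻¹ (Q t ζ), π r⁻¹ (Q r ζ)⟫_ℂ else 0 := by
    intro t r s
    split_ifs with hs
    · rw [hs, hmul, ← (π t).inner_map_map (π t⁻¹ (Q t ζ)), ← hmul t t⁻¹, mul_inv_cancel, hone]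
    · rw [hcov, hQ.symm, hQ.orth _ _ _ fun h => hs (eq_mul_inv_of_mul_eq h.symm), inner_zero_right]
  have h2 : ∀ s, p s * ⟪∑ t ∈ T, Q t ζ, π s (∑ t ∈ T, Q t ζ)⟫_ℂ = ∑ t ∈ T, ∑ r ∈ T,
      if s = t * r⁻¹ then ⟪π t⁻¹ (Q t ζ), π r⁻¹ (Q r ζ)⟫_ℂ * p (t * r⁻¹) else 0 := by
    intro s
    rw [map_sum, sum_inner, Finset.mul_sum]
    refine Finset.sum_congr rfl fun t _ => ?_
    rw [inner_sum, Finset.mul_sum]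
    refine Finset.sum_congr rfl fun r _ => ?_
    rw [h1]
    split_ifs with hs
    · rw [hs, mul_comm]
    · rw [mul_zero]
  simp only [h2]
  exact hasSum_sum fun t _ => hasSum_sum fun r _ => hasSum_ite_eq _ _

/-- Summation of the pointwise bound p b ≥ D p 1_V − ε p − (C + D) p 1_{Eᶜ}; off E the last term
absorbs both −C and D. -/
theorem le_of_hasSum_weighted {Λ : Type*} {p b : Λ → ℝ} {V : Set Λ} {E : Finset Λ}
    {G C D κ ε : ℝ} (hp : ∀ s, 0 ≤ p s) (hp1 : HasSum p 1) (hV : 1 / 2 ≤ ∑' s, V.indicator p s)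
    (hE : 1 - κ ≤ ∑ s ∈ E, p s) (hD : 0 ≤ D) (hC : 0 ≤ C) (hε : 0 ≤ ε) (hbC : ∀ s, -C ≤ b s)
    (hb : ∀ s ∈ E, -ε ≤ b s) (hbV : ∀ s ∈ E, s ∈ V → D - ε ≤ b s)
    (hG : HasSum (fun s => p s * b s) G) : D / 2 - ε - (C + D) * κ ≤ G := by
  classical
  have h1 : HasSum (fun s => if s ∈ E then p s else 0) (∑ s ∈ E, p s) := by
    have : HasSum (fun s => if s ∈ E then p s else 0) (∑ s ∈ E, if s ∈ E then p s else 0) :=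
      hasSum_sum_of_ne_finset_zero fun s hs => if_neg hs
    rwa [Finset.sum_congr rfl fun s hs => if_pos hs] at this
  have h2 := (((hp1.summable.indicator V).hasSum.mul_left D).sub (hp1.mul_left ε)).sub
    ((hp1.sub h1).mul_left (C + D))
  have h3 := hasSum_le (fun s => ?_) h2 hG
  · nlinarith
  · by_cases hsE : s ∈ E
    · by_cases hsV : s ∈ V
      · rw [Set.indicator_of_mem hsV, if_pos hsE]
        nlinarith [hbV s hsE hsV, hp s]
      · rw [Set.indicator_of_notMem hsV, if_pos hsE]
        nlinarith [hb s hsE, hp s]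
    · rw [if_neg hsE]
      have h4 : V.indicator p s ≤ p s := Set.indicator_le_self' (fun _ _ => hp s) s
      nlinarith [hbC s, hp s, mul_nonneg hε (hp s)]

namespace VonNeumannAlgebra.TracialState

variable {H : Type u} [NormedAddCommGroup H] [InnerProductSpace ℂ H] [CompleteSpace H]
  {A B M : VonNeumannAlgebra H} {τ : M.TracialState} {Γ : Type v} [Group Γ] {Λ : Type w} [Group Λ]
  {u : Γ →* unitary M} {v : Λ →* unitary M}

theorem IsCrossedProduct.isAmenableGroup_of_fourierCoeff_le (hA : τ.IsCrossedProduct A u)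
    (hB : τ.IsCrossedProduct B v) (hAam : (τ.restrict hA.le).IsAmenable)
    (hBam : (τ.restrict hB.le).IsAmenable) (Γ₀ : Subgroup Γ) (V : Set Λ)
    (hV : ∀ g ∈ Γ₀, 1 / 2 ≤ ∑' s, V.indicator (fun s => ‖hB.proj s (τ.toL2 (u g : M))‖ ^ 2) s)
    (F : Finset Γ) {δ : ℝ} (hδ : 0 < δ)
    (hF : ∀ s ∈ V, ∃ g ∈ F, δ ≤ ‖hA.proj g (τ.toL2 (v s : M))‖) : IsAmenableGroup Γ₀ := by
  classical
  -- With 1 in F', the pair (g, 1) contributes ‖P_g v_s‖², where P_g now projects onto u_g L²(A); so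
  -- ψ ≥ δ² on V.
  let F' := insert 1 F
  let ψ : Λ → ℝ := fun s => ∑ t ∈ F', ∑ r ∈ F', ‖hA.proj (t * r⁻¹) (τ.toL2 (v s : M))‖ ^ 2
  have hψ0 : ∀ s, 0 ≤ ψ s := fun s =>
    Finset.sum_nonneg fun _ _ => Finset.sum_nonneg fun _ _ => by positivity
  set D : ℝ := δ ^ 2
  have hD : 0 < D := by positivity
  have hψV : ∀ s ∈ V, D ≤ ψ s := by
    intro s hs
    obtain ⟨g, hg, hgs⟩ := hF s hs
    have h1 : ‖hA.proj (g * 1⁻¹) (τ.toL2 (v s : M))‖ ^ 2 ≤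
        ∑ r ∈ F', ‖hA.proj (g * r⁻¹) (τ.toL2 (v s : M))‖ ^ 2 :=
      Finset.single_le_sum (f := fun r => ‖hA.proj (g * r⁻¹) (τ.toL2 (v s : M))‖ ^ 2)
        (fun _ _ => by positivity) (Finset.mem_insert_self _ _)
    have h2 : ∑ r ∈ F', ‖hA.proj (g * r⁻¹) (τ.toL2 (v s : M))‖ ^ 2 ≤ ψ s :=
      Finset.single_le_sum
        (f := fun t => ∑ r ∈ F', ‖hA.proj (t * r⁻¹) (τ.toL2 (v s : M))‖ ^ 2)
        (fun _ _ => Finset.sum_nonneg fun _ _ => by positivity) (Finset.mem_insert_of_mem hg)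
    rw [inv_one, mul_one] at h1
    exact (pow_le_pow_left₀ hδ.le hgs 2).trans (h1.trans h2)
  set C : ℝ := ψ 1 + D
  have hC : 0 < C := by have := hψ0 1; positivity
  -- Half of the mass lies in V, which gives D/2. Approximating ψ by ζ, cutting ζ off, neglecting
  -- the complement of E and passing to ζ' cost D/16 each, leaving D/4.
  refine Γ₀.isAmenableGroup_of_partition (c := D / 4) (C := C + D) (by positivity) fun S => ?_
  let κ : ℝ := D / 16 / (C + D)
  have hκ : 0 < κ := by positivity
  let p : Γ → Λ → ℝ := fun g s => ‖hB.proj s (τ.toL2 (u g : M))‖ ^ 2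
  have hp1 : ∀ g, HasSum (p g) 1 := fun g => hB.hasSum_norm_proj_sq (u g)
  -- The first approximation holds only on a finite E, which must carry almost all the mass of u_g
  -- for g ∈ S; 1 ∈ E is there to bound ‖ζ‖².
  obtain ⟨E, hE1, hE⟩ : ∃ E : Finset Λ, 1 ∈ E ∧ ∀ g ∈ S, 1 - κ ≤ ∑ s ∈ E, p g s := by
    have h1 : ∀ g ∈ S, ∀ᶠ E : Finset Λ in atTop, 1 - κ ≤ ∑ s ∈ E, p g s := fun g _ =>
      (Tendsto.eventually_const_le (by linarith) (hp1 g))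
    obtain ⟨E, h2, h3⟩ := ((eventually_ge_atTop {1}).and
      ((Filter.eventually_all_finset S).mpr h1)).exists
    exact ⟨E, h2 (Finset.mem_singleton_self 1), h3⟩
  obtain ⟨n, ζ, hζ⟩ := hA.exists_coarse_vector hAam (fun _ => (1 : ℂ)) F' (E.image v)
    (show 0 < D / 16 by positivity)
  have hζE : ∀ s ∈ E, |ψ s - (⟪ζ, τ.coarseIso (v s) ζ⟫_ℂ).re| < D / 16 := by
    intro s hs
    have h1 := (Complex.abs_re_le_norm _).trans_lt (hζ (v s) (Finset.mem_image_of_mem _ hs))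
    have h2 : (∑ t ∈ F', ∑ r ∈ F', ⟪(1 : ℂ), 1⟫_ℂ * ((‖τ.expect hA.le
        (τ.toL2 ((u t⁻¹ : M) * (v s : M) * (u r : M)))‖ ^ 2 : ℝ) : ℂ)) = ((ψ s : ℝ) : ℂ) := by
      simp only [ψ, Complex.ofReal_sum]
      refine Finset.sum_congr rfl fun t _ => Finset.sum_congr rfl fun r _ => ?_
      rw [hA.norm_expect_star_mul_mul]
      simp
    rwa [h2, Complex.sub_re, Complex.ofReal_re] at h1
  have hζC : ‖ζ‖ ^ 2 ≤ C := by
    have h1 := hζE 1 hE1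
    rw [_root_.map_one, coarseIso_one, inner_self_eq_norm_sq_to_K] at h1
    have h2 : (((‖ζ‖ : ℝ) : ℂ) ^ 2).re = ‖ζ‖ ^ 2 := by norm_cast
    have h3 : |ψ 1 - ‖ζ‖ ^ 2| < D / 16 := by rw [← h2]; exact h1
    have := (abs_lt.mp h3).1
    simp only [C]; linarith
  set Q := hB.coarseProj (ℂ ⊗[ℂ] EuclideanSpace ℂ (Fin n))
  have hQ : IsOrthPartition Q := hB.isOrthPartition_coarseProj
  let π : Λ → τ.CoarseMultiple (ℂ ⊗[ℂ] EuclideanSpace ℂ (Fin n)) →ₗᵢ[ℂ] _ :=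
    fun s => τ.coarseIso (v s)
  have hπmul : ∀ g h ξ, π (g * h) ξ = π g (π h ξ) := fun g h ξ => by
    simp only [π, _root_.map_mul, coarseIso_mul]
  have hπone : ∀ ξ, π 1 ξ = ξ := fun ξ => by simp only [π, _root_.map_one, coarseIso_one]
  have hπcov : ∀ g t ξ, π g (Q t ξ) = Q (g * t) (π g ξ) := fun g t ξ => hB.coarseIso_coarseProj g t ξ
  -- Cutting ζ down to finitely many Λ-blocks changes the coefficients uniformly in s and reduces
  -- the weighted sum over Λ to a finite double sum.
  obtain ⟨T, hT⟩ : ∃ T : Finset Λ, ‖∑ t ∈ T, Q t ζ - ζ‖ < D / 16 / (2 * (‖ζ‖ + 1)) := by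
    have h1 := Metric.tendsto_nhds.mp (hQ.hasSum ζ) (D / 16 / (2 * (‖ζ‖ + 1))) (by positivity)
    obtain ⟨T, hT⟩ := h1.exists
    exact ⟨T, by rwa [dist_eq_norm] at hT⟩
  set ζT := ∑ t ∈ T, Q t ζ with hζT
  have hζTn : ‖ζT‖ ≤ ‖ζ‖ := IsOrthPartition.norm_sum_le hQ.symm hQ.idem hQ.orth T ζ
  have hclose : ∀ s, |(⟪ζT, π s ζT⟫_ℂ).re - (⟪ζ, π s ζ⟫_ℂ).re| ≤ D / 16 := by
    intro s
    rw [← Complex.sub_re]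
    have h1 : ⟪ζT, π s ζT⟫_ℂ - ⟪ζ, π s ζ⟫_ℂ = ⟪ζT - ζ, π s ζT⟫_ℂ + ⟪ζ, π s (ζT - ζ)⟫_ℂ := by
      rw [map_sub, inner_sub_left, inner_sub_right]; ring
    have h2 : ‖⟪ζT - ζ, π s ζT⟫_ℂ‖ ≤ ‖ζT - ζ‖ * ‖ζ‖ := by
      refine (norm_inner_le_norm _ _).trans ?_
      rw [LinearIsometry.norm_map]; gcongr
    have h3 : ‖⟪ζ, π s (ζT - ζ)⟫_ℂ‖ ≤ ‖ζ‖ * ‖ζT - ζ‖ := by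
      refine (norm_inner_le_norm _ _).trans ?_
      rw [LinearIsometry.norm_map]
    rw [lt_div_iff₀ (by positivity)] at hT
    refine (Complex.abs_re_le_norm _).trans ?_
    rw [h1]
    refine (norm_add_le _ _).trans ?_
    nlinarith [norm_nonneg (ζT - ζ)]
  have hbC : ∀ s, |(⟪ζT, π s ζT⟫_ℂ).re| ≤ C := by
    intro s
    refine (Complex.abs_re_le_norm _).trans ((norm_inner_le_norm _ _).trans ?_)
    rw [LinearIsometry.norm_map]
    nlinarith [norm_nonneg ζT]
  -- The auxiliary space is the first coarse multiple itself, with the vectors π_{t⁻¹}Q_t ζ as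
  -- weights. The identity is added to the finite set to bound ‖ζ'‖².
  obtain ⟨n', ζ', hζ'⟩ := hB.exists_coarse_vector hBam (fun t => π t⁻¹ (Q t ζ)) T
    (insert 1 (S.image fun g : Γ₀ => u g)) (show 0 < D / 16 by positivity)
  have hsum : ∀ g : Γ, HasSum (fun s => p g s * (⟪ζT, π s ζT⟫_ℂ).re)
      (∑ t ∈ T, ∑ r ∈ T, ⟪π t⁻¹ (Q t ζ), π r⁻¹ (Q r ζ)⟫_ℂ *
        ((‖τ.expect hB.le (τ.toL2 ((v t⁻¹ : M) * (u g : M) * (v r : M)))‖ ^ 2 : ℝ) : ℂ)).re := by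
    intro g
    have h1 := Complex.hasSum_re
      (hQ.hasSum_mul_inner π hπmul hπone hπcov ζ T fun s => ((p g s : ℝ) : ℂ))
    simp only [Complex.re_ofReal_mul] at h1
    simp only [hB.norm_expect_star_mul_mul]
    exact h1
  have hζ'g : ∀ g : Γ, u g ∈ insert 1 (S.image fun g : Γ₀ => u g) →
      |(∑ t ∈ T, ∑ r ∈ T, ⟪π t⁻¹ (Q t ζ), π r⁻¹ (Q r ζ)⟫_ℂ *
        ((‖τ.expect hB.le (τ.toL2 ((v t⁻¹ : M) * (u g : M) * (v r : M)))‖ ^ 2 : ℝ) : ℂ)).re -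
        (⟪ζ', τ.coarseIso (u g) ζ'⟫_ℂ).re| < D / 16 := by
    intro g hg
    rw [← Complex.sub_re]
    exact (Complex.abs_re_le_norm _).trans_lt (hζ' (u g) hg)
  refine ⟨_, _, _, fun g => τ.coarseIso (u g), hA.coarseProj _, ζ', fun g h ξ => ?_, fun ξ => ?_,
    hA.isOrthPartition_coarseProj, fun g t ξ => hA.coarseIso_coarseProj g t ξ, ?_, fun g hg => ?_⟩
  · change τ.coarseIso (u ((g * h : Γ₀) : Γ)) ξ = _
    rw [Subgroup.coe_mul, _root_.map_mul, coarseIso_mul]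
  · change τ.coarseIso (u ((1 : Γ₀) : Γ)) ξ = _
    rw [OneMemClass.coe_one, _root_.map_one, coarseIso_one]
  · have h1 := hζ'g 1 (by rw [_root_.map_one]; exact Finset.mem_insert_self _ _)
    have h2 := hasSum_le (fun s => mul_le_mul_of_nonneg_left ((le_abs_self _).trans (hbC s))
      (show 0 ≤ p 1 s by positivity)) (hsum 1) ((hp1 1).mul_right C)
    rw [one_mul] at h2
    rw [_root_.map_one, coarseIso_one, inner_self_eq_norm_sq_to_K] at h1
    have h3 : (((‖ζ'‖ : ℝ) : ℂ) ^ 2).re = ‖ζ'‖ ^ 2 := by norm_cast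
    have h4 := (abs_lt.mp h1).1
    change _ < _ - (((‖ζ'‖ : ℝ) : ℂ) ^ 2).re at h4
    rw [h3] at h4
    rw [_root_.map_one] at h2
    linarith
  · have h1 := hζ'g g (Finset.mem_insert_of_mem (Finset.mem_image_of_mem _ hg))
    have h2 := le_of_hasSum_weighted (ε := D / 8) (C := C) (D := D) (κ := κ) (V := V) (E := E)
      (fun s => by positivity) (hp1 g) (hV g g.2) (hE g hg) hD.le hC.le (by positivity)
      (fun s => (abs_le.mp (hbC s)).1) (fun s hs => ?_) (fun s hs hsV => ?_) (hsum g)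
    · have h3 : (C + D) * κ = D / 16 := by simp only [κ]; field_simp
      have h4 := (abs_lt.mp h1).2
      linarith
    · have h5 := (abs_lt.mp (hζE s hs)).2
      have h6 := (abs_le.mp (hclose s)).1
      have := hψ0 s
      simp only [π] at h6 ⊢
      linarith
    · have h5 := (abs_lt.mp (hζE s hs)).2
      have h6 := (abs_le.mp (hclose s)).1
      have := hψV s hsV
      simp only [π] at h6 ⊢
      linarith

end VonNeumannAlgebra.TracialState

theorem exists_seq_of_forall_finset {Γ : Type v} {Λ : Type w} [Nonempty Γ] [Countable Γ]
    {V : Set Λ} {c : Λ → Γ → ℝ} (hc : ∀ s g, 0 ≤ c s g)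
    (h : ∀ (F : Finset Γ) (δ : ℝ), 0 < δ → ∃ s ∈ V, ∀ g ∈ F, c s g < δ) :
    ∃ s : ℕ → Λ, (∀ k, s k ∈ V) ∧ ∀ g, Tendsto (fun k => c (s k) g) atTop (𝓝 0) := by
  classical
  obtain ⟨e, he⟩ := exists_surjective_nat Γ
  choose s hsV hs using fun k : ℕ =>
    h ((Finset.range (k + 1)).image e) (1 / ((k : ℝ) + 1)) (by positivity)
  refine ⟨s, hsV, fun g => ?_⟩
  obtain ⟨j, rfl⟩ := he g
  refine squeeze_zero' (Eventually.of_forall fun k => hc _ _) ?_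
    tendsto_one_div_add_atTop_nhds_zero_nat
  filter_upwards [eventually_ge_atTop j] with k hk
  exact (hs k _ (Finset.mem_image_of_mem _ (Finset.mem_range.mpr (by omega)))).le

theorem mainTheorem4 {H : Type u} [NormedAddCommGroup H] [InnerProductSpace ℂ H] [CompleteSpace H]
    (M : VonNeumannAlgebra H) (τ : M.TracialState) (hM : M.IsTypeIIOneFactor τ)
    {Γ : Type v} [Group Γ] [Countable Γ] {Λ : Type w} [Group Λ] [Countable Λ]
    (A B : VonNeumannAlgebra H) (u : Γ →* unitary M) (v : Λ →* unitary M)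
    (hA : τ.IsCrossedProduct A u) (hB : τ.IsCrossedProduct B v)
    (hAam : (τ.restrict hA.le).IsAmenable) (hBam : (τ.restrict hB.le).IsAmenable)
    (hΓ : ∃ Γ₀ : Subgroup Γ, ¬ IsAmenableGroup Γ₀ ∧ HasRelativePropertyT Γ₀)
    (φ : ℕ → CompletelyPositiveMap M M) (hφ : τ.IsDeformationOfIdentity φ)
    (ε : ℝ) (hε : 0 < ε) :
    ∃ (n : ℕ) (s : ℕ → Λ),
      (∀ k, τ.norm₂ (φ n (v (s k) : M) - (v (s k) : M)) < ε) ∧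
      ∀ g : Γ, Filter.Tendsto (fun k => ‖τ.fourierCoeff hA.le u (v (s k) : M) g‖)
        Filter.atTop (nhds 0) := by
  obtain ⟨Γ₀, hΓ₀, hT⟩ := hΓ
  have hpd := fun n => τ.isPosDefFun_cpCoeff (φ n) v
  have hf1 := fun n => τ.cpCoeff_one v (hφ.map_one n)
  have hfn := fun n => (hpd n).norm_le_one (hf1 n)
  have hlim : ∀ s, Tendsto (fun n => τ.cpCoeff (φ n) v s) atTop (𝓝 1) := fun s =>
    tendsto_iff_norm_sub_tendsto_zero.mpr (squeeze_zero (fun _ => norm_nonneg _)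
      (fun n => τ.norm_one_sub_cpCoeff_le v s) (hφ.tendsto (v s : M)))
  obtain ⟨n, hn⟩ := hT.exists_uniform (fun n => hB.isPosDefFun_transfer u (hpd n) (hf1 n))
    (fun n => hB.transfer_one u (hf1 n)) (hB.tendsto_transfer u hfn hlim)
    -- Outside V one has 1 − Re f ≥ ε²/2, so an average defect of at most ε²/4 leaves mass at most
    -- 1/2 outside V.
    (show 0 < ε ^ 2 / 4 by positivity)
  refine ⟨n, ?_⟩
  let V : Set Λ := {s | τ.norm₂ (φ n (v s : M) - (v s : M)) < ε}
  refine exists_seq_of_forall_finset (V := V)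
    (c := fun s g => ‖τ.fourierCoeff hA.le u (v s : M) g‖) (fun _ _ => norm_nonneg _) ?_
  -- The failure yields a finite F and a δ > 0 such that every s ∈ V has a coefficient of norm at
  -- least δ on F.
  by_contra! hcon
  obtain ⟨F, δ, hδ, hF⟩ := hcon
  refine hΓ₀ (hA.isAmenableGroup_of_fourierCoeff_le hB hAam hBam Γ₀ V (fun g hg => ?_) F hδ
    fun s hs => ?_)
  · have h1 := hB.hasSum_norm_proj_sq (u g)
    have h2 := hB.re_transfer u (hfn n) g
    have h3 := (h1.sub (h1.summable.indicator V).hasSum).mul_left (ε ^ 2 / 2)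
    have h4 := hasSum_le (fun s => ?_) h3 h2
    · have h5 := h4.trans (hn g hg)
      have h6 : 0 < ε ^ 2 := by positivity
      nlinarith
    · by_cases hs : s ∈ V
      · rw [Set.indicator_of_mem hs, sub_self, mul_zero]
        have := (Complex.re_le_norm _).trans (hfn n s)
        exact mul_nonneg (by linarith) (by positivity)
      · rw [Set.indicator_of_notMem hs, sub_zero]
        refine mul_le_mul_of_nonneg_right ?_ (by positivity)
        have h5 := τ.norm_map_sub_sq_le v (hφ.map_one n) s
        have h6 : ε ^ 2 ≤ τ.norm₂ (φ n (v s) - (v s : M)) ^ 2 :=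
          pow_le_pow_left₀ hε.le (not_lt.mp hs) 2
        linarith
  · obtain ⟨g, hg, hgs⟩ := hF s hs
    exact ⟨g, hg, by rwa [← hA.norm_fourierCoeff]⟩
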